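/- Let $p$ be a prime and write $R_{(p)}=\mathbb Z_{(p)}\otimes_{\mathbb Z} R$ for the $p$-localization of a (possibly non-unital) commutative ring $R$. For a finite group $G$ let $A(G)$ be its Burnside ring (the Grothendieck ring of isomorphism classes of finite $G$-sets under disjoint union and cartesian product), with fixed point homomorphisms $\Phi_H\colon A(G)\to\mathbb Z$, $\Phi_H([X])=|X^H|$, extended to $\Phi_H\colon A(G)_{(p)}\to\mathbb Z_{(p)}$. For a fusion system $\mathcal F$ on a finite $p$-group $S$ let $A(\mathcal F)\subseteq A(S)$ be the subring of $\mathcal F$-stable elements, i.e. those $X$ whose restrictions to $A(P)$ along $\varphi$ and along the inclusion agree for all $P\le S$ and $\varphi\in\mathcal F(P,S)$. For $P\le S$ let $\beta_P\in A(\mathcal F)_{(p)}$ be the element determined by \[\Phi_Q(\beta_P)=\frac1{|[Q]_{\mathcal F}|}\sum_{Q'\in[Q]_{\mathcal F}}\Phi_{Q'}([S/P])\qquad\text{for all } Q\le S,\] where $[Q]_{\mathcal F}$ is the set of subgroups of $S$ that are $\mathcal F$-conjugate to $Q$. In both situations below there is exactly one such element for every $P\le S$. (1) Let $G$ be a finite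 group with Sylow $p$-subgroup $S$, let $\mathcal F=\mathcal F_S(G)$ be the fusion system of $G$ on $S$, and let $A(G;p)\subseteq A(G)$ be the (possibly non-unital) subring of all differences $[X]-[Y]$ of finite $G$-sets $X,Y$ all of whose isotropy subgroups are $p$-groups. Then $A(G;p)_{(p)}$ has a multiplicative unit, $[G/S]$ is invertible in $A(G;p)_{(p)}$, and there is exactly one ring isomorphism $A(\mathcal F)_{(p)}\cong A(G;p)_{(p)}$ with \[\beta_P\mapsto\frac{[G/P]}{[G/S]}\qquad\text{for all } P\le S.\] (2) Let $\mathcal F$ be a saturated fusion system on a finite $p$-group $S$. A subgroup $P\le S$ is $\mathcal F$-centric if $C_S(P')\le P'$ for all $P'\in[P]_{\mathcal F}$. Let $\mathcal O(\mathcal F^c)$ be the category whose objects are the $\mathcal F$-centric subgroups of $S$ and whose morphisms $P\to Q$ are the classes in $\mathrm{Inn}(Q)\backslash\mathcal F(P,Q)$, and let $\mathcal O(\mathcal F^c)_{\sqcup}$ be the category of finite formal coproducts of its objects. This category has binary products. Let $A^{cent}(\mathcal F)$ be the Diaz--Libman centric Burnside ring, i.e. the Grothendieck group of the monoid of isomorphism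 classes of objects of $\mathcal O(\mathcal F^c)_{\sqcup}$ under formal coproduct, with the multiplication induced by the product of $\mathcal O(\mathcal F^c)_{\sqcup}$, and let $\xi_P\in A^{cent}(\mathcal F)$ be the class of an $\mathcal F$-centric $P$. Let $N$ be the $\mathbb Z_{(p)}$-submodule of $A(\mathcal F)_{(p)}$ generated by the $\beta_P$ for all $P\le S$ that are not $\mathcal F$-centric. Then $N$ is an ideal of $A(\mathcal F)_{(p)}$, the ring $A^{cent}(\mathcal F)_{(p)}$ has a multiplicative unit, $\xi_S$ is invertible in $A^{cent}(\mathcal F)_{(p)}$, and there is exactly one ring isomorphism $A(\mathcal F)_{(p)}/N\cong A^{cent}(\mathcal F)_{(p)}$ with \[\overline{\beta_P}\mapsto\frac{\xi_P}{\xi_S}\qquad\text{for all }\mathcal F\text{-centric } P\le S.\] -/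

import Mathlib

open CategoryTheory CategoryTheory.Limits
open scoped TensorProduct

universe u

noncomputable section

/-- The Grothendieck group of the additive monoid of a commutative semiring (possibly without
`1`); it carries the multiplication extended bilinearly from the semiring. -/
def GrothendieckRing (R : Type*) [AddCommMonoid R] : Type _ := Algebra.GrothendieckAddGroup R

namespace GrothendieckRing

instance (R : Type*) [AddCommMonoid R] : AddCommGroup (GrothendieckRing R) :=
  inferInstanceAs (AddCommGroup (Algebra.GrothendieckAddGroup R))

section Additive

variable {R : Type*} [AddCommMonoid R]

def of : R →+ GrothendieckRing R := Algebra.GrothendieckAddGroup.of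

def liftAdd {H : Type*} [AddCommGroup H] (f : R →+ H) : GrothendieckRing R →+ H :=
  Algebra.GrothendieckAddGroup.lift f

@[simp]
theorem liftAdd_of {H : Type*} [AddCommGroup H] (f : R →+ H) (a : R) :
    liftAdd f (of a) = f a :=
  DFunLike.congr_fun (Algebra.GrothendieckAddGroup.lift.symm_apply_apply f) a

theorem addHom_ext {H : Type*} [AddCommGroup H] {f g : GrothendieckRing R →+ H}
    (h : ∀ a, f (of a) = g (of a)) : f = g :=
  Algebra.GrothendieckAddGroup.lift.symm.injective (AddMonoidHom.ext h)

end Additive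

section NonUnital

variable {R : Type*} [NonUnitalCommSemiring R]

def mulHom : GrothendieckRing R →+ GrothendieckRing R →+ GrothendieckRing R :=
  liftAdd
    { toFun := fun a => liftAdd (of.comp (AddMonoidHom.mulLeft a))
      map_zero' := addHom_ext fun b => by simp
      map_add' := fun a a' => addHom_ext fun b => by simp [add_mul] }

instance : Mul (GrothendieckRing R) := ⟨fun x y => mulHom x y⟩

theorem mul_def (x y : GrothendieckRing R) : x * y = mulHom x y := rfl

@[simp]
theorem of_mul (a b : R) : (of (a * b) : GrothendieckRing R) = of a * of b := by
  simp [mul_def, mulHom]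

theorem induction {P : GrothendieckRing R → Prop} (x : GrothendieckRing R)
    (h : ∀ a b, P (of a - of b)) : P x := by
  suffices H : ∀ y : R × (⊤ : AddSubmonoid R),
      P (AddLocalization.mk y.1 y.2 : Algebra.GrothendieckAddGroup R) from
    AddLocalization.induction_on x H
  rintro ⟨a, b⟩
  have e : (AddLocalization.mk a b : Algebra.GrothendieckAddGroup R) =
      Algebra.GrothendieckAddGroup.of a - Algebra.GrothendieckAddGroup.of (b : R) := by
    rw [eq_sub_iff_add_eq]
    change _ + AddLocalization.addMonoidOf _ (b : R) = AddLocalization.addMonoidOf _ a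
    rw [← AddLocalization.mk_zero_eq_addMonoidOf_mk, ← AddLocalization.mk_zero_eq_addMonoidOf_mk,
      AddLocalization.mk_add, AddLocalization.mk_eq_mk_iff, AddLocalization.r_iff_exists]
    exact ⟨0, by simp [add_comm]⟩
  exact e ▸ h a b

instance : NonUnitalNonAssocRing (GrothendieckRing R) where
  left_distrib x y z := map_add (mulHom x) y z
  right_distrib x y z := by simp [mul_def]
  zero_mul x := by simp [mul_def]
  mul_zero x := by simp [mul_def]

instance : NonUnitalCommRing (GrothendieckRing R) where
  mul_assoc x y z := by
    induction x using induction with | _ a a'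
    induction y using induction with | _ b b'
    induction z using induction with | _ c c'
    simp only [mul_sub, sub_mul, ← of_mul, mul_assoc]
  mul_comm x y := by
    induction x using induction with | _ a a'
    induction y using induction with | _ b b'
    simp only [mul_sub, sub_mul, ← of_mul, mul_comm b, mul_comm b']
    abel

end NonUnital

section Unital

variable {R : Type*} [CommSemiring R]

instance : One (GrothendieckRing R) := ⟨of 1⟩

theorem of_one : (of 1 : GrothendieckRing R) = 1 := rfl

instance : CommRing (GrothendieckRing R) where
  __ := (inferInstance : NonUnitalCommRing (GrothendieckRing R))
  one_mul x := by
    induction x using induction with | _ a a'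
    simp only [mul_sub, ← of_one, ← of_mul, one_mul]
  mul_one x := by
    induction x using induction with | _ a a'
    simp only [sub_mul, ← of_one, ← of_mul, mul_one]

def ofHom : R →+* GrothendieckRing R where
  __ := of (R := R)
  map_one' := rfl
  map_mul' := of_mul

/-- The extension of a semiring homomorphism into a commutative ring. -/
def lift {T : Type*} [CommRing T] (f : R →+* T) : GrothendieckRing R →+* T where
  __ := liftAdd (f : R →+ T)
  map_one' := by
    change liftAdd (f : R →+ T) (of 1) = 1
    simp
  map_mul' x y := by
    change liftAdd (f : R →+ T) _ = liftAdd (f : R →+ T) _ * liftAdd (f : R →+ T) _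
    induction x using induction with | _ a a'
    induction y using induction with | _ b b'
    simp only [mul_sub, sub_mul, ← of_mul, map_sub, liftAdd_of]
    simp

end Unital

end GrothendieckRing

/-! ### Finite `G`-sets and the Burnside ring -/

/-- A finite set with an action of `G`. -/
structure FinGSet (G : Type u) [Group G] where
  carrier : Type u
  [finite : Finite carrier]
  [action : MulAction G carrier]

namespace FinGSet

variable {G : Type u} [Group G]

instance : CoeSort (FinGSet G) (Type u) := ⟨carrier⟩

attribute [instance] FinGSet.finite FinGSet.action

/-- Isomorphism of `G`-sets. -/
def Isom (X Y : FinGSet G) : Prop := ∃ e : X ≃ Y, ∀ (g : G) (x : X), e (g • x) = g • e x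

instance setoid (G : Type u) [Group G] : Setoid (FinGSet G) where
  r := Isom
  iseqv :=
    { refl := fun _ => ⟨Equiv.refl _, fun _ _ => rfl⟩
      symm := fun ⟨e, he⟩ => ⟨e.symm, fun g y => by
        rw [Equiv.symm_apply_eq, he, Equiv.apply_symm_apply]⟩
      trans := fun ⟨e, he⟩ ⟨f, hf⟩ => ⟨e.trans f, fun g x => by simp [he, hf]⟩ }

/-- The empty `G`-set. -/
def empty (G : Type u) [Group G] : FinGSet G :=
  letI : MulAction G PEmpty.{u + 1} :=
    { smul := fun _ x => x, one_smul := fun _ => rfl, mul_smul := fun _ _ _ => rfl }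
  ⟨PEmpty⟩

/-- The one-point `G`-set. -/
def point (G : Type u) [Group G] : FinGSet G := ⟨PUnit⟩

/-- Disjoint union. -/
def sum (X Y : FinGSet G) : FinGSet G := ⟨X ⊕ Y⟩

/-- Cartesian product with the diagonal action. -/
def prod (X Y : FinGSet G) : FinGSet G := ⟨X × Y⟩

/-- The transitive `G`-set `G/H`. -/
def coset [Finite G] (H : Subgroup G) : FinGSet G := ⟨G ⧸ H⟩

/-- Restriction of the action along a group homomorphism `φ : H → G`. -/
def res {H : Type u} [Group H] (φ : H →* G) (X : FinGSet G) : FinGSet H :=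
  letI : MulAction H X := MulAction.compHom X φ
  ⟨X⟩

/-- The number of `P`-fixed points. -/
def numFixed (P : Subgroup G) (X : FinGSet G) : ℕ :=
  Nat.card {x : X // ∀ g ∈ P, g • x = x}

/-- The semiring of isomorphism classes of finite `G`-sets. -/
def Classes (G : Type u) [Group G] : Type (u + 1) := Quotient (setoid G)

namespace Classes

def mk (X : FinGSet G) : Classes G := Quotient.mk _ X

theorem mk_eq {X Y : FinGSet G} (e : X ≃ Y) (he : ∀ (g : G) (x : X), e (g • x) = g • e x) :
    mk X = mk Y := Quotient.sound ⟨e, he⟩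

instance : Zero (Classes G) := ⟨mk (empty G)⟩

instance : One (Classes G) := ⟨mk (point G)⟩

instance : Add (Classes G) :=
  ⟨Quotient.map₂ sum fun _ _ ⟨e, he⟩ _ _ ⟨f, hf⟩ => ⟨Equiv.sumCongr e f, fun g x => by
    rcases x with x | x
    · exact congrArg Sum.inl (he g x)
    · exact congrArg Sum.inr (hf g x)⟩⟩

instance : Mul (Classes G) :=
  ⟨Quotient.map₂ prod fun _ _ ⟨e, he⟩ _ _ ⟨f, hf⟩ => ⟨Equiv.prodCongr e f, fun g x =>
    Prod.ext (he g x.1) (hf g x.2)⟩⟩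

theorem mk_add (X Y : FinGSet G) : mk (sum X Y) = mk X + mk Y := rfl

theorem mk_mul (X Y : FinGSet G) : mk (prod X Y) = mk X * mk Y := rfl

instance : CommSemiring (Classes G) where
  add_assoc := by
    rintro ⟨X⟩ ⟨Y⟩ ⟨Z⟩
    exact mk_eq (Equiv.sumAssoc X Y Z) (by rintro g ((x | x) | x) <;> rfl)
  zero_add := by
    rintro ⟨X⟩
    exact mk_eq (Equiv.emptySum PEmpty X) (by rintro g (x | x); exacts [x.elim, rfl])
  add_zero := by
    rintro ⟨X⟩
    exact mk_eq (Equiv.sumEmpty X PEmpty) (by rintro g (x | x); exacts [rfl, x.elim])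
  add_comm := by
    rintro ⟨X⟩ ⟨Y⟩
    exact mk_eq (Equiv.sumComm X Y) (by rintro g (x | x) <;> rfl)
  left_distrib := by
    rintro ⟨X⟩ ⟨Y⟩ ⟨Z⟩
    exact mk_eq (Equiv.prodSumDistrib X Y Z) (by rintro g ⟨x, (y | y)⟩ <;> rfl)
  right_distrib := by
    rintro ⟨X⟩ ⟨Y⟩ ⟨Z⟩
    exact mk_eq (Equiv.sumProdDistrib X Y Z) (by rintro g ⟨(x | x), y⟩ <;> rfl)
  zero_mul := by
    rintro ⟨X⟩
    exact mk_eq (Equiv.pemptyProd X) (by rintro g ⟨x, _⟩; exact x.elim)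
  mul_zero := by
    rintro ⟨X⟩
    exact mk_eq (Equiv.prodPEmpty X) (by rintro g ⟨_, x⟩; exact x.elim)
  mul_assoc := by
    rintro ⟨X⟩ ⟨Y⟩ ⟨Z⟩
    exact mk_eq (Equiv.prodAssoc X Y Z) (by rintro g ⟨⟨x, y⟩, z⟩; rfl)
  one_mul := by
    rintro ⟨X⟩
    exact mk_eq (Equiv.punitProd X) (by rintro g ⟨x, y⟩; rfl)
  mul_one := by
    rintro ⟨X⟩
    exact mk_eq (Equiv.prodPUnit X) (by rintro g ⟨x, y⟩; rfl)
  mul_comm := by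
    rintro ⟨X⟩ ⟨Y⟩
    exact mk_eq (Equiv.prodComm X Y) (by rintro g ⟨x, y⟩; rfl)
  nsmul := nsmulRec

/-- Restriction along `φ` on isomorphism classes. -/
def res {H : Type u} [Group H] (φ : H →* G) : Classes G →+* Classes H where
  toFun := Quotient.map (FinGSet.res φ) fun _ _ ⟨e, he⟩ => ⟨e, fun h x => he (φ h) x⟩
  map_zero' := mk_eq (Equiv.refl PEmpty) (fun _ x => x.elim)
  map_one' := mk_eq (Equiv.refl PUnit) (fun _ _ => rfl)
  map_add' := by
    rintro ⟨X⟩ ⟨Y⟩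
    exact mk_eq (Equiv.refl (X ⊕ Y)) (by rintro g (x | x) <;> rfl)
  map_mul' := by
    rintro ⟨X⟩ ⟨Y⟩
    exact mk_eq (Equiv.refl (X × Y)) (fun _ _ => rfl)

/-- The number of `P`-fixed points on isomorphism classes. -/
def numFixed (P : Subgroup G) : Classes G →+* ℕ where
  toFun := Quotient.lift (FinGSet.numFixed P) fun X Y ⟨e, he⟩ =>
    Nat.card_congr (e.subtypeEquiv fun x => by simp [← he])
  map_zero' := by
    have : IsEmpty {x : empty G // ∀ g ∈ P, g • x = x} := ⟨fun x => x.1.elim⟩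
    exact Nat.card_of_isEmpty
  map_one' := by
    have : Unique {x : point G // ∀ g ∈ P, g • x = x} :=
      { default := ⟨PUnit.unit, fun _ _ => rfl⟩, uniq := fun _ => rfl }
    exact Nat.card_unique
  map_add' := by
    rintro ⟨X⟩ ⟨Y⟩
    refine Eq.trans (Nat.card_congr ?_) (Nat.card_sum (α := {x : X // ∀ g ∈ P, g • x = x})
      (β := {x : Y // ∀ g ∈ P, g • x = x}))
    refine (Equiv.subtypeSum (α := X) (β := Y)).trans (Equiv.sumCongr ?_ ?_)
    · exact Equiv.subtypeEquivRight fun x => forall₂_congr fun g _ => Sum.inl_injective.eq_iff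
    · exact Equiv.subtypeEquivRight fun x => forall₂_congr fun g _ => Sum.inr_injective.eq_iff
  map_mul' := by
    rintro ⟨X⟩ ⟨Y⟩
    refine Eq.trans (Nat.card_congr ?_) (Nat.card_prod {x : X // ∀ g ∈ P, g • x = x}
      {x : Y // ∀ g ∈ P, g • x = x})
    refine Equiv.trans (Equiv.subtypeEquivRight fun x => ?_)
      (Equiv.subtypeProdEquivProd (p := fun x : X => ∀ g ∈ P, g • x = x)
        (q := fun y : Y => ∀ g ∈ P, g • y = y))
    exact ⟨fun h => ⟨fun g hg => congrArg Prod.fst (h g hg), fun g hg => congrArg Prod.snd (h g hg)⟩,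
      fun h g hg => Prod.ext (h.1 g hg) (h.2 g hg)⟩

end Classes

end FinGSet

/-- The Burnside ring `A(G)`. -/
abbrev Burnside (G : Type u) [Group G] : Type (u + 1) := GrothendieckRing (FinGSet.Classes G)

namespace Burnside

variable {G : Type u} [Group G]

/-- The class `[X]` of a finite `G`-set. -/
def cls (X : FinGSet G) : Burnside G := GrothendieckRing.of (FinGSet.Classes.mk X)

/-- The restriction homomorphism `r_φ : A(G) → A(H)` along `φ : H → G`. -/
def res {H : Type u} [Group H] (φ : H →* G) : Burnside G →+* Burnside H :=
  GrothendieckRing.lift (GrothendieckRing.ofHom.comp (FinGSet.Classes.res φ))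

/-- The fixed point homomorphism `Φ_P : A(G) → ℤ`. -/
def mark (P : Subgroup G) : Burnside G →+* ℤ :=
  GrothendieckRing.lift ((Nat.castRingHom ℤ).comp (FinGSet.Classes.numFixed P))

end Burnside

/-! ### The part of `A(G)` with `p`-group isotropy -/

/-- All isotropy subgroups of `X` are `p`-groups. -/
def FinGSet.HasPIsotropy {G : Type u} [Group G] (p : ℕ) (X : FinGSet G) : Prop :=
  ∀ x : X, IsPGroup p (MulAction.stabilizer G x)

namespace FinGSet.HasPIsotropy

variable {G : Type u} [Group G] {p : ℕ} {X Y : FinGSet G}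

theorem empty : (FinGSet.empty G).HasPIsotropy p := fun x => PEmpty.elim x

theorem sum (hX : X.HasPIsotropy p) (hY : Y.HasPIsotropy p) : (X.sum Y).HasPIsotropy p := by
  rintro (x | x)
  · exact (hX x).to_le fun _ hg => Sum.inl_injective hg
  · exact (hY x).to_le fun _ hg => Sum.inr_injective hg

theorem prod (hX : X.HasPIsotropy p) : (X.prod Y).HasPIsotropy p := fun x =>
  (hX x.1).to_le fun _ hg => congrArg Prod.fst hg

theorem coset [Finite G] {H : Subgroup G} (hH : IsPGroup p H) :
    (FinGSet.coset H).HasPIsotropy p := by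
  intro x
  induction x using QuotientGroup.induction_on with | _ g
  intro k
  have hk : g⁻¹ * (k : G) * g ∈ H := by
    have h : (k : G) • (g : G ⧸ H) = g := k.2
    rw [MulAction.Quotient.smul_coe, smul_eq_mul, eq_comm, QuotientGroup.eq] at h
    simpa [mul_assoc] using h
  obtain ⟨n, hn⟩ := hH ⟨_, hk⟩
  refine ⟨n, Subtype.ext ?_⟩
  have h2 : (g⁻¹ * (k : G) * g) ^ p ^ n = 1 := congrArg Subtype.val hn
  have h3 : (g⁻¹ * (k : G) * g⁻¹⁻¹) ^ p ^ n = 1 := by simpa using h2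
  rw [conj_pow] at h3
  simpa [mul_eq_one_iff_eq_inv] using h3

end FinGSet.HasPIsotropy

/-- The subring `A(G;p)` of `A(G)` where all isotropy subgroups are `p`-groups. It need not
contain the unit element of `A(G)`. -/
def Burnside.pPart (p : ℕ) (G : Type u) [Group G] : NonUnitalSubring (Burnside G) where
  carrier := {x | ∃ X Y : FinGSet G, X.HasPIsotropy p ∧ Y.HasPIsotropy p ∧
    x = Burnside.cls X - Burnside.cls Y}
  zero_mem' := ⟨_, _, .empty, .empty, (sub_self _).symm⟩
  add_mem' := by
    rintro _ _ ⟨X, Y, hX, hY, rfl⟩ ⟨X', Y', hX', hY', rfl⟩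
    refine ⟨_, _, hX.sum hX', hY.sum hY', ?_⟩
    simp only [Burnside.cls, FinGSet.Classes.mk_add, map_add]
    abel
  neg_mem' := by
    rintro _ ⟨X, Y, hX, hY, rfl⟩
    exact ⟨Y, X, hY, hX, by abel⟩
  mul_mem' := by
    rintro _ _ ⟨X, Y, hX, hY, rfl⟩ ⟨X', Y', hX', hY', rfl⟩
    refine ⟨_, _, (hX.prod (Y := X')).sum (hY.prod (Y := Y')),
      (hX.prod (Y := Y')).sum (hY.prod (Y := X')), ?_⟩
    simp only [Burnside.cls, FinGSet.Classes.mk_add, FinGSet.Classes.mk_mul, map_add,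
      GrothendieckRing.of_mul]
    ring

/-- The element `[G/H]` of `A(G;p)`, for a `p`-subgroup `H`. -/
def Burnside.pCoset {p : ℕ} {G : Type u} [Group G] [Finite G] (H : Subgroup G)
    (hH : IsPGroup p H) : Burnside.pPart p G :=
  ⟨Burnside.cls (FinGSet.coset H), FinGSet.coset H, FinGSet.empty G, .coset hH, .empty, by
    have h : Burnside.cls (FinGSet.empty G) = 0 := map_zero GrothendieckRing.of
    rw [h, sub_zero]⟩

/-! ### `p`-localization -/

instance (p : ℕ) [Fact p.Prime] : (Ideal.span {(p : ℤ)}).IsPrime :=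
  (Ideal.span_singleton_prime (by exact_mod_cast (Fact.out : p.Prime).ne_zero)).2
    (Nat.prime_iff_prime_int.1 Fact.out)

/-- The ring `ℤ_(p)`. -/
def ZLoc (p : ℕ) [Fact p.Prime] : Type := Localization.AtPrime (Ideal.span {(p : ℤ)})

instance (p : ℕ) [Fact p.Prime] : CommRing (ZLoc p) :=
  inferInstanceAs (CommRing (Localization.AtPrime (Ideal.span {(p : ℤ)})))

/-- The `p`-localization `A_(p) = ℤ_(p) ⊗ A` of a (possibly non-unital) ring `A`. -/
abbrev PLoc (p : ℕ) [Fact p.Prime] (A : Type*) [AddCommGroup A] : Type _ := ZLoc p ⊗[ℤ] A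

/-- The image of an element in the `p`-localization. -/
abbrev PLoc.of (p : ℕ) [Fact p.Prime] {A : Type*} [AddCommGroup A] (a : A) : PLoc p A :=
  (1 : ZLoc p) ⊗ₜ[ℤ] a

/-- The extension `A_(p) → ℤ_(p)` of a ring homomorphism `A → ℤ`. -/
def PLoc.extend (p : ℕ) [Fact p.Prime] {A : Type*} [CommRing A] (f : A →+* ℤ) :
    PLoc p A →ₐ[ZLoc p] ZLoc p :=
  Algebra.TensorProduct.lift (Algebra.ofId (ZLoc p) (ZLoc p))
    ((algebraMap ℤ (ZLoc p)).comp f).toIntAlgHom (fun _ _ => Commute.all _ _)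

/-- `x` is invertible in `R`, where having a multiplicative unit is part of the claim. -/
def IsInvertibleIn {R : Type*} [Mul R] (x : R) : Prop :=
  ∃ e : R, (∀ y, e * y = y ∧ y * e = y) ∧ ∃ z, x * z = e ∧ z * x = e

/-! ### Fusion systems -/

/-- A fusion system on a (finite `p`-)group `S`: for all subgroups `P, Q ≤ S` a set
`hom P Q` of injective group homomorphisms, closed under composition, containing all
homomorphisms induced by conjugation in `S`, and containing, for each of its members `φ`,
the isomorphism `φ : P → φ(P)` and its inverse. -/
structure FusionSystem (S : Type u) [Group S] where
  hom : (P Q : Subgroup S) → Set (P →* Q)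
  injective : ∀ {P Q : Subgroup S} {φ : P →* Q}, φ ∈ hom P Q → Function.Injective φ
  comp_mem : ∀ {P Q R : Subgroup S} {φ : P →* Q} {ψ : Q →* R},
    φ ∈ hom P Q → ψ ∈ hom Q R → ψ.comp φ ∈ hom P R
  conj_mem : ∀ {P Q : Subgroup S} (s : S) (φ : P →* Q),
    (∀ x : P, (φ x : S) = s * x * s⁻¹) → φ ∈ hom P Q
  equiv_mem : ∀ {P Q R : Subgroup S} {φ : P →* Q} (e : P ≃* R), φ ∈ hom P Q →
    (∀ x : P, (e x : S) = φ x) → e.toMonoidHom ∈ hom P R ∧ e.symm.toMonoidHom ∈ hom R P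

/-- The fusion system `F_S(G)` of a group `G` on a subgroup `S`. -/
def fusionOfGroup {G : Type u} [Group G] (S : Subgroup G) : FusionSystem S where
  hom P Q := {φ | ∃ g : G, ∀ x : P, ((φ x : S) : G) = g * ((x : S) : G) * g⁻¹}
  injective := by
    rintro P Q φ ⟨g, hg⟩ x y hxy
    have h := (hg x).symm.trans ((congrArg (fun z : Q => ((z : S) : G)) hxy).trans (hg y))
    exact Subtype.ext (Subtype.ext (by simpa using h))
  comp_mem := by
    rintro P Q R φ ψ ⟨g, hg⟩ ⟨h, hh⟩
    refine ⟨h * g, fun x => ?_⟩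
    rw [MonoidHom.comp_apply, hh, hg]
    group
  conj_mem := by
    intro P Q s φ h
    exact ⟨s, fun x => by rw [h]; rfl⟩
  equiv_mem := by
    rintro P Q R φ e ⟨g, hg⟩ he
    have key : ∀ x : P, ((e x : S) : G) = g * ((x : S) : G) * g⁻¹ := fun x => by rw [he, hg]
    refine ⟨⟨g, key⟩, ⟨g⁻¹, fun y => ?_⟩⟩
    have := key (e.symm y)
    rw [MulEquiv.apply_symm_apply] at this
    rw [this]
    simp [mul_assoc]

namespace FusionSystem

variable {S : Type u} [Group S] (F : FusionSystem S)

/-- `P` and `Q` are `F`-conjugate: they are isomorphic in `F`. -/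
def Conj (P Q : Subgroup S) : Prop := ∃ φ ∈ F.hom P Q, Function.Bijective φ

/-- The `F`-conjugacy class `[P]_F`. -/
def conjClass (P : Subgroup S) : Set (Subgroup S) := {Q | F.Conj P Q}

def FullyNormalized (P : Subgroup S) : Prop :=
  ∀ Q ∈ F.conjClass P, Nat.card (Subgroup.normalizer (Q : Set S)) ≤
    Nat.card (Subgroup.normalizer (P : Set S))

def FullyCentralized (P : Subgroup S) : Prop :=
  ∀ Q ∈ F.conjClass P, Nat.card (Subgroup.centralizer (Q : Set S)) ≤
    Nat.card (Subgroup.centralizer (P : Set S))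

/-- `F`-centric subgroups. -/
def IsCentric (P : Subgroup S) : Prop :=
  ∀ Q ∈ F.conjClass P, Subgroup.centralizer (Q : Set S) ≤ Q

/-- The automorphism group `Aut_F(P)`. -/
def aut (P : Subgroup S) : Subgroup (MulAut P) where
  carrier := {α | α.toMonoidHom ∈ F.hom P P}
  one_mem' := F.conj_mem 1 _ (fun x => by simp)
  mul_mem' := fun ha hb => F.comp_mem hb ha
  inv_mem' := fun {α} ha => (F.equiv_mem α ha fun _ => rfl).2

/-- `Aut_S(P)`, the automorphisms of `P` induced by conjugation in `S`. -/
def autS (P : Subgroup S) : Subgroup (MulAut P) where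
  carrier := {α | ∃ s : S, ∀ x : P, (α x : S) = s * x * s⁻¹}
  one_mem' := ⟨1, fun x => by simp⟩
  mul_mem' := by
    rintro α β ⟨s, hs⟩ ⟨t, ht⟩
    exact ⟨s * t, fun x => by rw [MulAut.mul_apply, hs, ht]; group⟩
  inv_mem' := by
    rintro α ⟨s, hs⟩
    refine ⟨s⁻¹, fun x => ?_⟩
    have := hs (α⁻¹ x)
    rw [MulAut.apply_inv_self] at this
    rw [this]
    group

/-- `N_φ = {x ∈ N_S(P) | ∃ y ∈ S, φ ∘ c_x = c_y ∘ φ}` for a homomorphism `φ : P → S`. -/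
def extensionDomain {P : Subgroup S} (φ : P →* (⊤ : Subgroup S)) : Subgroup S where
  carrier := {x | x ∈ Subgroup.normalizer (P : Set S) ∧
    ∃ y : S, ∀ u v : P, (v : S) = x * u * x⁻¹ → (φ v : S) = y * φ u * y⁻¹}
  one_mem' := ⟨one_mem _, 1, fun u v h => by
    have : v = u := Subtype.ext (by simpa using h)
    simp [this]⟩
  mul_mem' := by
    rintro a b ⟨ha, y, hy⟩ ⟨hb, z, hz⟩
    refine ⟨mul_mem ha hb, y * z, fun u v h => ?_⟩
    have hw : b * u * b⁻¹ ∈ P := (Subgroup.mem_normalizer_iff.1 hb u).1 u.2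
    rw [hy ⟨_, hw⟩ v (by rw [h]; group), hz u ⟨_, hw⟩ rfl]
    group
  inv_mem' := by
    rintro a ⟨ha, y, hy⟩
    refine ⟨inv_mem ha, y⁻¹, fun u v h => ?_⟩
    rw [hy v u (by rw [h]; group)]
    group

theorem le_extensionDomain {P : Subgroup S} (φ : P →* (⊤ : Subgroup S)) :
    P ≤ extensionDomain φ := fun x hx =>
  ⟨Subgroup.le_normalizer hx, φ ⟨x, hx⟩, fun u v h => by
    have : v = ⟨x, hx⟩ * u * ⟨x, hx⟩⁻¹ := Subtype.ext h
    rw [this, map_mul, map_mul, map_inv]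
    rfl⟩

/-- Saturation of a fusion system on a finite `p`-group. -/
structure IsSaturated (p : ℕ) : Prop where
  fullyNormalized : ∀ P : Subgroup S, F.FullyNormalized P → F.FullyCentralized P ∧
    ∃ T : Sylow p (F.aut P), (T : Subgroup (F.aut P)) = (autS P).subgroupOf (F.aut P)
  extension : ∀ (P : Subgroup S), ∀ φ ∈ F.hom P ⊤,
    F.FullyCentralized (φ.range.map (⊤ : Subgroup S).subtype) →
    ∃ ψ ∈ F.hom (extensionDomain φ) ⊤,
      ψ.comp (Subgroup.inclusion (le_extensionDomain φ)) = φ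

/-! ### The Burnside ring of a fusion system -/

/-- The Burnside ring `A(F)`: the subring of `A(S)` of all `F`-stable elements. -/
def burnside : Subring (Burnside S) where
  carrier := {X | ∀ (P : Subgroup S), ∀ φ ∈ F.hom P ⊤,
    Burnside.res ((⊤ : Subgroup S).subtype.comp φ) X = Burnside.res P.subtype X}
  zero_mem' := fun P φ _ => by simp
  one_mem' := fun P φ _ => by simp
  add_mem' := fun hx hy P φ h => by simp [hx P φ h, hy P φ h]
  mul_mem' := fun hx hy P φ h => by simp [hx P φ h, hy P φ h]
  neg_mem' := fun hx P φ h => by simp [hx P φ h]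

variable (p : ℕ) [Fact p.Prime]

/-- `Y ∈ A(F)_(p)` is the stabilization of `X ∈ A(S)_(p)`: for every `Q ≤ S`, `Φ_Q(Y)` is the
average of the numbers `Φ_{Q'}(X)` over the `F`-conjugates `Q'` of `Q`. -/
def IsStabilization (X : PLoc p (Burnside S)) (Y : PLoc p F.burnside) : Prop :=
  ∀ Q : Subgroup S,
    (Nat.card (F.conjClass Q) : ZLoc p) *
        PLoc.extend p ((Burnside.mark Q).comp F.burnside.subtype) Y =
      ∑ᶠ Q' ∈ F.conjClass Q, PLoc.extend p (Burnside.mark Q') X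

/-- The stabilization map `π : A(S)_(p) → A(F)_(p)`. -/
def stabilization (X : PLoc p (Burnside S)) : PLoc p F.burnside :=
  Classical.epsilon (F.IsStabilization p X)

/-- `β_P = π([S/P])`. -/
def beta [Finite S] (P : Subgroup S) : PLoc p F.burnside :=
  F.stabilization p (PLoc.of p (Burnside.cls (FinGSet.coset P)))

/-- The `ℤ_(p)`-submodule `N` of `A(F)_(p)` generated by `β_P` for non-centric `P`. -/
def nonCentricSpan [Finite S] : Submodule (ZLoc p) (PLoc p F.burnside) :=
  Submodule.span (ZLoc p) {b | ∃ P : Subgroup S, ¬ F.IsCentric P ∧ b = F.beta p P}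

/-! ### The orbit category of centric subgroups -/

/-- The objects of the orbit category `O(F^c)`: the `F`-centric subgroups. -/
structure OrbitCat where
  subgroup : Subgroup S
  centric : F.IsCentric subgroup

variable {F} in
/-- Morphisms of `F` that differ by an inner automorphism of the target. -/
def innSetoid (P Q : Subgroup S) : Setoid (F.hom P Q) where
  r φ ψ := ∃ q : Q, ∀ x : P, ψ.1 x = q * φ.1 x * q⁻¹
  iseqv :=
    { refl := fun _ => ⟨1, fun x => by simp⟩
      symm := fun ⟨q, h⟩ => ⟨q⁻¹, fun x => by rw [h]; group⟩
      trans := fun ⟨q, h⟩ ⟨r, h'⟩ => ⟨r * q, fun x => by rw [h', h]; group⟩ }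

/-- `Hom_{O(F^c)}(P, Q) = Inn(Q) \ F(P, Q)`. -/
instance : Category.{u} F.OrbitCat where
  Hom P Q := Quotient (innSetoid (F := F) P.subgroup Q.subgroup)
  id P := Quotient.mk _ ⟨MonoidHom.id _, F.conj_mem 1 _ fun x => by simp⟩
  comp f g := Quotient.map₂ (fun φ ψ => ⟨ψ.1.comp φ.1, F.comp_mem φ.2 ψ.2⟩)
    (by
      rintro φ φ' ⟨q, hq⟩ ψ ψ' ⟨r, hr⟩
      refine ⟨r * ψ.1 q, fun x => ?_⟩
      simp only [MonoidHom.comp_apply, hq, hr, map_mul, map_inv]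
      group) f g
  id_comp := by rintro _ _ ⟨φ⟩; rfl
  comp_id := by rintro _ _ ⟨φ⟩; rfl
  assoc := by rintro _ _ _ _ ⟨φ⟩ ⟨ψ⟩ ⟨χ⟩; rfl

end FusionSystem

/-! ### Finite formal coproducts and their Grothendieck ring -/

/-- The category `C_⊔` of finite formal coproducts of objects of `C`. -/
abbrev FinCoprod (C : Type u) [Category.{u} C] : Type _ :=
  ObjectProperty.FullSubcategory (fun X : FormalCoproduct.{0} C => Finite X.I)

namespace FinCoprod

variable {C : Type u} [Category.{u} C]

/-- An object of `C`, as a formal coproduct with one summand. -/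
def single (A : C) : FinCoprod C :=
  ⟨(FormalCoproduct.incl C).obj A, inferInstanceAs (Finite PUnit)⟩

/-- The empty formal coproduct. -/
def empty (C : Type u) [Category.{u} C] : FinCoprod C :=
  ⟨⟨Empty, Empty.elim⟩, inferInstanceAs (Finite Empty)⟩

/-- The concatenation of two formal coproducts. -/
def sum (X Y : FinCoprod C) : FinCoprod C :=
  ⟨⟨X.obj.I ⊕ Y.obj.I, Sum.elim X.obj.obj Y.obj.obj⟩,
    have := X.property; have := Y.property; inferInstanceAs (Finite (X.obj.I ⊕ Y.obj.I))⟩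

/-- Morphisms of formal coproducts as families. -/
def homEquiv (X Y : FinCoprod C) :
    (X ⟶ Y) ≃ ∀ i : X.obj.I, Σ j : Y.obj.I, (X.obj.obj i ⟶ Y.obj.obj j) where
  toFun f i := ⟨f.hom.f i, f.hom.φ i⟩
  invFun g := ObjectProperty.homMk ⟨fun i => (g i).1, fun i => (g i).2⟩
  left_inv _ := rfl
  right_inv _ := rfl

theorem homEquiv_comp {X Y Z : FinCoprod C} (f : X ⟶ Y) (g : Y ⟶ Z) (i : X.obj.I) :
    homEquiv X Z (f ≫ g) i = ⟨(homEquiv Y Z g (homEquiv X Y f i).1).1,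
      (homEquiv X Y f i).2 ≫ (homEquiv Y Z g (homEquiv X Y f i).1).2⟩ := rfl

theorem ext_family {X Y : FinCoprod C} {f g : X ⟶ Y}
    (h : ∀ i, homEquiv X Y f i = homEquiv X Y g i) : f = g :=
  (homEquiv X Y).injective (funext h)

def inl (X Y : FinCoprod C) : X ⟶ sum X Y := (homEquiv _ _).symm fun i => ⟨Sum.inl i, 𝟙 _⟩

def inr (X Y : FinCoprod C) : Y ⟶ sum X Y := (homEquiv _ _).symm fun i => ⟨Sum.inr i, 𝟙 _⟩

def desc {X Y Z : FinCoprod C} (f : X ⟶ Z) (g : Y ⟶ Z) : sum X Y ⟶ Z :=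
  (homEquiv _ _).symm fun i => match i with
    | Sum.inl i => homEquiv _ _ f i
    | Sum.inr i => homEquiv _ _ g i

theorem inl_desc {X Y Z : FinCoprod C} (f : X ⟶ Z) (g : Y ⟶ Z) : inl X Y ≫ desc f g = f :=
  ext_family fun _ => Sigma.ext rfl (heq_of_eq (Category.id_comp _))

theorem inr_desc {X Y Z : FinCoprod C} (f : X ⟶ Z) (g : Y ⟶ Z) : inr X Y ≫ desc f g = g :=
  ext_family fun _ => Sigma.ext rfl (heq_of_eq (Category.id_comp _))

theorem homEquiv_comp_inl {X Y Z : FinCoprod C} (f : Z ⟶ X) (i : Z.obj.I) :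
    homEquiv _ _ (f ≫ inl X Y) i = ⟨Sum.inl (homEquiv _ _ f i).1, (homEquiv _ _ f i).2⟩ :=
  Sigma.ext rfl (heq_of_eq (Category.comp_id _))

theorem homEquiv_comp_inr {X Y Z : FinCoprod C} (f : Z ⟶ Y) (i : Z.obj.I) :
    homEquiv _ _ (f ≫ inr X Y) i = ⟨Sum.inr (homEquiv _ _ f i).1, (homEquiv _ _ f i).2⟩ :=
  Sigma.ext rfl (heq_of_eq (Category.comp_id _))

theorem inl_cancel {X Y Z : FinCoprod C} {f g : Z ⟶ X}
    (h : f ≫ inl X Y = g ≫ inl X Y) : f = g := by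
  refine ext_family fun i => ?_
  have h' := congrFun (congrArg (homEquiv _ _) h) i
  rw [homEquiv_comp_inl, homEquiv_comp_inl] at h'
  obtain ⟨h₁, h₂⟩ := Sigma.mk.inj_iff.1 h'
  exact Sigma.ext (Sum.inl_injective h₁) h₂

theorem inr_cancel {X Y Z : FinCoprod C} {f g : Z ⟶ Y}
    (h : f ≫ inr X Y = g ≫ inr X Y) : f = g := by
  refine ext_family fun i => ?_
  have h' := congrFun (congrArg (homEquiv _ _) h) i
  rw [homEquiv_comp_inr, homEquiv_comp_inr] at h'
  obtain ⟨h₁, h₂⟩ := Sigma.mk.inj_iff.1 h'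
  exact Sigma.ext (Sum.inr_injective h₁) h₂

theorem inl_ne_inr {A : C} {X Y : FinCoprod C} {f : single A ⟶ X} {g : single A ⟶ Y}
    (h : f ≫ inl X Y = g ≫ inr X Y) : False :=
  Sum.inl_ne_inr (congrArg (fun k => (homEquiv _ _ k PUnit.unit).1) h)

/-- A morphism from a single object into a sum factors through one of the summands. -/
theorem single_hom_sum {A : C} {X Y : FinCoprod C} (f : single A ⟶ sum X Y) :
    (∃ g, g ≫ inl X Y = f) ∨ (∃ g, g ≫ inr X Y = f) := by
  rcases h : homEquiv _ _ f PUnit.unit with ⟨i | i, k⟩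
  · refine Or.inl ⟨(homEquiv (single A) X).symm fun _ => ⟨i, k⟩, ext_family fun _ => ?_⟩
    rw [homEquiv_comp_inl]
    exact h.symm
  · refine Or.inr ⟨(homEquiv (single A) Y).symm fun _ => ⟨i, k⟩, ext_family fun _ => ?_⟩
    rw [homEquiv_comp_inr]
    exact h.symm

theorem homEquiv_inl_comp {X Y Z : FinCoprod C} (f : sum X Y ⟶ Z) (i : X.obj.I) :
    homEquiv _ _ (inl X Y ≫ f) i = homEquiv _ _ f (Sum.inl i) :=
  Sigma.ext rfl (heq_of_eq (Category.id_comp _))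

theorem homEquiv_inr_comp {X Y Z : FinCoprod C} (f : sum X Y ⟶ Z) (i : Y.obj.I) :
    homEquiv _ _ (inr X Y ≫ f) i = homEquiv _ _ f (Sum.inr i) :=
  Sigma.ext rfl (heq_of_eq (Category.id_comp _))

theorem sum_hom_ext {X Y Z : FinCoprod C} {f g : sum X Y ⟶ Z}
    (h₁ : inl X Y ≫ f = inl X Y ≫ g) (h₂ : inr X Y ≫ f = inr X Y ≫ g) : f = g := by
  refine ext_family fun i => ?_
  rcases i with i | i
  · exact (homEquiv_inl_comp f i).symm.trans ((by rw [h₁]) : _ = _) |>.trans (homEquiv_inl_comp g i)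
  · exact (homEquiv_inr_comp f i).symm.trans ((by rw [h₂]) : _ = _) |>.trans (homEquiv_inr_comp g i)

/-- The inclusion of the `i`-th summand. -/
def ι (X : FinCoprod C) (i : X.obj.I) : single (X.obj.obj i) ⟶ X :=
  (homEquiv _ _).symm fun _ => ⟨i, 𝟙 _⟩

theorem homEquiv_ι {X Y : FinCoprod C} (f : X ⟶ Y) (i : X.obj.I) :
    homEquiv _ _ (X.ι i ≫ f) PUnit.unit = homEquiv _ _ f i :=
  Sigma.ext rfl (heq_of_eq (Category.id_comp _))

theorem isIso_of_single {X Y : FinCoprod C} (f : X ⟶ Y)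
    (h : ∀ A : C, Function.Bijective fun g : single A ⟶ X => g ≫ f) : IsIso f := by
  refine isIso_of_yoneda_map_bijective f fun T => ⟨fun g g' e => ext_family fun i => ?_, fun g => ?_⟩
  · rw [← homEquiv_ι, ← homEquiv_ι]
    have e' : g ≫ f = g' ≫ f := e
    rw [(h _).1 (show (T.ι i ≫ g) ≫ f = (T.ι i ≫ g') ≫ f by
      rw [Category.assoc, Category.assoc, e'])]
  · choose k hk using fun i => (h _).2 (T.ι i ≫ g)
    refine ⟨(homEquiv _ _).symm fun i => homEquiv _ _ (k i) PUnit.unit, ext_family fun i => ?_⟩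
    rw [← homEquiv_ι g, ← hk]
    rfl

section Products

variable [HasBinaryProducts (FinCoprod C)]

theorem isIso_distrib (X Y Z : FinCoprod C) :
    IsIso (desc (prod.map (𝟙 X) (inl Y Z)) (prod.map (𝟙 X) (inr Y Z))) := by
  refine isIso_of_single _ fun A => ⟨fun g g' e => ?_, fun h => ?_⟩
  · have e₁ := congrArg (· ≫ prod.fst) e
    have e₂ := congrArg (· ≫ prod.snd) e
    rcases single_hom_sum g with ⟨a, rfl⟩ | ⟨a, rfl⟩ <;>
      rcases single_hom_sum g' with ⟨b, rfl⟩ | ⟨b, rfl⟩ <;>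
      simp only [Category.assoc, inl_desc, inr_desc, prod.map_fst, prod.map_snd,
        Category.comp_id] at e₁ e₂ <;>
      simp only [← Category.assoc] at e₂
    · congr 1
      exact Limits.prod.hom_ext e₁ (inl_cancel e₂)
    · exact (inl_ne_inr e₂).elim
    · exact (inl_ne_inr e₂.symm).elim
    · congr 1
      exact Limits.prod.hom_ext e₁ (inr_cancel e₂)
  · rcases single_hom_sum (h ≫ prod.snd) with ⟨k, hk⟩ | ⟨k, hk⟩
    · refine ⟨prod.lift (h ≫ prod.fst) k ≫ inl _ _, ?_⟩
      apply Limits.prod.hom_ext <;> simp [inl_desc, hk, prod.lift_fst, prod.lift_snd]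
    · refine ⟨prod.lift (h ≫ prod.fst) k ≫ inr _ _, ?_⟩
      apply Limits.prod.hom_ext <;> simp [inr_desc, hk, prod.lift_fst, prod.lift_snd]

theorem isIso_empty_prod (X : FinCoprod C) : IsIso (prod.fst : empty C ⨯ X ⟶ empty C) := by
  have h : ∀ {A : C} (_ : single A ⟶ empty C), False := fun f =>
    (homEquiv _ _ f PUnit.unit).1.elim
  exact isIso_of_single _ fun A => ⟨fun g => (h (g ≫ prod.fst)).elim, fun g => (h g).elim⟩

end Products

/-- The isomorphism classes of finite formal coproducts. -/
def Classes (C : Type u) [Category.{u} C] : Type _ := Quotient (isIsomorphicSetoid (FinCoprod C))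

namespace Classes

def mk (X : FinCoprod C) : Classes C := Quotient.mk _ X

theorem mk_eq {X Y : FinCoprod C} (e : X ≅ Y) : mk X = mk Y := Quotient.sound ⟨e⟩

theorem mk_eq_of_isIso {X Y : FinCoprod C} (f : X ⟶ Y) (hf : IsIso f) : mk X = mk Y :=
  mk_eq (asIso f)

instance : Zero (Classes C) := ⟨mk (empty C)⟩

instance : Add (Classes C) :=
  ⟨Quotient.map₂ sum fun _ _ ⟨e⟩ _ _ ⟨f⟩ =>
    ⟨{ hom := desc (e.hom ≫ inl _ _) (f.hom ≫ inr _ _)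
       inv := desc (e.inv ≫ inl _ _) (f.inv ≫ inr _ _)
       hom_inv_id := sum_hom_ext (by simp [reassoc_of% inl_desc, inl_desc])
        (by simp [reassoc_of% inr_desc, inr_desc])
       inv_hom_id := sum_hom_ext (by simp [reassoc_of% inl_desc, inl_desc])
        (by simp [reassoc_of% inr_desc, inr_desc]) }⟩⟩

theorem mk_eq_of_equiv {X Y : FinCoprod C} (e : X.obj.I ≃ Y.obj.I)
    (h : ∀ i, X.obj.obj i = Y.obj.obj (e i)) : mk X = mk Y :=
  mk_eq (ObjectProperty.isoMk _ (FormalCoproduct.isoOfComponents e fun i => eqToIso (h i)))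

instance : AddCommMonoid (Classes C) where
  add_assoc := by
    rintro ⟨X⟩ ⟨Y⟩ ⟨Z⟩
    exact mk_eq_of_equiv (Equiv.sumAssoc _ _ _) (by rintro ((i | i) | i) <;> rfl)
  zero_add := by
    rintro ⟨X⟩
    exact mk_eq_of_equiv (Equiv.emptySum Empty _) (by rintro (i | i); exacts [i.elim, rfl])
  add_zero := by
    rintro ⟨X⟩
    exact mk_eq_of_equiv (Equiv.sumEmpty _ Empty) (by rintro (i | i); exacts [rfl, i.elim])
  add_comm := by
    rintro ⟨X⟩ ⟨Y⟩
    exact mk_eq_of_equiv (Equiv.sumComm _ _) (by rintro (i | i) <;> rfl)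
  nsmul := nsmulRec

variable [HasBinaryProducts (FinCoprod C)]

/-- Multiplication of classes is given by the categorical product in `C_⊔`. -/
instance : Mul (Classes C) :=
  ⟨Quotient.map₂ (fun X Y => X ⨯ Y) fun _ _ ⟨e⟩ _ _ ⟨f⟩ => ⟨prod.mapIso e f⟩⟩

theorem mul_comm' (x y : Classes C) : x * y = y * x := by
  induction x using Quotient.inductionOn with | _ X
  induction y using Quotient.inductionOn with | _ Y
  exact mk_eq (prod.braiding X Y)

theorem mul_add' (x y z : Classes C) : x * (y + z) = x * y + x * z := by
  induction x using Quotient.inductionOn with | _ X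
  induction y using Quotient.inductionOn with | _ Y
  induction z using Quotient.inductionOn with | _ Z
  exact (mk_eq_of_isIso _ (isIso_distrib X Y Z)).symm

theorem zero_mul' (x : Classes C) : 0 * x = 0 := by
  induction x using Quotient.inductionOn with | _ X
  exact mk_eq_of_isIso _ (isIso_empty_prod X)

instance : NonUnitalCommSemiring (Classes C) where
  left_distrib := mul_add'
  right_distrib x y z := by rw [mul_comm', mul_add', mul_comm' z, mul_comm' z]
  zero_mul := zero_mul'
  mul_zero x := by rw [mul_comm', zero_mul']
  mul_assoc := by
    rintro ⟨X⟩ ⟨Y⟩ ⟨Z⟩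
    exact mk_eq (prod.associator X Y Z)
  mul_comm := mul_comm'

end Classes

end FinCoprod

namespace FusionSystem

variable {S : Type u} [Group S] (F : FusionSystem S)

/-- The Burnside ring `A^cent(F)` of Diaz and Libman: the Grothendieck group of the monoid of
isomorphism classes in `O(F^c)_⊔`. Its multiplication is given by the categorical product of
`O(F^c)_⊔`, once that category is known to have binary products. -/
def centricBurnside : Type _ := GrothendieckRing (FinCoprod.Classes F.OrbitCat)

instance : AddCommGroup F.centricBurnside :=
  inferInstanceAs (AddCommGroup (GrothendieckRing (FinCoprod.Classes F.OrbitCat)))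

instance [HasBinaryProducts (FinCoprod F.OrbitCat)] : NonUnitalCommRing F.centricBurnside :=
  let R : NonUnitalCommRing (GrothendieckRing (FinCoprod.Classes F.OrbitCat)) := inferInstance
  { (inferInstance : AddCommGroup F.centricBurnside) with
    mul := R.mul
    left_distrib := R.left_distrib
    right_distrib := R.right_distrib
    zero_mul := R.zero_mul
    mul_zero := R.mul_zero
    mul_assoc := R.mul_assoc
    mul_comm := R.mul_comm }

/-- The basis element `ξ_P` of `A^cent(F)` for an `F`-centric subgroup `P`. -/
def xi (P : Subgroup S) (hP : F.IsCentric P) : F.centricBurnside :=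
  (GrothendieckRing.of (FinCoprod.Classes.mk (FinCoprod.single ⟨P, hP⟩)) :
    GrothendieckRing (FinCoprod.Classes F.OrbitCat))

/-- `S` itself is `F`-centric. -/
theorem isCentric_top [Finite S] : F.IsCentric ⊤ := by
  rintro Q ⟨φ, -, hφ⟩
  have h : Nat.card Q = Nat.card S :=
    (Nat.card_congr (Equiv.ofBijective φ hφ)).symm.trans
      (Nat.card_congr Subgroup.topEquiv.toEquiv)
  rw [Subgroup.eq_top_of_card_eq Q h]
  exact le_top

end FusionSystem

end

/-! All rings are compared through fixed point counts (marks), which embed each of them in a finite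
product of copies of ℤ_(p). The central tool is a characteristic biset Ω of F: an S × S-set whose
stabilizers are graphs of morphisms of F, whose marks on such graphs depend only on the F-class of
the domain, and for which |Ω/S| is prime to p. Sorting the points over (Ω/P)^Q by the graph inside
their stabilizer gives |(Ω/P)^Q| |P| = |F(Q,P)| |Ω^Δ(Q)|, where Δ(Q) is the diagonal
(`IsCharacteristic.numFixed_rightQuot`). Hence Ω/P is F-stable and [Ω/S] is invertible in A(F)_(p).
Double counting turns the average that defines β_P into Φ_Q(β_P) = |S| |F(Q,P)| / (|P| |F(Q,S)|)
(`isStabilization_iff`), so that β_P = [Ω/P]/[Ω/S].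

The β_P span A(F)_(p) by a triangular induction (`mem_span_beta`): if the marks of x vanish above Q,
then |N_S(Q)/Q| divides Φ_Q(x), and for fully normalized Q this number is a multiple of Φ_Q(β_Q).
The same induction, restricted to non-centric subgroups, identifies N with the kernel of the marks
at centric subgroups.

For a finite group one takes Ω = G, and Ω/P is the restriction of G/P to S. On the centric side the
marks are the numbers |Hom(Q,P)| = |F(Q,P)| |Z(Q)| / |P| in the orbit category, so |Hom(Q,P)| /
|Hom(Q,S)| = Φ_Q(β_P). In both situations two spanning families differ by one factor which is a unit
of the product, and `existsUnique_ringEquiv_of_pi` shows that the two images coincide.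

Saturation enters twice. It yields Ω (`IsSaturated.exists_stable`), built by adding orbits (S × S)/D
in decreasing order of |D|, where `IsSaturated.card_normalizer_dvd` supplies the necessary
congruences. It also yields the products (`IsSaturated.exists_factorization`): the components of P ×
Q are the maximal graphs with centric domain inside P × Q, up to conjugation, and factorizations are
unique because maximal extensions of a centric graph are conjugate
(`IsSaturated.exists_conj_of_maximal`).

Morphisms of F are mostly replaced by their graphs, subgroups of the single group S × S, so that
restriction, inversion and composition are operations on subgroups. -/

/-! ### Fixed points and marks -/

namespace FinGSet

variable {G : Type u} [Group G]

theorem numFixed_res {H : Type u} [Group H] (φ : H →* G) (Q : Subgroup H) (X : FinGSet G) :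
    numFixed Q (res φ X) = numFixed (Q.map φ) X := by
  refine Nat.card_congr (Equiv.subtypeEquivRight fun x => ?_)
  constructor
  · rintro h _ ⟨q, hq, rfl⟩
    exact h q hq
  · intro h q hq
    exact h (φ q) ⟨q, hq, rfl⟩

/-- A coset gP is fixed by Q exactly when g⁻¹Qg ≤ P, and each coset has |P| representatives. -/
theorem numFixed_coset_mul_card [Finite G] (Q P : Subgroup G) :
    numFixed Q (coset P) * Nat.card P = Nat.card {g : G // ∀ q ∈ Q, g⁻¹ * q * g ∈ P} := by
  have e := QuotientGroup.preimageMkEquivSubgroupProdSet P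
    {x : G ⧸ P | ∀ q ∈ Q, q • x = x}
  have h := Nat.card_congr e
  rw [Nat.card_prod] at h
  rw [mul_comm]
  refine Eq.trans ?_ (h.symm.trans (Nat.card_congr (Equiv.subtypeEquivRight fun g => ?_)))
  · rfl
  · simp only [Set.mem_preimage, Set.mem_ofPred_eq]
    refine forall₂_congr fun q _ => ?_
    rw [MulAction.Quotient.smul_coe, smul_eq_mul, eq_comm, QuotientGroup.eq, mul_assoc]

theorem numFixed_pos_iff {Q : Subgroup G} {X : FinGSet G} :
    0 < numFixed Q X ↔ ∃ x : X, Q ≤ MulAction.stabilizer G x := by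
  unfold numFixed
  rw [Nat.card_pos_iff]
  constructor
  · rintro ⟨⟨x, hx⟩, -⟩
    exact ⟨x, hx⟩
  · rintro ⟨x, hx⟩
    exact ⟨⟨x, hx⟩, inferInstance⟩

/-- Every finite `G`-set is a disjoint union of transitive ones. -/
theorem Classes.mk_mem_closure [Finite G] (𝓗 : Set (Subgroup G)) (X : FinGSet G)
    (hX : ∀ x : X, MulAction.stabilizer G x ∈ 𝓗) :
    Classes.mk X ∈ AddSubmonoid.closure ((fun H => Classes.mk (coset H)) '' 𝓗) := by
  induction hn : Nat.card X using Nat.strong_induction_on generalizing X with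
  | _ n ih =>
  by_cases hne : Nonempty X
  swap
  · have : IsEmpty X := not_nonempty_iff.1 hne
    have h0 : Classes.mk X = 0 :=
      Classes.mk_eq (Equiv.equivOfIsEmpty X PEmpty) (fun g x => isEmptyElim x)
    rw [h0]
    exact zero_mem _
  obtain ⟨x⟩ := hne
  let C : SubMulAction G X :=
    { carrier := (MulAction.orbit G x)ᶜ
      smul_mem' := fun g y hy h => hy (by
        rw [← MulAction.orbit_eq_iff] at h ⊢
        rw [← h, MulAction.orbit_smul]) }
  let Y : FinGSet G := ⟨C⟩
  -- One orbit is split off. Its complement has fewer points, and its stabilizers are stabilizers of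
  -- points of `X`.
  have hsplit : Classes.mk X = Classes.mk (coset (MulAction.stabilizer G x)) + Classes.mk Y := by
    rw [← Classes.mk_add]
    symm
    let f : (G ⧸ MulAction.stabilizer G x) ⊕ C → X :=
      Sum.elim (MulAction.ofQuotientStabilizer G x) Subtype.val
    have hr : ∀ q, MulAction.ofQuotientStabilizer G x q ∈ MulAction.orbit G x := fun q => by
      induction q using QuotientGroup.induction_on with | _ g
      exact ⟨g, rfl⟩
    have hf : Function.Bijective f := by
      constructor
      · rintro (a | a) (b | b) h
        · exact congrArg Sum.inl (MulAction.injective_ofQuotientStabilizer G x h)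
        · exact (b.2 ((show _ = b.1 from h) ▸ hr a)).elim
        · exact (a.2 ((show a.1 = _ from h).symm ▸ hr b)).elim
        · exact congrArg Sum.inr (Subtype.ext h)
      · intro y
        by_cases hy : y ∈ MulAction.orbit G x
        · obtain ⟨g, rfl⟩ := hy
          exact ⟨Sum.inl (g : G ⧸ _), rfl⟩
        · exact ⟨Sum.inr ⟨y, hy⟩, rfl⟩
    refine Classes.mk_eq (Equiv.ofBijective f hf) ?_
    rintro g (a | a)
    · exact MulAction.ofQuotientStabilizer_smul G x g a
    · rfl
  rw [hsplit]
  refine add_mem (AddSubmonoid.subset_closure ⟨_, hX x, rfl⟩) (ih (Nat.card Y) ?_ Y ?_ rfl)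
  · rw [← hn]
    exact Finite.card_subtype_lt (p := fun y => y ∈ (MulAction.orbit G x)ᶜ) (x := x)
      (fun h => h (MulAction.mem_orbit_self x))
  · intro y
    have : MulAction.stabilizer G y = MulAction.stabilizer G (y.1 : X) := by
      ext g
      exact Subtype.ext_iff
    rw [this]
    exact hX _

end FinGSet

/-! ### Marks on the Burnside ring and the congruences between them. -/

namespace Burnside

variable {G : Type u} [Group G]

theorem mark_cls (Q : Subgroup G) (X : FinGSet G) : mark Q (cls X) = FinGSet.numFixed Q X :=
  GrothendieckRing.liftAdd_of _ _

theorem res_cls {H : Type u} [Group H] (φ : H →* G) (X : FinGSet G) :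
    res φ (cls X) = cls (FinGSet.res φ X) :=
  GrothendieckRing.liftAdd_of _ _

theorem exists_eq_cls_sub_cls (a : Burnside G) : ∃ X Y : FinGSet G, a = cls X - cls Y := by
  induction a using GrothendieckRing.induction with | _ x y
  induction x using Quotient.inductionOn with | _ X
  induction y using Quotient.inductionOn with | _ Y
  exact ⟨X, Y, rfl⟩

theorem mark_res {H : Type u} [Group H] (φ : H →* G) (Q : Subgroup H) (a : Burnside G) :
    mark Q (res φ a) = mark (Q.map φ) a := by
  obtain ⟨X, Y, rfl⟩ := exists_eq_cls_sub_cls a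
  simp only [map_sub, res_cls, mark_cls, FinGSet.numFixed_res]

theorem mark_conj (g : G) (Q : Subgroup G) (a : Burnside G) :
    mark (Q.map (MulAut.conj g).toMonoidHom) a = mark Q a := by
  obtain ⟨X, Y, rfl⟩ := exists_eq_cls_sub_cls a
  have key : ∀ X : FinGSet G, FinGSet.numFixed (Q.map (MulAut.conj g).toMonoidHom) X =
      FinGSet.numFixed Q X := fun X => by
    refine Nat.card_congr ((MulAction.toPerm g⁻¹).subtypeEquiv fun x => ?_)
    constructor
    · intro h q hq
      have := h (g * q * g⁻¹) ⟨q, hq, rfl⟩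
      simp only [mul_smul] at this
      simpa using eq_inv_smul_iff.2 this
    · rintro h _ ⟨q, hq, rfl⟩
      have := h q hq
      simp only [MulAction.toPerm_apply] at this
      change (g * q * g⁻¹) • x = x
      rw [mul_smul, mul_smul, this, smul_inv_smul]
  simp only [map_sub, mark_cls, key]

theorem cls_mem_closure [Finite G] (𝓗 : Set (Subgroup G)) (X : FinGSet G)
    (hX : ∀ x : X, MulAction.stabilizer G x ∈ 𝓗) :
    cls X ∈ AddSubgroup.closure ((fun H => cls (FinGSet.coset H)) '' 𝓗) := by
  have h := FinGSet.Classes.mk_mem_closure 𝓗 X hX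
  have h2 : (GrothendieckRing.of : _ →+ Burnside G) (FinGSet.Classes.mk X) ∈
      (AddSubmonoid.closure ((fun H => FinGSet.Classes.mk (FinGSet.coset H)) '' 𝓗)).map
        GrothendieckRing.of := ⟨_, h, rfl⟩
  rw [AddMonoidHom.map_mclosure, Set.image_image] at h2
  refine (AddSubmonoid.closure_le (S := (AddSubgroup.closure
    ((fun H => cls (FinGSet.coset H)) '' 𝓗)).toAddSubmonoid)).2 ?_ h2
  exact AddSubgroup.subset_closure

theorem closure_coset [Finite G] :
    AddSubgroup.closure (Set.range fun H : Subgroup G => cls (FinGSet.coset H)) = ⊤ := by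
  refine eq_top_iff.2 fun a _ => ?_
  obtain ⟨X, Y, rfl⟩ := exists_eq_cls_sub_cls a
  rw [← Set.image_univ]
  exact sub_mem (cls_mem_closure _ X fun _ => trivial) (cls_mem_closure _ Y fun _ => trivial)

/-- A form of Burnside's orbit counting lemma. -/
theorem card_dvd_sum_numFixed [Fintype G] (Q : Subgroup G) [Q.Normal] (X : FinGSet G) :
    Nat.card G ∣ ∑ g : G, FinGSet.numFixed (Q ⊔ Subgroup.zpowers g) X := by
  classical
  -- As Q is normal, G permutes the Q-fixed points, and g fixes such a point exactly when Q ⊔ ⟨g⟩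
  -- does. So the sum counts orbits on `C`, multiplied by |G|.
  let C : SubMulAction G X :=
    { carrier := {x | ∀ q ∈ Q, q • x = x}
      smul_mem' := fun g x hx q hq => by
        have := hx (g⁻¹ * q * g) (by simpa using Subgroup.Normal.conj_mem ‹_› q hq g⁻¹)
        rw [mul_smul, mul_smul, inv_smul_eq_iff] at this
        exact this }
  have := Fintype.ofFinite C
  have h := MulAction.sum_card_fixedBy_eq_card_orbits_mul_card_group G C
  rw [← Nat.card_eq_fintype_card (α := G)] at h
  refine Dvd.intro_left _ (h.symm.trans (Finset.sum_congr rfl fun g _ => ?_))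
  rw [← Nat.card_eq_fintype_card]
  refine Nat.card_congr ?_
  have hx : ∀ x : X, (∀ k ∈ Q ⊔ Subgroup.zpowers g, k • x = x) ↔ x ∈ C ∧ g • x = x := fun x => by
    change Q ⊔ Subgroup.zpowers g ≤ MulAction.stabilizer G x ↔ _
    rw [sup_le_iff, Subgroup.zpowers_le]
    rfl
  exact
    { toFun := fun y => ⟨y.1.1, (hx _).2 ⟨y.1.2, congrArg Subtype.val y.2⟩⟩
      invFun := fun y => ⟨⟨y.1, ((hx _).1 y.2).1⟩, Subtype.ext ((hx _).1 y.2).2⟩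
      left_inv := fun _ => rfl
      right_inv := fun _ => rfl }

theorem card_dvd_sum_mark [Fintype G] (Q : Subgroup G) [Q.Normal] (a : Burnside G) :
    (Nat.card G : ℤ) ∣ ∑ g : G, mark (Q ⊔ Subgroup.zpowers g) a := by
  obtain ⟨X, Y, rfl⟩ := exists_eq_cls_sub_cls a
  simp only [map_sub, mark_cls, Finset.sum_sub_distrib]
  exact dvd_sub (by exact_mod_cast card_dvd_sum_numFixed Q X)
    (by exact_mod_cast card_dvd_sum_numFixed Q Y)

/-- In the orbit counting sum only the |Q| elements g ∈ Q contribute, since Q ⊔ ⟨g⟩ is strictly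
larger than Q for all others. In other words, |G/Q| divides Φ_Q(a). -/
theorem card_dvd_card_mul_mark_of_normal [Finite G] (Q : Subgroup G) [Q.Normal] (a : Burnside G)
    (ha : ∀ H, Q < H → mark H a = 0) : (Nat.card G : ℤ) ∣ Nat.card Q * mark Q a := by
  classical
  have := Fintype.ofFinite G
  convert card_dvd_sum_mark Q a using 1
  have h : ∀ g : G, mark (Q ⊔ Subgroup.zpowers g) a = if g ∈ Q then mark Q a else 0 := fun g => by
    split_ifs with hg
    · rw [sup_eq_left.2 (Subgroup.zpowers_le.2 hg)]
    · exact ha _ (lt_of_le_of_ne le_sup_left fun h => hg (h ▸ Subgroup.mem_sup_right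
        (Subgroup.mem_zpowers g)))
  simp_rw [h]
  rw [Finset.sum_ite, Finset.sum_const_zero, add_zero, Finset.sum_const, nsmul_eq_mul,
    Nat.card_eq_fintype_card, Fintype.card_subtype]

/-- Restriction to N_G(Q) makes Q normal. This congruence bounds the leading coefficients in the
triangular induction of `mem_span_beta`. -/
theorem card_normalizer_dvd [Finite G] (Q : Subgroup G) (a : Burnside G)
    (ha : ∀ H, Q < H → mark H a = 0) :
    (Nat.card (Subgroup.normalizer (Q : Set G)) : ℤ) ∣ Nat.card Q * mark Q a := by
  have hle : Q ≤ Subgroup.normalizer (Q : Set G) := Subgroup.le_normalizer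
  have hmap := Subgroup.map_subgroupOf_eq_of_le hle
  have h := card_dvd_card_mul_mark_of_normal (Q.subgroupOf (Subgroup.normalizer (Q : Set G)))
    (res (Subgroup.normalizer (Q : Set G)).subtype a) fun H hH => by
      rw [mark_res]
      apply ha
      have := (Subgroup.map_lt_map_iff_of_injective
        (Subgroup.normalizer (Q : Set G)).subtype_injective).2 hH
      rwa [hmap] at this
  rwa [mark_res, hmap, Nat.card_congr (Subgroup.subgroupOfEquivOfLe hle).toEquiv] at h

end Burnside

/-! ### The ring `ℤ_(p)` and localized modules -/

section Localization

variable (p : ℕ) [Fact p.Prime]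

instance : IsDomain (ZLoc p) :=
  inferInstanceAs (IsDomain (Localization.AtPrime (Ideal.span {(p : ℤ)})))

instance : CharZero (ZLoc p) := by
  refine ⟨fun m n h => ?_⟩
  have h' : (m : Localization.AtPrime (Ideal.span {(p : ℤ)})) = n := h
  have := IsLocalization.injective (Localization.AtPrime (Ideal.span {(p : ℤ)}))
    (Ideal.primeCompl_le_nonZeroDivisors (Ideal.span {(p : ℤ)}))
    (a₁ := (m : ℤ)) (a₂ := (n : ℤ)) (by simpa using h')
  exact_mod_cast this

theorem ZLoc.isUnit_intCast {n : ℤ} (hn : ¬ (p : ℤ) ∣ n) : IsUnit (n : ZLoc p) := by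
  have := (IsLocalization.AtPrime.isUnit_to_map_iff
    (Localization.AtPrime (Ideal.span {(p : ℤ)})) (Ideal.span {(p : ℤ)}) n).2
    (fun h => hn (Ideal.mem_span_singleton.1 h))
  rw [eq_intCast] at this
  exact this

theorem ZLoc.isUnit_natCast {n : ℕ} (hn : ¬ p ∣ n) : IsUnit (n : ZLoc p) := by
  have := ZLoc.isUnit_intCast p (n := n) (by exact_mod_cast hn)
  rwa [Int.cast_natCast] at this

theorem ZLoc.exists_intCast_mul_eq (x : ZLoc p) :
    ∃ n m : ℤ, ¬ (p : ℤ) ∣ n ∧ (n : ZLoc p) * x = m := by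
  obtain ⟨⟨m, n⟩, h⟩ := IsLocalization.surj (Ideal.span {(p : ℤ)}).primeCompl
    (S := Localization.AtPrime (Ideal.span {(p : ℤ)})) x
  refine ⟨n, m, fun hn => n.2 (Ideal.mem_span_singleton.2 hn), ?_⟩
  rw [eq_intCast, eq_intCast] at h
  rw [mul_comm]
  exact h

variable {p}

theorem ZLoc.dvd_of_intCast_dvd {a b : ℤ} (h : a ∣ b) : (a : ZLoc p) ∣ b :=
  map_dvd (Int.castRingHom (ZLoc p)) h

/-- Additive maps between `ℤ_(p)`-modules are linear. -/
theorem ZLoc.map_smul {M N : Type*} [AddCommGroup M] [Module (ZLoc p) M] [AddCommGroup N]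
    [Module (ZLoc p) N] (f : M →+ N) (c : ZLoc p) (x : M) : f (c • x) = c • f x := by
  -- Multiplying by the denominator of c, which acts invertibly, leaves only integer multiples, and
  -- these every additive map preserves.
  obtain ⟨n, m, hn, h⟩ := ZLoc.exists_intCast_mul_eq p c
  have hu := ZLoc.isUnit_intCast p hn
  rw [← hu.smul_left_cancel, smul_smul, h, Int.cast_smul_eq_zsmul, Int.cast_smul_eq_zsmul,
    ← map_zsmul f, ← map_zsmul f, ← Int.cast_smul_eq_zsmul (ZLoc p), smul_smul, h,
    Int.cast_smul_eq_zsmul]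

namespace PLoc

/-- Clearing denominators: up to a unit of ℤ_(p), every element is integral. This transfers
injectivity, invariance and congruences of marks from A to its localization. -/
theorem exists_smul_eq_of {A : Type*} [AddCommGroup A] (x : PLoc p A) :
    ∃ (n : ℤ) (a : A), ¬ (p : ℤ) ∣ n ∧ (n : ZLoc p) • x = PLoc.of p a := by
  have hp : Prime (p : ℤ) := Nat.prime_iff_prime_int.1 Fact.out
  induction x using TensorProduct.induction_on with
  | zero => exact ⟨1, 0, hp.not_dvd_one, by simp⟩
  | tmul c a =>
    obtain ⟨n, m, hn, h⟩ := ZLoc.exists_intCast_mul_eq p c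
    refine ⟨n, m • a, hn, ?_⟩
    rw [TensorProduct.smul_tmul', smul_eq_mul, h, PLoc.of, TensorProduct.tmul_smul,
      TensorProduct.smul_tmul', zsmul_one]
  | add x y hx hy =>
    obtain ⟨n, a, hn, hx⟩ := hx
    obtain ⟨m, b, hm, hy⟩ := hy
    refine ⟨n * m, m • a + n • b, fun h => (hp.dvd_or_dvd h).elim hn hm, ?_⟩
    rw [PLoc.of, TensorProduct.tmul_add, TensorProduct.tmul_smul, TensorProduct.tmul_smul]
    change _ = m • PLoc.of p a + n • PLoc.of p b
    rw [← hx, ← hy, smul_add, Int.cast_mul, ← Int.cast_smul_eq_zsmul (ZLoc p),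
      ← Int.cast_smul_eq_zsmul (ZLoc p), smul_smul, smul_smul, mul_comm (m : ZLoc p)]

variable (p) in
/-- The linear extension `A_(p) → ℤ_(p)` of an additive map `A → ℤ`. -/
noncomputable def linExtend {A : Type*} [AddCommGroup A] (f : A →+ ℤ) :
    PLoc p A →ₗ[ZLoc p] ZLoc p :=
  (TensorProduct.AlgebraTensorModule.rid ℤ (ZLoc p) (ZLoc p)).toLinearMap ∘ₗ
    TensorProduct.AlgebraTensorModule.lTensor (ZLoc p) (ZLoc p) f.toIntLinearMap

@[simp]
theorem linExtend_tmul {A : Type*} [AddCommGroup A] (f : A →+ ℤ) (c : ZLoc p) (a : A) :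
    linExtend p f (c ⊗ₜ a) = f a * c := by
  simp [linExtend, zsmul_eq_mul]

theorem linExtend_of {A : Type*} [AddCommGroup A] (f : A →+ ℤ) (a : A) :
    linExtend p f (PLoc.of p a) = f a := by simp

/-- Multiplicativity needs no unit. It is used for A(G;p) and for the centric Burnside ring, which
carry only non-unital ring structures, so that `PLoc.extend` is not available there. -/
theorem linExtend_mul {A : Type*} [NonUnitalNonAssocRing A] (f : A →+ ℤ)
    (hf : ∀ a b, f (a * b) = f a * f b) (x y : PLoc p A) :
    linExtend p f (x * y) = linExtend p f x * linExtend p f y := by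
  let : NonUnitalNonAssocRing (PLoc p A) := Algebra.TensorProduct.instNonUnitalNonAssocRing
  induction x using TensorProduct.induction_on with
  | zero => exact (congrArg _ (zero_mul (M₀ := PLoc p A) y)).trans (by simp)
  | add x x' hx hx' =>
    refine (congrArg _ (add_mul (R := PLoc p A) x x' y)).trans ?_
    rw [map_add, map_add, hx, hx', add_mul]
  | tmul c a =>
    induction y using TensorProduct.induction_on with
    | zero => exact (congrArg _ (mul_zero (M₀ := PLoc p A) (c ⊗ₜ a))).trans (by simp)
    | add y y' hy hy' =>
      refine (congrArg _ (mul_add (R := PLoc p A) (c ⊗ₜ a) y y')).trans ?_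
      rw [map_add, map_add, hy, hy', mul_add]
    | tmul d b =>
      rw [Algebra.TensorProduct.tmul_mul_tmul, linExtend_tmul, linExtend_tmul, linExtend_tmul, hf]
      push_cast
      ring

theorem extend_eq_linExtend {A : Type*} [CommRing A] (f : A →+* ℤ) (x : PLoc p A) :
    PLoc.extend p f x = linExtend p (f : A →+ ℤ) x := by
  induction x using TensorProduct.induction_on with
  | zero => simp
  | add x y hx hy => rw [map_add, map_add, hx, hy]
  | tmul c a =>
    rw [linExtend_tmul, PLoc.extend, Algebra.TensorProduct.lift_tmul]
    simp [mul_comm]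

theorem extend_of {A : Type*} [CommRing A] (f : A →+* ℤ) (a : A) :
    PLoc.extend p f (PLoc.of p a) = f a := by
  rw [extend_eq_linExtend, linExtend_of]
  rfl

theorem span_of_eq_top {A : Type*} [AddCommGroup A] {s : Set A}
    (hs : AddSubgroup.closure s = ⊤) :
    Submodule.span (ZLoc p) ((fun a => PLoc.of p a) '' s) = ⊤ := by
  have key : ∀ a : A, PLoc.of p a ∈ Submodule.span (ZLoc p) ((fun a => PLoc.of p a) '' s) := by
    intro a
    have ha : a ∈ AddSubgroup.closure s := hs ▸ AddSubgroup.mem_top a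
    induction ha using AddSubgroup.closure_induction with
    | mem a ha => exact Submodule.subset_span ⟨a, ha, rfl⟩
    | zero => rw [PLoc.of, TensorProduct.tmul_zero]; exact zero_mem _
    | add a b _ _ ha hb => rw [PLoc.of, TensorProduct.tmul_add]; exact add_mem ha hb
    | neg a _ ha => rw [PLoc.of, TensorProduct.tmul_neg]; exact neg_mem ha
  refine eq_top_iff.2 fun x _ => ?_
  induction x using TensorProduct.induction_on with
  | zero => exact zero_mem _
  | add x y hx hy => exact add_mem (hx trivial) (hy trivial)
  | tmul c a =>
    have : c ⊗ₜ[ℤ] a = c • PLoc.of p a := by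
      rw [TensorProduct.smul_tmul', smul_eq_mul, mul_one]
    rw [this]
    exact Submodule.smul_mem _ _ (key a)

end PLoc

end Localization

/-! ### Triangular families and comparison of subrings of a product -/

/-- A family which is triangular with respect to a family of functionals has only trivial linear
combinations on which all functionals vanish. -/
theorem eq_zero_of_triangular {k V ι : Type*} [CommRing k] [IsDomain k] [AddCommGroup V]
    [Module k V] [Finite ι] (b : ι → V) (Φ : ι → V →ₗ[k] k) (d : ι → ℕ)
    (hΦ : ∀ i j, Φ i (b j) ≠ 0 → d i < d j ∨ b i = b j) (hb : ∀ i, Φ i (b i) ≠ 0)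
    {x : V} (hx : x ∈ Submodule.span k (Set.range b)) (h : ∀ i, Φ i x = 0) : x = 0 := by
  suffices H : ∀ (n : ℕ) (U : Set ι), U.ncard = n → x ∈ Submodule.span k (b '' U) → x = 0 from
    H _ Set.univ rfl (by rwa [Set.image_univ])
  intro n
  induction n using Nat.strong_induction_on with
  | _ n ih =>
  intro U hU hxU
  rcases U.eq_empty_or_nonempty with rfl | hne
  · simpa using hxU
  -- For maximal `d i`, triangularity makes `Φ i` vanish on every vector of the family other than `b
  -- i`, so the coefficient of `b i` is zero. All indices with the same vector are discarded
  -- together, because conjugate subgroups give equal vectors.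
  obtain ⟨i, hi, hmax⟩ := U.toFinite.exists_maximalFor d U hne
  let U' : Set ι := {j ∈ U | b j ≠ b i}
  have hsub : b '' U ⊆ insert (b i) (b '' U') := by
    rintro _ ⟨j, hj, rfl⟩
    by_cases hji : b j = b i
    · exact Or.inl hji
    · exact Or.inr ⟨j, ⟨hj, hji⟩, rfl⟩
  obtain ⟨c, y, hy, rfl⟩ := Submodule.mem_span_insert.1 (Submodule.span_mono hsub hxU)
  have hy0 : Φ i y = 0 := by
    have : Submodule.span k (b '' U') ≤ LinearMap.ker (Φ i) := by
      rw [Submodule.span_le]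
      rintro _ ⟨j, ⟨hj, hji⟩, rfl⟩
      by_contra hne
      rcases hΦ i j hne with hlt | heq
      · exact absurd (hmax hj hlt.le) (not_le.2 hlt)
      · exact hji heq.symm
    exact this hy
  have hc : c = 0 := by
    have := h i
    rw [map_add, hy0, add_zero, map_smul, smul_eq_mul] at this
    exact (mul_eq_zero.1 this).resolve_right (hb i)
  subst hc
  rw [zero_smul, zero_add] at ih ⊢
  refine ih _ ?_ U' rfl hy
  rw [← hU]
  exact Set.ncard_lt_ncard ⟨fun j hj => hj.1, fun hs => (hs hi).2 rfl⟩ U.toFinite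

/-- A finite product of copies of k is integral over k, hence over R, and an injective integral
extension reflects units. -/
theorem isUnit_of_isUnit_pi {k ι R : Type*} [CommRing k] [Finite ι] [CommRing R] [Algebra k R]
    (f : R →ₐ[k] (ι → k)) (hf : Function.Injective f) {r : R} (hr : IsUnit (f r)) : IsUnit r := by
  have hint : (f : R →+* (ι → k)).IsIntegral := by
    refine RingHom.IsIntegral.tower_top (algebraMap k R) _ ?_
    rw [f.comp_algebraMap]
    exact fun v => Algebra.IsIntegral.isIntegral (R := k) v
  have := hint.isLocalHom hf
  exact (isUnit_map_iff (f : R →+* (ι → k)) r).1 hr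

/-- Let `R` and `T` be embedded in a finite product of copies of `ℤ_(p)`, such that the two images
differ by the factor `g (x j₀)`, which is a unit of the product. Then the images are equal. -/
theorem existsUnique_ringEquiv_of_pi {p : ℕ} [Fact p.Prime] {ι J R T : Type*} [Finite ι]
    [CommRing R] [Algebra (ZLoc p) R] [NonUnitalNonAssocRing T] [Module (ZLoc p) T]
    (f : R →ₐ[ZLoc p] (ι → ZLoc p)) (hf : Function.Injective f)
    (g : T →ₗ[ZLoc p] (ι → ZLoc p)) (hg : Function.Injective g)
    (hmul : ∀ s t, g (s * t) = g s * g t)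
    (b : J → R) (hb : Submodule.span (ZLoc p) (Set.range b) = ⊤)
    (x : J → T) (hx : Submodule.span (ZLoc p) (Set.range x) = ⊤)
    (j₀ : J) (hu : IsUnit (g (x j₀))) (hxb : ∀ j, g (x j) = f (b j) * g (x j₀)) :
    IsInvertibleIn (x j₀) ∧ ∃! e : R ≃+* T, ∀ j, e (b j) * x j₀ = x j := by
  -- Together, `hA` and `hB` say that g(T) = f(R) · g(x j₀).
  have hA : ∀ t, ∃ r, g t = f r * g (x j₀) := fun t => by
    have ht : t ∈ Submodule.span (ZLoc p) (Set.range x) := hx ▸ Submodule.mem_top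
    induction ht using Submodule.span_induction with
    | mem t ht => obtain ⟨j, rfl⟩ := ht; exact ⟨b j, hxb j⟩
    | zero => exact ⟨0, by simp⟩
    | add s t _ _ hs ht =>
      obtain ⟨r, hr⟩ := hs
      obtain ⟨r', hr'⟩ := ht
      exact ⟨r + r', by rw [map_add, map_add, hr, hr', add_mul]⟩
    | smul c t _ ht =>
      obtain ⟨r, hr⟩ := ht
      exact ⟨c • r, by rw [map_smul, map_smul, hr, smul_mul_assoc]⟩
  have hB : ∀ r, ∃ t, g t = f r * g (x j₀) := fun r => by
    have hr : r ∈ Submodule.span (ZLoc p) (Set.range b) := hb ▸ Submodule.mem_top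
    induction hr using Submodule.span_induction with
    | mem t ht => obtain ⟨j, rfl⟩ := ht; exact ⟨x j, hxb j⟩
    | zero => exact ⟨0, by simp⟩
    | add s t _ _ hs ht =>
      obtain ⟨r, hr⟩ := hs
      obtain ⟨r', hr'⟩ := ht
      exact ⟨r + r', by rw [map_add, map_add, hr, hr', add_mul]⟩
    | smul c t _ ht =>
      obtain ⟨r, hr⟩ := ht
      exact ⟨c • r, by rw [map_smul, map_smul, hr, smul_mul_assoc]⟩
  -- The square of x j₀ lies in T, so g(x j₀)² = f(r) g(x j₀), and the unit g(x j₀) cancels. The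
  -- element found is then a unit of R by integrality, which makes the two images equal.
  obtain ⟨r₀, hr₀⟩ : ∃ r₀, g (x j₀) = f r₀ := by
    obtain ⟨r, hr⟩ := hA (x j₀ * x j₀)
    rw [hmul] at hr
    exact ⟨r, hu.mul_right_cancel hr⟩
  obtain ⟨r₁, hr₁⟩ := isUnit_iff_exists_inv.1 (isUnit_of_isUnit_pi f hf (hr₀ ▸ hu))
  have hcancel : ∀ r, f (r * r₁) * g (x j₀) = f r := fun r => by
    rw [hr₀, ← map_mul, mul_assoc, mul_comm r₁, hr₁, mul_one]
  choose t ht using fun r => hB (r * r₁)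
  simp only [hcancel] at ht
  have hsurj : Function.Surjective t := fun s => by
    obtain ⟨r, hr⟩ := hA s
    exact ⟨r * r₀, hg (by rw [ht, hr, hr₀, map_mul])⟩
  let e : R ≃+* T := RingEquiv.ofBijective
    ({ toFun := t
       map_zero' := hg (by rw [ht, map_zero, map_zero])
       map_add' := fun r s => hg (by rw [ht, map_add, map_add, ht, ht])
       map_mul' := fun r s => hg (by rw [ht, map_mul, hmul, ht, ht]) } : R →ₙ+* T)
    ⟨fun r s hrs => hf (by rw [← ht, ← ht]; exact congrArg g hrs), hsurj⟩
  have he : ∀ r, g (e r) = f r := ht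
  have heb : ∀ j, e (b j) * x j₀ = x j := fun j => hg (by rw [hmul, he, ← hxb])
  refine ⟨⟨e 1, fun y => ⟨hg ?_, hg ?_⟩, e r₁, hg ?_, hg ?_⟩, e, heb, fun e' he' => ?_⟩
  · rw [hmul, he, map_one, one_mul]
  · rw [hmul, he, map_one, mul_one]
  · rw [hmul, he, he, hr₀, ← map_mul, hr₁]
  · rw [hmul, he, he, hr₀, ← map_mul, mul_comm, hr₁]
  -- A ring isomorphism is automatically ℤ_(p)-linear, so it is determined by its values on the
  -- spanning family.
  · have hlin : ∀ r, e' r = e r := fun r => by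
      have hr : r ∈ Submodule.span (ZLoc p) (Set.range b) := hb ▸ Submodule.mem_top
      induction hr using Submodule.span_induction with
      | mem r hr =>
        obtain ⟨j, rfl⟩ := hr
        refine hg (hu.mul_right_cancel ?_)
        rw [← hmul, ← hmul, he', heb]
      | zero => rw [map_zero, map_zero]
      | add r s _ _ hr hs => rw [map_add, map_add, hr, hs]
      | smul c r _ hr =>
        have h₁ := ZLoc.map_smul (e' : R →+ T) c r
        have h₂ := ZLoc.map_smul (e : R →+ T) c r
        exact h₁.trans ((congrArg (c • ·) hr).trans h₂.symm)
    exact RingEquiv.ext hlin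

/-! ### Injectivity of the marks -/

theorem PLoc.eq_zero_of_linExtend {p : ℕ} [Fact p.Prime] {A ι : Type*} [AddCommGroup A]
    (χ : ι → A →+ ℤ) (hχ : ∀ a, (∀ i, χ i a = 0) → a = 0) {x : PLoc p A}
    (hx : ∀ i, PLoc.linExtend p (χ i) x = 0) : x = 0 := by
  obtain ⟨n, a, hn, h⟩ := PLoc.exists_smul_eq_of x
  have ha : a = 0 := hχ a fun i => by
    have := congrArg (PLoc.linExtend p (χ i)) h
    rw [map_smul, hx, smul_zero, PLoc.linExtend_of] at this
    exact_mod_cast this.symm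
  rw [ha, PLoc.of, TensorProduct.tmul_zero] at h
  exact (ZLoc.isUnit_intCast p hn).smul_eq_zero.1 h

theorem mem_span_int_of_closure {A : Type*} [AddCommGroup A] {s : Set A}
    (h : AddSubgroup.closure s = ⊤) (x : A) : x ∈ Submodule.span ℤ s := by
  have := Submodule.span_int_eq_addSubgroupClosure s
  rw [h] at this
  rw [← Submodule.mem_toAddSubgroup, this]
  trivial

/-! ### Injectivity of the marks on A(G) and on A(G;p). -/

namespace Burnside

variable {G : Type u} [Group G]

theorem cls_coset_conj [Finite G] {Q P : Subgroup G} (g : G)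
    (h : ∀ x, x ∈ Q ↔ g⁻¹ * x * g ∈ P) : cls (FinGSet.coset Q) = cls (FinGSet.coset P) := by
  refine congrArg GrothendieckRing.of (FinGSet.Classes.mk_eq (X := FinGSet.coset Q) (Y := FinGSet.coset P)
    (Quotient.congr (Equiv.mulRight g) fun a b => ?_) fun k x => ?_)
  · change QuotientGroup.leftRel Q a b ↔ QuotientGroup.leftRel P (a * g) (b * g)
    rw [QuotientGroup.leftRel_apply, QuotientGroup.leftRel_apply, h]
    simp [mul_assoc]
  · induction x using Quotient.inductionOn with | _ x
    exact congrArg (QuotientGroup.mk (s := P)) (mul_assoc k x g)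

theorem mark_coset_ne_zero [Finite G] {Q P : Subgroup G}
    (h : mark Q (cls (FinGSet.coset P)) ≠ 0) : ∃ g : G, ∀ q ∈ Q, g⁻¹ * q * g ∈ P := by
  rw [mark_cls] at h
  have h' : FinGSet.numFixed Q (FinGSet.coset P) * Nat.card P ≠ 0 :=
    mul_ne_zero (by exact_mod_cast h) Nat.card_pos.ne'
  rw [FinGSet.numFixed_coset_mul_card] at h'
  obtain ⟨⟨g, hg⟩⟩ := (Nat.card_ne_zero.1 h').1
  exact ⟨g, hg⟩

theorem mark_coset_self_ne_zero [Finite G] (P : Subgroup G) :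
    mark P (cls (FinGSet.coset P)) ≠ 0 := by
  rw [mark_cls]
  have h := FinGSet.numFixed_coset_mul_card P P
  have : Nonempty {g : G // ∀ q ∈ P, g⁻¹ * q * g ∈ P} := ⟨1, fun q hq => by simpa using hq⟩
  have : 0 < FinGSet.numFixed P (FinGSet.coset P) * Nat.card P := h ▸ Nat.card_pos
  exact_mod_cast (Nat.pos_of_mul_pos_right this).ne'

/-- A nonzero mark means that Q is conjugate into P, and equality of orders then makes Q and P
conjugate. This is the triangularity required by `eq_zero_of_triangular`. -/
theorem card_lt_or_cls_coset_eq [Finite G] {Q P : Subgroup G}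
    (h : mark Q (cls (FinGSet.coset P)) ≠ 0) :
    Nat.card Q < Nat.card P ∨ cls (FinGSet.coset Q) = cls (FinGSet.coset P) := by
  obtain ⟨g, hg⟩ := mark_coset_ne_zero h
  have hle : Q.map (MulAut.conj g⁻¹).toMonoidHom ≤ P := by
    rintro _ ⟨q, hq, rfl⟩
    simpa using hg q hq
  have hcard : Nat.card (Q.map (MulAut.conj g⁻¹).toMonoidHom) = Nat.card Q :=
    Subgroup.card_map_of_injective (MulAut.conj g⁻¹).injective
  rcases (hcard ▸ Subgroup.card_le_of_le hle).lt_or_eq with hlt | heq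
  · exact Or.inl hlt
  · refine Or.inr (cls_coset_conj g fun x => ⟨hg x, fun hx => ?_⟩)
    rw [← Subgroup.eq_of_le_of_card_ge hle (by rw [hcard, heq])] at hx
    obtain ⟨q, hq, hqx⟩ := hx
    have : q = x := by simpa using hqx
    exact this ▸ hq

/-- Burnside's theorem: the marks detect the elements of the Burnside ring. -/
theorem eq_zero_of_mark [Finite G] (a : Burnside G) (h : ∀ Q : Subgroup G, mark Q a = 0) :
    a = 0 := by
  refine eq_zero_of_triangular (fun H : Subgroup G => cls (FinGSet.coset H))
    (fun Q => (mark Q : Burnside G →+ ℤ).toIntLinearMap) (fun Q => Nat.card Q)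
    (fun Q P => card_lt_or_cls_coset_eq) mark_coset_self_ne_zero
    (mem_span_int_of_closure closure_coset a) h

theorem ext_mark [Finite G] {a b : Burnside G} (h : ∀ Q : Subgroup G, mark Q a = mark Q b) :
    a = b :=
  sub_eq_zero.1 (eq_zero_of_mark _ fun Q => by rw [map_sub, h, sub_self])

section PPart

variable {p : ℕ}

theorem closure_pCoset [Finite G] :
    AddSubgroup.closure (Set.range fun H : {H : Subgroup G // IsPGroup p H} =>
      (pCoset H.1 H.2 : pPart p G)) = ⊤ := by
  refine eq_top_iff.2 fun a _ => ?_
  have key : ∀ X : FinGSet G, X.HasPIsotropy p → cls X ∈ (AddSubgroup.closure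
      (Set.range fun H : {H : Subgroup G // IsPGroup p H} => (pCoset H.1 H.2 : pPart p G))).map
        (NonUnitalSubringClass.subtype (pPart p G) : pPart p G →+ Burnside G) := fun X hX => by
    have h := cls_mem_closure {H : Subgroup G | IsPGroup p H} X hX
    refine AddSubgroup.closure_le _ |>.2 ?_ h
    rintro _ ⟨H, hH, rfl⟩
    exact ⟨pCoset H hH, AddSubgroup.subset_closure ⟨⟨H, hH⟩, rfl⟩, rfl⟩
  obtain ⟨a, X, Y, hX, hY, rfl⟩ := a
  obtain ⟨b, hb, hb'⟩ := sub_mem (key X hX) (key Y hY)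
  have : b = ⟨cls X - cls Y, X, Y, hX, hY, rfl⟩ := Subtype.ext hb'
  exact this ▸ hb

/-- The mark `Φ_Q` on `A(G;p)`. -/
noncomputable def pMark (p : ℕ) (Q : Subgroup G) : pPart p G →+ ℤ :=
  (mark Q : Burnside G →+ ℤ).comp
    (NonUnitalSubringClass.subtype (pPart p G) : pPart p G →+ Burnside G)

theorem pMark_apply (Q : Subgroup G) (a : pPart p G) : pMark p Q a = mark Q (a : Burnside G) := rfl

theorem eq_zero_of_pMark [Finite G] (a : pPart p G)
    (h : ∀ Q : Subgroup G, IsPGroup p Q → pMark p Q a = 0) : a = 0 := by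
  refine eq_zero_of_triangular (fun H : {H : Subgroup G // IsPGroup p H} =>
      (pCoset H.1 H.2 : pPart p G))
    (fun Q => (pMark p Q.1).toIntLinearMap) (fun Q => Nat.card Q.1)
    (fun Q P hQP => (card_lt_or_cls_coset_eq hQP).imp id fun e => Subtype.ext e)
    (fun P => mark_coset_self_ne_zero P.1)
    (mem_span_int_of_closure closure_pCoset a) (fun Q => h Q.1 Q.2)

end PPart

end Burnside

/-! ### Marks on the Burnside ring of a fusion system. -/

namespace FusionSystem

variable {S : Type u} [Group S] (F : FusionSystem S) (p : ℕ) [Fact p.Prime]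

/-- The mark `Φ_Q : A(F)_(p) → ℤ_(p)`. -/
noncomputable def mark (Q : Subgroup S) : PLoc p F.burnside →ₐ[ZLoc p] ZLoc p :=
  PLoc.extend p ((Burnside.mark Q).comp F.burnside.subtype)

variable {F p}

theorem mark_of (Q : Subgroup S) (a : F.burnside) :
    F.mark p Q (PLoc.of p a) = Burnside.mark Q (a : Burnside S) :=
  PLoc.extend_of _ _

theorem eq_zero_of_mark [Finite S] {x : PLoc p F.burnside}
    (h : ∀ Q : Subgroup S, F.mark p Q x = 0) : x = 0 := by
  refine PLoc.eq_zero_of_linExtend (ι := Subgroup S)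
    (fun Q => (((Burnside.mark Q).comp F.burnside.subtype : F.burnside →+* ℤ) : F.burnside →+ ℤ))
    (fun a ha => Subtype.ext (Burnside.eq_zero_of_mark _ ha)) fun Q => ?_
  rw [← PLoc.extend_eq_linExtend]
  exact h Q

theorem ext_mark [Finite S] {x y : PLoc p F.burnside}
    (h : ∀ Q : Subgroup S, F.mark p Q x = F.mark p Q y) : x = y :=
  sub_eq_zero.1 (eq_zero_of_mark fun Q => by rw [map_sub, h, sub_self])

variable (F p) in
/-- All marks together. -/
noncomputable def marks : PLoc p F.burnside →ₐ[ZLoc p] (Subgroup S → ZLoc p) :=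
  AlgHom.pi fun Q => F.mark p Q

theorem marks_injective [Finite S] : Function.Injective (F.marks p) :=
  fun _ _ h => ext_mark fun Q => congrFun h Q

theorem isUnit_of_mark [Finite S] {x : PLoc p F.burnside}
    (h : ∀ Q : Subgroup S, IsUnit (F.mark p Q x)) : IsUnit x :=
  isUnit_of_isUnit_pi (F.marks p) marks_injective (Pi.isUnit_iff.2 h)

/-- Marks detect equality of the two restrictions to P. At R ≤ P they are the marks of a at φ(R) and
at R, and restricting φ to R makes these F-conjugate. -/
theorem mem_burnside_of_mark [Finite S] {a : Burnside S}
    (h : ∀ P Q, F.Conj P Q → Burnside.mark P a = Burnside.mark Q a) : a ∈ F.burnside := by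
  intro P φ hφ
  refine Burnside.ext_mark fun R => ?_
  rw [Burnside.mark_res, Burnside.mark_res]
  symm
  apply h
  let i : R.map P.subtype ≃* R := (R.equivMapOfInjective _ P.subtype_injective).symm
  have hi : ∀ y : R.map P.subtype, ((i y : P) : S) = y := fun y => by
    obtain ⟨r, rfl⟩ := i.symm.surjective y
    rw [MulEquiv.apply_symm_apply]
    rfl
  have hinj : Function.Injective ((⊤ : Subgroup S).subtype.comp φ) :=
    (⊤ : Subgroup S).subtype_injective.comp (F.injective hφ)
  let e := i.trans (R.equivMapOfInjective ((⊤ : Subgroup S).subtype.comp φ) hinj)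
  let incl : R.map P.subtype →* P := R.subtype.comp i.toMonoidHom
  have hincl : incl ∈ F.hom (R.map P.subtype) P := F.conj_mem 1 incl fun x => by
    rw [one_mul, inv_one, mul_one]
    exact hi x
  exact ⟨_, (F.equiv_mem e (F.comp_mem hincl hφ) fun x => rfl).1, e.bijective⟩

/-- The converse of `mem_burnside_of_mark`: the stability condition for an isomorphism P → Q is
evaluated at the mark of the whole group P. -/
theorem mark_eq_of_conj {P Q : Subgroup S} (h : F.Conj P Q) (a : F.burnside) :
    Burnside.mark P (a : Burnside S) = Burnside.mark Q (a : Burnside S) := by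
  obtain ⟨φ, hφ, hb⟩ := h
  have hmem : (Subgroup.inclusion (le_top : Q ≤ ⊤)).comp φ ∈ F.hom P ⊤ :=
    F.comp_mem hφ (F.conj_mem 1 _ fun x => by simp)
  have := congrArg (Burnside.mark ⊤) (a.2 P _ hmem)
  rw [Burnside.mark_res, Burnside.mark_res] at this
  have h₁ : Subgroup.map P.subtype ⊤ = P := by rw [← MonoidHom.range_eq_map, P.range_subtype]
  have h₂ : Subgroup.map ((⊤ : Subgroup S).subtype.comp
      ((Subgroup.inclusion (le_top : Q ≤ ⊤)).comp φ)) ⊤ = Q := by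
    ext x
    constructor
    · rintro ⟨y, -, rfl⟩
      exact (φ y).2
    · intro hx
      obtain ⟨y, hy⟩ := hb.2 ⟨x, hx⟩
      exact ⟨y, trivial, congrArg Subtype.val hy⟩
  rw [h₁, h₂] at this
  exact this.symm

theorem plocMark_eq_of_conj {P Q : Subgroup S} (h : F.Conj P Q) (x : PLoc p F.burnside) :
    F.mark p P x = F.mark p Q x := by
  obtain ⟨n, a, hn, hx⟩ := PLoc.exists_smul_eq_of x
  refine (ZLoc.isUnit_intCast p hn).mul_left_cancel ?_
  rw [← smul_eq_mul, ← smul_eq_mul, ← map_smul, ← map_smul, hx, mark_of, mark_of,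
    mark_eq_of_conj h]

end FusionSystem

/-! ### Graphs of morphisms -/

namespace Subgroup

variable {S : Type u} [Group S]

/-- The domain of a relation given by a subgroup of `S × S`. -/
def dom (D : Subgroup (S × S)) : Subgroup S := D.map (MonoidHom.fst S S)

/-- The range of a relation given by a subgroup of `S × S`. -/
def cod (D : Subgroup (S × S)) : Subgroup S := D.map (MonoidHom.snd S S)

/-- The inverse relation. -/
def relInv (D : Subgroup (S × S)) : Subgroup (S × S) :=
  D.comap ((MonoidHom.snd S S).prod (MonoidHom.fst S S))

/-- The composition of relations, first `D` and then `E`. -/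
def relComp (D E : Subgroup (S × S)) : Subgroup (S × S) where
  carrier := {z | ∃ y, (z.1, y) ∈ D ∧ (y, z.2) ∈ E}
  one_mem' := ⟨1, D.one_mem, E.one_mem⟩
  mul_mem' := fun ⟨y, h₁, h₂⟩ ⟨y', h₁', h₂'⟩ => ⟨y * y', D.mul_mem h₁ h₁', E.mul_mem h₂ h₂'⟩
  inv_mem' := fun ⟨y, h₁, h₂⟩ => ⟨y⁻¹, D.inv_mem h₁, E.inv_mem h₂⟩

/-- The graph of the conjugation by `s` on `P`. -/
def conjGraph (P : Subgroup S) (s : S) : Subgroup (S × S) :=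
  P.map ((MonoidHom.id S).prod (MulAut.conj s).toMonoidHom)

variable {D E : Subgroup (S × S)} {x y : S}

theorem mem_dom : x ∈ D.dom ↔ ∃ y, (x, y) ∈ D :=
  ⟨fun ⟨z, hz, h⟩ => ⟨z.2, by rw [← h]; exact hz⟩, fun ⟨y, hy⟩ => ⟨_, hy, rfl⟩⟩

theorem mem_cod : y ∈ D.cod ↔ ∃ x, (x, y) ∈ D :=
  ⟨fun ⟨z, hz, h⟩ => ⟨z.1, by rw [← h]; exact hz⟩, fun ⟨y, hy⟩ => ⟨_, hy, rfl⟩⟩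

theorem mem_relInv : (x, y) ∈ D.relInv ↔ (y, x) ∈ D := Iff.rfl

theorem mem_relComp : (x, y) ∈ relComp D E ↔ ∃ t, (x, t) ∈ D ∧ (t, y) ∈ E := Iff.rfl

theorem mem_conjGraph {P : Subgroup S} {s : S} :
    (x, y) ∈ P.conjGraph s ↔ x ∈ P ∧ y = s * x * s⁻¹ := by
  constructor
  · rintro ⟨z, hz, h⟩
    obtain ⟨rfl, rfl⟩ := Prod.ext_iff.1 h
    exact ⟨hz, rfl⟩
  · rintro ⟨hx, rfl⟩
    exact ⟨x, hx, rfl⟩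

theorem dom_relInv : D.relInv.dom = D.cod := by
  ext; simp only [mem_dom, mem_cod, mem_relInv]

theorem cod_relInv : D.relInv.cod = D.dom := by
  ext; simp only [mem_dom, mem_cod, mem_relInv]

theorem dom_conjGraph (P : Subgroup S) (s : S) : (P.conjGraph s).dom = P := by
  ext; simp [mem_dom, mem_conjGraph]

theorem cod_conjGraph_one (P : Subgroup S) : (P.conjGraph 1).cod = P := by
  ext; simp [mem_cod, mem_conjGraph]

theorem dom_mono (h : D ≤ E) : D.dom ≤ E.dom := map_mono h

theorem cod_mono (h : D ≤ E) : D.cod ≤ E.cod := map_mono h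

theorem dom_relComp (h : D.cod ≤ E.dom) : (relComp D E).dom = D.dom := by
  ext x
  simp only [mem_dom, mem_relComp]
  constructor
  · rintro ⟨y, t, h, -⟩
    exact ⟨t, h⟩
  · rintro ⟨t, ht⟩
    obtain ⟨y, hy⟩ := mem_dom.1 (h (mem_cod.2 ⟨x, ht⟩))
    exact ⟨y, t, ht, hy⟩

theorem cod_relComp (h : E.dom ≤ D.cod) : (relComp D E).cod = E.cod := by
  ext x
  simp only [mem_cod, mem_relComp]
  constructor
  · rintro ⟨y, t, -, h⟩
    exact ⟨t, h⟩
  · rintro ⟨t, ht⟩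
    obtain ⟨y, hy⟩ := mem_cod.1 (h (mem_dom.2 ⟨x, ht⟩))
    exact ⟨y, t, hy, ht⟩

theorem cod_relComp_le : (relComp D E).cod ≤ E.cod := by
  intro x hx
  obtain ⟨y, t, -, h⟩ := mem_cod.1 hx
  exact mem_cod.2 ⟨t, h⟩

end Subgroup

namespace FusionSystem

open Subgroup

variable {S : Type u} [Group S] (F : FusionSystem S)

/-- `D` is the graph of a morphism of `F`. -/
def IsGraph (D : Subgroup (S × S)) : Prop :=
  ∃ (P : Subgroup S) (φ : P →* (⊤ : Subgroup S)), φ ∈ F.hom P ⊤ ∧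
    ∀ z, z ∈ D ↔ ∃ x : P, ((x : S), (φ x : S)) = z

variable {F}

theorem inclusion_mem {P Q : Subgroup S} (h : P ≤ Q) : Subgroup.inclusion h ∈ F.hom P Q :=
  F.conj_mem 1 _ fun x => by simp

theorem isGraph_of_mem {P Q : Subgroup S} {φ : P →* Q} (hφ : φ ∈ F.hom P Q)
    {D : Subgroup (S × S)} (h : ∀ z, z ∈ D ↔ ∃ x : P, ((x : S), (φ x : S)) = z) : F.IsGraph D :=
  ⟨P, _, F.comp_mem hφ (inclusion_mem le_top), h⟩

theorem isGraph_conjGraph (P : Subgroup S) (s : S) : F.IsGraph (P.conjGraph s) := by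
  let φ : P →* (⊤ : Subgroup S) := ((MulAut.conj s).toMonoidHom.comp P.subtype).codRestrict ⊤
    fun _ => trivial
  refine isGraph_of_mem (φ := φ) (F.conj_mem s φ fun _ => rfl) ?_
  rintro ⟨x, y⟩
  rw [mem_conjGraph]
  constructor
  · rintro ⟨hx, rfl⟩
    exact ⟨⟨x, hx⟩, rfl⟩
  · rintro ⟨x, h⟩
    obtain ⟨rfl, rfl⟩ := Prod.ext_iff.1 h
    exact ⟨x.2, rfl⟩

/-! ### Closure of graphs under restriction, inversion, composition and conjugation. -/

namespace IsGraph

variable {D E : Subgroup (S × S)}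

/-- The morphism with a given graph. -/
theorem exists_hom (hD : F.IsGraph D) {P Q : Subgroup S} (hP : D.dom = P) (hQ : D.cod ≤ Q) :
    ∃ φ ∈ F.hom P Q, ∀ z, z ∈ D ↔ ∃ x : P, ((x : S), (φ x : S)) = z := by
  obtain ⟨P', φ, hφ, h⟩ := hD
  obtain rfl : P' = P := by
    rw [← hP]
    ext x
    rw [mem_dom]
    constructor
    · exact fun hx => ⟨_, (h _).2 ⟨⟨x, hx⟩, rfl⟩⟩
    · rintro ⟨y, hy⟩
      obtain ⟨z, hz⟩ := (h _).1 hy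
      exact (show (z : S) = x from (Prod.ext_iff.1 hz).1) ▸ z.2
  have hmem : ∀ x : P', ((φ x : (⊤ : Subgroup S)) : S) ∈ D.cod := fun x =>
    mem_cod.2 ⟨x, (h _).2 ⟨x, rfl⟩⟩
  let ψ : P' →* D.cod := ((⊤ : Subgroup S).subtype.comp φ).codRestrict D.cod hmem
  have hψ : Function.Bijective ψ := by
    constructor
    · intro x y hxy
      exact F.injective hφ (Subtype.ext (congrArg (fun z : D.cod => (z : S)) hxy))
    · rintro ⟨y, hy⟩
      obtain ⟨x, hx⟩ := mem_cod.1 hy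
      obtain ⟨z, hz⟩ := (h _).1 hx
      exact ⟨z, Subtype.ext (Prod.ext_iff.1 hz).2⟩
  have := (F.equiv_mem (MulEquiv.ofBijective ψ hψ) hφ fun _ => rfl).1
  exact ⟨_, F.comp_mem this (inclusion_mem hQ), h⟩

theorem right_unique (hD : F.IsGraph D) {x y y' : S} (h : (x, y) ∈ D) (h' : (x, y') ∈ D) :
    y = y' := by
  obtain ⟨P, φ, hφ, H⟩ := hD
  obtain ⟨z, hz⟩ := (H _).1 h
  obtain ⟨z', hz'⟩ := (H _).1 h'
  obtain ⟨h₁, h₂⟩ := Prod.ext_iff.1 hz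
  obtain ⟨h₁', h₂'⟩ := Prod.ext_iff.1 hz'
  have : z = z' := Subtype.ext (h₁.trans h₁'.symm)
  subst this
  exact h₂.symm.trans h₂'

theorem left_unique (hD : F.IsGraph D) {x x' y : S} (h : (x, y) ∈ D) (h' : (x', y) ∈ D) :
    x = x' := by
  obtain ⟨P, φ, hφ, H⟩ := hD
  obtain ⟨z, hz⟩ := (H _).1 h
  obtain ⟨z', hz'⟩ := (H _).1 h'
  obtain ⟨h₁, h₂⟩ := Prod.ext_iff.1 hz
  obtain ⟨h₁', h₂'⟩ := Prod.ext_iff.1 hz'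
  have : z = z' := F.injective hφ (Subtype.ext (h₂.trans h₂'.symm))
  subst this
  exact h₁.symm.trans h₁'

theorem mono (hD : F.IsGraph D) (h : E ≤ D) : F.IsGraph E := by
  obtain ⟨φ, hφ, H⟩ := hD.exists_hom rfl (le_top (a := D.cod))
  refine isGraph_of_mem (F.comp_mem (inclusion_mem (dom_mono h)) hφ) ?_
  rintro ⟨x, y⟩
  constructor
  · intro hxy
    obtain ⟨z, hz⟩ := (H _).1 (h hxy)
    obtain ⟨rfl, rfl⟩ := Prod.ext_iff.1 hz
    exact ⟨⟨z, mem_dom.2 ⟨_, hxy⟩⟩, rfl⟩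
  · rintro ⟨x, h'⟩
    obtain ⟨rfl, rfl⟩ := Prod.ext_iff.1 h'
    obtain ⟨y, hy⟩ := mem_dom.1 x.2
    rwa [hD.right_unique (h hy) ((H _).2 ⟨⟨x, dom_mono h x.2⟩, rfl⟩)] at hy

theorem relInv (hD : F.IsGraph D) : F.IsGraph D.relInv := by
  obtain ⟨φ, hφ, H⟩ := hD.exists_hom rfl (le_refl D.cod)
  have hb : Function.Bijective φ := by
    refine ⟨F.injective hφ, ?_⟩
    rintro ⟨y, hy⟩
    obtain ⟨x, hx⟩ := mem_cod.1 hy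
    obtain ⟨z, hz⟩ := (H _).1 hx
    exact ⟨z, Subtype.ext (Prod.ext_iff.1 hz).2⟩
  refine isGraph_of_mem (F.equiv_mem (MulEquiv.ofBijective φ hb) hφ fun _ => rfl).2 ?_
  rintro ⟨y, x⟩
  rw [mem_relInv, H]
  constructor
  · rintro ⟨z, hz⟩
    obtain ⟨rfl, rfl⟩ := Prod.ext_iff.1 hz
    exact ⟨φ z, Prod.ext rfl
      (congrArg Subtype.val ((MulEquiv.ofBijective φ hb).symm_apply_apply z))⟩
  · rintro ⟨z, hz⟩
    obtain ⟨rfl, rfl⟩ := Prod.ext_iff.1 hz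
    refine ⟨(MulEquiv.ofBijective φ hb).symm z, Prod.ext rfl ?_⟩
    exact congrArg Subtype.val ((MulEquiv.ofBijective φ hb).apply_symm_apply z)

theorem relComp (hD : F.IsGraph D) (hE : F.IsGraph E) : F.IsGraph (relComp D E) := by
  -- The range of `D` need not lie in the domain of `E`, so `D` is first cut down to the part on
  -- which the composite is defined.
  let D' : Subgroup (S × S) := D ⊓ E.dom.comap (MonoidHom.snd S S)
  have hD' : F.IsGraph D' := hD.mono inf_le_left
  have hcod : D'.cod ≤ E.dom := by
    rintro _ ⟨z, hz, rfl⟩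
    exact hz.2
  obtain ⟨φ, hφ, H⟩ := hD'.exists_hom rfl hcod
  obtain ⟨ψ, hψ, H'⟩ := hE.exists_hom rfl (le_refl E.cod)
  refine isGraph_of_mem (F.comp_mem hφ hψ) ?_
  rintro ⟨x, y⟩
  constructor
  · rintro ⟨t, h₁, h₂⟩
    obtain ⟨z, hz⟩ := (H (x, t)).1 ⟨h₁, mem_dom.2 ⟨_, h₂⟩⟩
    obtain ⟨rfl, rfl⟩ := Prod.ext_iff.1 hz
    obtain ⟨w, hw⟩ := (H' _).1 h₂
    obtain ⟨h₁, rfl⟩ := Prod.ext_iff.1 hw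
    have : w = φ z := Subtype.ext h₁
    subst this
    exact ⟨z, rfl⟩
  · rintro ⟨x, h⟩
    obtain ⟨rfl, rfl⟩ := Prod.ext_iff.1 h
    exact ⟨φ x, ((H _).2 ⟨x, rfl⟩).1, (H' _).2 ⟨φ x, rfl⟩⟩

theorem conj (hD : F.IsGraph D) (g : S × S) : F.IsGraph (D.map (MulAut.conj g).toMonoidHom) := by
  -- Conjugating a graph by (g₁, g₂) is precomposition with conjugation by g₁⁻¹ and postcomposition
  -- with conjugation by g₂.
  have h := ((isGraph_conjGraph (F := F) ⊤ g.1⁻¹).relComp hD).relComp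
    (isGraph_conjGraph (F := F) ⊤ g.2)
  convert h using 1
  ext ⟨x, y⟩
  simp only [mem_relComp, mem_conjGraph, Subgroup.mem_map]
  constructor
  · rintro ⟨⟨a, b⟩, hab, h⟩
    obtain ⟨rfl, rfl⟩ := Prod.ext_iff.1 h
    exact ⟨b, ⟨a, by simp [mul_assoc], hab⟩, by simp⟩
  · rintro ⟨b, ⟨a, ⟨-, rfl⟩, hab⟩, -, rfl⟩
    exact ⟨_, hab, Prod.ext (by simp [mul_assoc]) (by simp)⟩

theorem card_dom (hD : F.IsGraph D) : Nat.card D.dom = Nat.card D := by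
  refine (Nat.card_congr (Equiv.ofBijective (fun z : D => (⟨z.1.1, mem_dom.2 ⟨_, z.2⟩⟩ : D.dom))
    ⟨?_, ?_⟩)).symm
  · rintro ⟨⟨x, y⟩, h⟩ ⟨⟨x', y'⟩, h'⟩ e
    obtain rfl : x = x' := congrArg Subtype.val e
    simp only [Subtype.mk.injEq, Prod.mk.injEq, true_and]
    exact hD.right_unique h h'
  · rintro ⟨x, hx⟩
    obtain ⟨y, hy⟩ := mem_dom.1 hx
    exact ⟨⟨_, hy⟩, rfl⟩

theorem card_cod (hD : F.IsGraph D) : Nat.card D.cod = Nat.card D := by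
  rw [← dom_relInv, hD.relInv.card_dom]
  exact Nat.card_congr ⟨fun z => ⟨(z.1.2, z.1.1), z.2⟩, fun z => ⟨(z.1.2, z.1.1), z.2⟩,
    fun _ => rfl, fun _ => rfl⟩

theorem conj_dom_cod (hD : F.IsGraph D) : F.Conj D.dom D.cod := by
  obtain ⟨φ, hφ, H⟩ := hD.exists_hom rfl (le_refl D.cod)
  refine ⟨φ, hφ, F.injective hφ, ?_⟩
  rintro ⟨y, hy⟩
  obtain ⟨x, hx⟩ := mem_cod.1 hy
  obtain ⟨z, hz⟩ := (H _).1 hx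
  exact ⟨z, Subtype.ext (Prod.ext_iff.1 hz).2⟩

end IsGraph

/-- The graph of a homomorphism between subgroups. -/
def homGraph {P Q : Subgroup S} (φ : P →* Q) : Subgroup (S × S) :=
  (P.subtype.prod (Q.subtype.comp φ)).range

theorem mem_homGraph {P Q : Subgroup S} {φ : P →* Q} (z : S × S) :
    z ∈ homGraph φ ↔ ∃ x : P, ((x : S), (φ x : S)) = z := Iff.rfl

theorem isGraph_homGraph {P Q : Subgroup S} {φ : P →* Q} (hφ : φ ∈ F.hom P Q) :
    F.IsGraph (homGraph φ) := isGraph_of_mem hφ mem_homGraph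

theorem dom_homGraph {P Q : Subgroup S} (φ : P →* Q) : (homGraph φ).dom = P := by
  ext x
  rw [mem_dom]
  constructor
  · rintro ⟨y, z, hz⟩
    exact (show (z : S) = x from (Prod.ext_iff.1 hz).1) ▸ z.2
  · exact fun hx => ⟨_, ⟨x, hx⟩, rfl⟩

theorem cod_homGraph_le {P Q : Subgroup S} (φ : P →* Q) : (homGraph φ).cod ≤ Q := by
  intro y hy
  obtain ⟨x, z, hz⟩ := mem_cod.1 hy
  exact (show (φ z : S) = y from (Prod.ext_iff.1 hz).2) ▸ (φ z).2

theorem conj_iff_exists_graph {P Q : Subgroup S} :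
    F.Conj P Q ↔ ∃ D, F.IsGraph D ∧ D.dom = P ∧ D.cod = Q := by
  constructor
  · rintro ⟨φ, hφ, hb⟩
    refine ⟨homGraph φ, isGraph_homGraph hφ, dom_homGraph φ, le_antisymm (cod_homGraph_le φ) ?_⟩
    intro y hy
    obtain ⟨x, hx⟩ := hb.2 ⟨y, hy⟩
    exact mem_cod.2 ⟨x, x, Prod.ext rfl (congrArg Subtype.val hx)⟩
  · rintro ⟨D, hD, rfl, rfl⟩
    exact hD.conj_dom_cod

theorem Conj.refl (P : Subgroup S) : F.Conj P P :=
  conj_iff_exists_graph.2 ⟨_, isGraph_conjGraph P 1, dom_conjGraph P 1, cod_conjGraph_one P⟩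

theorem Conj.symm {P Q : Subgroup S} (h : F.Conj P Q) : F.Conj Q P := by
  obtain ⟨D, hD, rfl, rfl⟩ := conj_iff_exists_graph.1 h
  exact conj_iff_exists_graph.2 ⟨_, hD.relInv, dom_relInv, cod_relInv⟩

theorem Conj.trans {P Q R : Subgroup S} (h : F.Conj P Q) (h' : F.Conj Q R) : F.Conj P R := by
  obtain ⟨D, hD, rfl, rfl⟩ := conj_iff_exists_graph.1 h
  obtain ⟨E, hE, hd, rfl⟩ := conj_iff_exists_graph.1 h'
  exact conj_iff_exists_graph.2 ⟨_, hD.relComp hE, dom_relComp hd.ge, cod_relComp hd.le⟩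

theorem Conj.card_eq {P Q : Subgroup S} (h : F.Conj P Q) : Nat.card P = Nat.card Q := by
  obtain ⟨D, hD, rfl, rfl⟩ := conj_iff_exists_graph.1 h
  rw [hD.card_dom, hD.card_cod]

/-! ### Counting morphisms by their graphs. -/

/-- The set of graphs of the morphisms in `F(Q, P)`. -/
def graphs (F : FusionSystem S) (Q P : Subgroup S) : Set (Subgroup (S × S)) :=
  {D | F.IsGraph D ∧ D.dom = Q ∧ D.cod ≤ P}

/-- The set of graphs of the isomorphisms from `Q` to `P` in `F`. -/
def isoGraphs (F : FusionSystem S) (Q P : Subgroup S) : Set (Subgroup (S × S)) :=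
  {D | F.IsGraph D ∧ D.dom = Q ∧ D.cod = P}

theorem IsGraph.relInv_relComp_relComp {D E : Subgroup (S × S)} (hE : F.IsGraph E)
    (h : D.dom ≤ E.cod) : Subgroup.relComp E.relInv (Subgroup.relComp E D) = D := by
  ext ⟨x, y⟩
  simp only [mem_relComp, mem_relInv]
  constructor
  · rintro ⟨t, htx, s, hts, hsy⟩
    rwa [hE.right_unique htx hts]
  · intro hxy
    obtain ⟨t, ht⟩ := mem_cod.1 (h (mem_dom.2 ⟨_, hxy⟩))
    exact ⟨t, ht, x, ht, hxy⟩

theorem card_graphs_eq_of_conj [Finite S] {Q Q' : Subgroup S} (h : F.Conj Q Q')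
    (P : Subgroup S) : Nat.card (F.graphs Q P) = Nat.card (F.graphs Q' P) := by
  have key : ∀ {Q Q' : Subgroup S}, F.Conj Q Q' →
      Nat.card (F.graphs Q' P) ≤ Nat.card (F.graphs Q P) := by
    intro Q Q' h
    obtain ⟨E, hE, rfl, rfl⟩ := conj_iff_exists_graph.1 h
    refine Nat.card_le_card_of_injective (fun D => ⟨Subgroup.relComp E D.1, hE.relComp D.2.1,
      dom_relComp D.2.2.1.ge, cod_relComp_le.trans D.2.2.2⟩) fun D D' e => Subtype.ext ?_
    rw [← hE.relInv_relComp_relComp D.2.2.1.le, ← hE.relInv_relComp_relComp D'.2.2.1.le]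
    exact congrArg (Subgroup.relComp E.relInv) (congrArg Subtype.val e)
  exact le_antisymm (key h.symm) (key h)

theorem card_isoGraphs_eq_of_conj [Finite S] {Q Q' : Subgroup S} (h : F.Conj Q Q')
    (P : Subgroup S) : Nat.card (F.isoGraphs Q P) = Nat.card (F.isoGraphs Q' P) := by
  have key : ∀ {Q Q' : Subgroup S}, F.Conj Q Q' →
      Nat.card (F.isoGraphs Q' P) ≤ Nat.card (F.isoGraphs Q P) := by
    intro Q Q' h
    obtain ⟨E, hE, rfl, rfl⟩ := conj_iff_exists_graph.1 h
    refine Nat.card_le_card_of_injective (fun D => ⟨Subgroup.relComp E D.1, hE.relComp D.2.1,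
      dom_relComp D.2.2.1.ge, (cod_relComp D.2.2.1.le).trans D.2.2.2⟩) fun D D' e => Subtype.ext ?_
    rw [← hE.relInv_relComp_relComp D.2.2.1.le, ← hE.relInv_relComp_relComp D'.2.2.1.le]
    exact congrArg (Subgroup.relComp E.relInv) (congrArg Subtype.val e)
  exact le_antisymm (key h.symm) (key h)

theorem card_isoGraphs_comm (Q P : Subgroup S) :
    Nat.card (F.isoGraphs Q P) = Nat.card (F.isoGraphs P Q) :=
  Nat.card_congr
    { toFun := fun D => ⟨D.1.relInv, D.2.1.relInv, dom_relInv.trans D.2.2.2,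
        cod_relInv.trans D.2.2.1⟩
      invFun := fun D => ⟨D.1.relInv, D.2.1.relInv, dom_relInv.trans D.2.2.2,
        cod_relInv.trans D.2.2.1⟩
      left_inv := fun _ => rfl
      right_inv := fun _ => rfl }

theorem card_isoGraphs_eq [Finite S] {Q Q' : Subgroup S} (h : F.Conj Q Q') :
    Nat.card (F.isoGraphs Q Q') = Nat.card (F.isoGraphs Q Q) := by
  rw [card_isoGraphs_comm, card_isoGraphs_eq_of_conj h.symm]

theorem card_isoGraphs_pos [Finite S] (Q : Subgroup S) : 0 < Nat.card (F.isoGraphs Q Q) :=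
  have : Nonempty (F.isoGraphs Q Q) :=
    ⟨⟨_, isGraph_conjGraph Q 1, dom_conjGraph Q 1, cod_conjGraph_one Q⟩⟩
  Nat.card_pos

/-- Morphisms Q → S are sorted by their image. The possible images are the F-conjugates of Q, and
each is reached by as many isomorphisms as Q has F-automorphisms. -/
theorem card_conjClass_mul_card_isoGraphs [Finite S] (Q : Subgroup S) :
    Nat.card (F.conjClass Q) * Nat.card (F.isoGraphs Q Q) = Nat.card (F.graphs Q ⊤) := by
  have := Fintype.ofFinite (F.conjClass Q)
  have e : F.graphs Q ⊤ ≃ Σ Q' : F.conjClass Q, F.isoGraphs Q Q'.1 :=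
    { toFun := fun D => ⟨⟨D.1.cod, (congrArg (F.Conj · D.1.cod) D.2.2.1).mp D.2.1.conj_dom_cod⟩,
        ⟨D.1, D.2.1, D.2.2.1, rfl⟩⟩
      invFun := fun z => ⟨z.2.1, z.2.2.1, z.2.2.2.1, le_top⟩
      left_inv := fun _ => rfl
      right_inv := by
        rintro ⟨⟨Q', hQ'⟩, ⟨D, hD, hd, hc⟩⟩
        change D.cod = Q' at hc
        subst hc
        rfl }
  rw [Nat.card_congr e, Nat.card_sigma, Finset.sum_congr rfl fun Q' _ => card_isoGraphs_eq Q'.2,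
    Finset.sum_const, smul_eq_mul, Nat.card_eq_fintype_card, Finset.card_univ]

theorem relComp_conjGraph_cancel (D : Subgroup (S × S)) (s : S) :
    relComp (relComp D (conjGraph ⊤ s)) (conjGraph ⊤ s⁻¹) = D := by
  ext ⟨x, y⟩
  simp [mem_relComp, mem_conjGraph, mul_assoc]

/-- Double counting: a pair of s ∈ S and a morphism D : Q → P corresponds to the isomorphism c_s ∘ D
from Q onto its image Q', together with s, which satisfies s⁻¹Q's ≤ P. For fixed Q' the elements s
are counted by the fixed points of S/P. -/
theorem sum_numFixed_coset [Finite S] (Q : Subgroup S) [Fintype (F.conjClass Q)] (P : Subgroup S) :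
    (∑ Q' : F.conjClass Q, FinGSet.numFixed Q'.1 (FinGSet.coset P)) * Nat.card P *
      Nat.card (F.isoGraphs Q Q) = Nat.card S * Nat.card (F.graphs Q P) := by
  -- The image Q' is determined by the graph, so an element of the dependent sum is determined by s
  -- and the graph.
  have hext : ∀ z w : Σ Q' : F.conjClass Q,
      {s : S // ∀ q ∈ Q'.1, s⁻¹ * q * s ∈ P} × F.isoGraphs Q Q'.1,
      z.2.1.1 = w.2.1.1 → z.2.2.1 = w.2.2.1 → z = w := by
    rintro ⟨⟨Q', hQ'⟩, ⟨s, hs⟩, ⟨D, hD, hd, hc⟩⟩ ⟨⟨Q'', hQ''⟩, ⟨s', hs'⟩, ⟨D', hD', hd', hc'⟩⟩ h h'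
    change D.cod = Q' at hc
    change D'.cod = Q'' at hc'
    change s = s' at h
    change D = D' at h'
    subst h h' hc hc'
    rfl
  have e : S × F.graphs Q P ≃ Σ Q' : F.conjClass Q,
      {s : S // ∀ q ∈ Q'.1, s⁻¹ * q * s ∈ P} × F.isoGraphs Q Q'.1 :=
    { toFun := fun z => ⟨⟨(relComp z.2.1 (conjGraph ⊤ z.1)).cod, by
          have hg := z.2.2.1.relComp (isGraph_conjGraph (F := F) ⊤ z.1)
          have := hg.conj_dom_cod
          rwa [dom_relComp ((dom_conjGraph ⊤ z.1).symm ▸ le_top), z.2.2.2.1] at this⟩,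
        ⟨z.1, fun q hq => by
          obtain ⟨x, t, hxt, htq⟩ := mem_cod.1 hq
          obtain ⟨-, rfl⟩ := mem_conjGraph.1 htq
          simpa [mul_assoc] using z.2.2.2.2 (mem_cod.2 ⟨x, hxt⟩)⟩,
        ⟨relComp z.2.1 (conjGraph ⊤ z.1), z.2.2.1.relComp (isGraph_conjGraph (F := F) ⊤ z.1),
          (dom_relComp ((dom_conjGraph ⊤ z.1).symm ▸ le_top)).trans z.2.2.2.1, rfl⟩⟩
      invFun := fun z => ⟨z.2.1.1, ⟨relComp z.2.2.1 (conjGraph ⊤ z.2.1.1⁻¹),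
        z.2.2.2.1.relComp (isGraph_conjGraph (F := F) ⊤ _),
        (dom_relComp (le_top.trans (dom_conjGraph ⊤ _).ge)).trans z.2.2.2.2.1, fun y hy => by
          obtain ⟨x, t, hxt, htq⟩ := mem_cod.1 hy
          obtain ⟨-, rfl⟩ := mem_conjGraph.1 htq
          simpa using z.2.1.2 t (z.2.2.2.2.2.le (mem_cod.2 ⟨x, hxt⟩))⟩⟩
      left_inv := by
        rintro ⟨s, D, hD⟩
        refine Prod.ext rfl (Subtype.ext ?_)
        exact relComp_conjGraph_cancel D s
      right_inv := by
        refine fun z => hext _ _ rfl ?_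
        have := relComp_conjGraph_cancel z.2.2.1 z.2.1.1⁻¹
        rwa [inv_inv] at this }
  rw [← Nat.card_prod, Nat.card_congr e, Nat.card_sigma, Finset.sum_mul, Finset.sum_mul]
  refine Finset.sum_congr rfl fun Q' _ => ?_
  rw [Nat.card_prod, FinGSet.numFixed_coset_mul_card, card_isoGraphs_eq Q'.2]

end FusionSystem

/-! ### Characteristic bisets -/

namespace FinGSet

variable {S : Type u} [Group S]

/-- Two points in the same orbit of the second factor, restricted to `P`. -/
def rightSetoid (Ω : FinGSet (S × S)) (P : Subgroup S) : Setoid Ω where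
  r ω ω' := ∃ y ∈ P, ((1, y) : S × S) • ω = ω'
  iseqv :=
    { refl := fun ω => ⟨1, P.one_mem, one_smul _ ω⟩
      symm := by
        rintro ω _ ⟨y, hy, rfl⟩
        refine ⟨y⁻¹, P.inv_mem hy, ?_⟩
        rw [smul_smul, Prod.mk_mul_mk, one_mul, inv_mul_cancel]
        exact one_smul _ ω
      trans := by
        rintro ω _ _ ⟨y, hy, rfl⟩ ⟨z, hz, rfl⟩
        refine ⟨z * y, P.mul_mem hz hy, ?_⟩
        rw [smul_smul, Prod.mk_mul_mk, one_mul] }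

/-- The quotient `Ω / P` by the second factor, with the action of the first factor. -/
def rightQuot (Ω : FinGSet (S × S)) (P : Subgroup S) : FinGSet S :=
  have : Finite (Quotient (rightSetoid Ω P)) := Quotient.finite _
  letI : MulAction S (Quotient (rightSetoid Ω P)) :=
    { smul := fun s => Quotient.map (fun ω => ((s, 1) : S × S) • ω) (by
        rintro ω _ ⟨y, hy, rfl⟩
        refine ⟨y, hy, ?_⟩
        rw [smul_smul, smul_smul]
        simp)
      one_smul := by
        rintro ⟨ω⟩
        exact congrArg (Quotient.mk (rightSetoid Ω P)) (one_smul (S × S) ω)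
      mul_smul := by
        rintro s t ⟨ω⟩
        refine congrArg (Quotient.mk (rightSetoid Ω P)) ?_
        change ((s * t, 1) : S × S) • ω = ((s, 1) : S × S) • ((t, 1) : S × S) • ω
        rw [smul_smul, Prod.mk_mul_mk, mul_one] }
  ⟨Quotient (rightSetoid Ω P)⟩

/-- The class of `ω` in `Ω / P`. -/
def rightMk (Ω : FinGSet (S × S)) (P : Subgroup S) (ω : Ω) : Ω.rightQuot P :=
  Quotient.mk (rightSetoid Ω P) ω

theorem smul_rightMk (Ω : FinGSet (S × S)) (P : Subgroup S) (s : S) (ω : Ω) :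
    s • Ω.rightMk P ω = Ω.rightMk P (((s, 1) : S × S) • ω) := rfl

theorem rightMk_eq_iff {Ω : FinGSet (S × S)} {P : Subgroup S} {ω ω' : Ω} :
    Ω.rightMk P ω = Ω.rightMk P ω' ↔ ∃ y ∈ P, ((1, y) : S × S) • ω = ω' :=
  Quotient.eq (r := rightSetoid Ω P)

theorem rightMk_surjective (Ω : FinGSet (S × S)) (P : Subgroup S) :
    Function.Surjective (Ω.rightMk P) := Quotient.mk_surjective

theorem smul_rightMk_eq_self_iff {Ω : FinGSet (S × S)} {P : Subgroup S} {ω : Ω} {x : S} :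
    x • Ω.rightMk P ω = Ω.rightMk P ω ↔ ∃ y ∈ P, ((x, y) : S × S) • ω = ω := by
  rw [smul_rightMk, rightMk_eq_iff]
  refine exists_congr fun y => and_congr_right fun _ => ?_
  rw [smul_smul, Prod.mk_mul_mk, one_mul, mul_one]

/-- Fixed points of a quotient by a free action of the second factor. -/
theorem numFixed_rightQuot_mul_card (Ω : FinGSet (S × S)) (P Q : Subgroup S)
    (hfree : ∀ (ω : Ω) (y : S), ((1, y) : S × S) • ω = ω → y = 1) :
    numFixed Q (Ω.rightQuot P) * Nat.card P =
      Nat.card {ω : Ω // ∀ x ∈ Q, ∃ y ∈ P, ((x, y) : S × S) • ω = ω} := by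
  rw [numFixed, ← Nat.card_prod]
  -- With representatives chosen, freeness makes (q, y) ↦ (1, y) • r q a bijection from (fixed
  -- classes) × P onto the points lying over fixed classes.
  let r : Ω.rightQuot P → Ω := Function.surjInv (Ω.rightMk_surjective P)
  have hr : ∀ q, Ω.rightMk P (r q) = q := Function.surjInv_eq (Ω.rightMk_surjective P)
  have hmk : ∀ (y : P) q, Ω.rightMk P (((1, y.1) : S × S) • r q) = q := fun y q => by
    conv_rhs => rw [← hr q]
    exact (rightMk_eq_iff.2 ⟨y.1, y.2, rfl⟩).symm
  refine Nat.card_congr (Equiv.ofBijective (fun z : {q : Ω.rightQuot P // ∀ g ∈ Q, g • q = q} × P =>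
    (⟨((1, z.2.1) : S × S) • r z.1.1, fun x hx => smul_rightMk_eq_self_iff.1 (by
      rw [hmk]; exact z.1.2 x hx)⟩ :
      {ω : Ω // ∀ x ∈ Q, ∃ y ∈ P, ((x, y) : S × S) • ω = ω})) ⟨?_, ?_⟩)
  · rintro ⟨⟨q, hq⟩, y⟩ ⟨⟨q', hq'⟩, y'⟩ h
    have h' : ((1, y.1) : S × S) • r q = ((1, y'.1) : S × S) • r q' := congrArg Subtype.val h
    have hqq : q = q' := by rw [← hmk y q, h', hmk]
    subst hqq
    have hy : y'⁻¹ * y = (1 : S) := hfree (r q) _ (by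
      rw [← inv_smul_eq_iff, smul_smul] at h'
      simpa using h')
    exact Prod.ext rfl (Subtype.ext (inv_mul_eq_one.1 hy).symm)
  · rintro ⟨ω, hω⟩
    obtain ⟨y, hy, h⟩ := rightMk_eq_iff.1 (hr (Ω.rightMk P ω))
    exact ⟨⟨⟨Ω.rightMk P ω, fun x hx => smul_rightMk_eq_self_iff.2 (hω x hx)⟩, ⟨y, hy⟩⟩,
      Subtype.ext h⟩

end FinGSet

/-! ### Characteristic bisets and the formula for β_P. -/

namespace FusionSystem

open Subgroup

variable {S : Type u} [Group S]

/-- A (two-sided) characteristic biset of `F`, as a set with an action of `S × S`: it is generated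
by morphisms of `F`, it is `F`-stable, and the number of orbits of the second factor is prime
to `p`. -/
structure IsCharacteristic (F : FusionSystem S) (p : ℕ) (Ω : FinGSet (S × S)) : Prop where
  isGraph_stabilizer : ∀ ω : Ω, F.IsGraph (MulAction.stabilizer (S × S) ω)
  numFixed_eq : ∀ {D E : Subgroup (S × S)}, F.IsGraph D → F.IsGraph E → F.Conj D.dom E.dom →
    FinGSet.numFixed D Ω = FinGSet.numFixed E Ω
  not_dvd_card : ¬ p ∣ Nat.card (Ω.rightQuot ⊤)

variable {F : FusionSystem S} {p : ℕ}

/-- For ω over a Q-fixed class of Ω/P, the intersection of the stabilizer of ω with Q × P is the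
graph of a morphism Q → P, and it is the only such graph that fixes ω. Sorting the points by this
graph gives the sum. -/
theorem numFixed_rightQuot_eq_sum [Finite S] {Ω : FinGSet (S × S)}
    (hΩ : ∀ ω : Ω, F.IsGraph (MulAction.stabilizer (S × S) ω)) (P Q : Subgroup S)
    [Fintype (F.graphs Q P)] :
    FinGSet.numFixed Q (Ω.rightQuot P) * Nat.card P =
      ∑ D : F.graphs Q P, FinGSet.numFixed D.1 Ω := by
  rw [Ω.numFixed_rightQuot_mul_card P Q fun ω y h =>
    ((hΩ ω).right_unique (MulAction.mem_stabilizer_iff.2 h) (one_mem _))]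
  unfold FinGSet.numFixed
  rw [← Nat.card_sigma (β := fun D : F.graphs Q P => {ω : Ω // ∀ d ∈ D.1, d • ω = ω})]
  refine Nat.card_congr
    { toFun := fun ω => ⟨⟨MulAction.stabilizer (S × S) ω.1 ⊓ Q.prod P, (hΩ _).mono inf_le_left,
        ?_, ?_⟩, ⟨ω.1, fun d hd => hd.1⟩⟩
      invFun := fun z => ⟨z.2.1, fun x hx => ?_⟩
      left_inv := fun ω => rfl
      right_inv := ?_ }
  · refine le_antisymm ?_ fun x hx => ?_
    · rintro _ ⟨z, hz, rfl⟩
      exact hz.2.1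
    · obtain ⟨y, hy, h⟩ := ω.2 x hx
      exact mem_dom.2 ⟨y, h, hx, hy⟩
  · rintro _ ⟨z, hz, rfl⟩
    exact hz.2.2
  · obtain ⟨y, hy⟩ := mem_dom.1 (z.1.2.2.1.ge hx)
    exact ⟨y, z.1.2.2.2 (mem_cod.2 ⟨x, hy⟩), z.2.2 _ hy⟩
  · rintro ⟨⟨D, hD, hd, hc⟩, ω, hω⟩
    have : MulAction.stabilizer (S × S) ω ⊓ Q.prod P = D := by
      ext ⟨x, y⟩
      constructor
      · rintro ⟨h, hx, hy⟩
        obtain ⟨y', hy'⟩ := mem_dom.1 (hd.ge hx)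
        rwa [(hΩ ω).right_unique h (hω _ hy')]
      · exact fun h => ⟨hω _ h, hd.le (mem_dom.2 ⟨y, h⟩), hc (mem_cod.2 ⟨x, h⟩)⟩
    subst this
    rfl

namespace IsCharacteristic

variable {Ω : FinGSet (S × S)}

/-- All graphs in the sum have domain Q, so stability gives each of them the mark of the diagonal of
Q. -/
theorem numFixed_rightQuot [Finite S] (hΩ : F.IsCharacteristic p Ω) (P Q : Subgroup S) :
    FinGSet.numFixed Q (Ω.rightQuot P) * Nat.card P =
      Nat.card (F.graphs Q P) * FinGSet.numFixed (Q.conjGraph 1) Ω := by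
  have := Fintype.ofFinite (F.graphs Q P)
  rw [numFixed_rightQuot_eq_sum hΩ.isGraph_stabilizer, Finset.sum_congr rfl fun D _ =>
    hΩ.numFixed_eq D.2.1 (isGraph_conjGraph Q 1) (by
      rw [dom_conjGraph, D.2.2.1]; exact Conj.refl Q), Finset.sum_const, smul_eq_mul,
    Finset.card_univ, Nat.card_eq_fintype_card]

theorem rightQuot_mem_burnside [Finite S] (hΩ : F.IsCharacteristic p Ω) (P : Subgroup S) :
    Burnside.cls (Ω.rightQuot P) ∈ F.burnside := by
  refine mem_burnside_of_mark fun Q Q' h => ?_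
  rw [Burnside.mark_cls, Burnside.mark_cls, Nat.cast_inj]
  refine Nat.eq_of_mul_eq_mul_right (Nat.card_pos (α := P)) ?_
  rw [hΩ.numFixed_rightQuot, hΩ.numFixed_rightQuot, card_graphs_eq_of_conj h,
    hΩ.numFixed_eq (isGraph_conjGraph Q 1) (isGraph_conjGraph Q' 1)]
  rwa [dom_conjGraph, dom_conjGraph]

/-- The fixed points of a p-group are congruent modulo p to the number of all points. This makes
every mark of Ω/S a unit of ℤ_(p). -/
theorem not_dvd_numFixed [Fact p.Prime] (hS : IsPGroup p S) (hΩ : F.IsCharacteristic p Ω)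
    (Q : Subgroup S) : ¬ p ∣ FinGSet.numFixed Q (Ω.rightQuot ⊤) := by
  have h := (hS.to_subgroup Q).card_modEq_card_fixedPoints (Ω.rightQuot ⊤)
  have e : Nat.card (MulAction.fixedPoints Q (Ω.rightQuot ⊤)) =
      FinGSet.numFixed Q (Ω.rightQuot ⊤) :=
    Nat.card_congr (Equiv.subtypeEquivRight fun x => ⟨fun h g hg => h ⟨g, hg⟩, fun h g => h g g.2⟩)
  rw [e] at h
  exact fun hd => hΩ.not_dvd_card ((Nat.ModEq.dvd_iff h dvd_rfl).2 hd)

end IsCharacteristic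

/-- The two counting identities turn the average into Φ_Q(b) = |S| |F(Q,P)| / (|P| |F(Q,S)|), here
with denominators cleared. This is the form in which β_P is used from here on. -/
theorem isStabilization_iff [Finite S] [Fact p.Prime] {P : Subgroup S} {b : PLoc p F.burnside} :
    F.IsStabilization p (PLoc.of p (Burnside.cls (FinGSet.coset P))) b ↔
      ∀ Q : Subgroup S, F.mark p Q b * (Nat.card P * Nat.card (F.graphs Q ⊤)) =
        Nat.card S * Nat.card (F.graphs Q P) := by
  refine forall_congr' fun Q => ?_
  have := Fintype.ofFinite (F.conjClass Q)
  have hsum : ∑ᶠ Q' ∈ F.conjClass Q, PLoc.extend p (Burnside.mark Q')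
      (PLoc.of p (Burnside.cls (FinGSet.coset P))) =
      ((∑ Q' : F.conjClass Q, FinGSet.numFixed Q'.1 (FinGSet.coset P) : ℕ) : ZLoc p) := by
    rw [← finsum_set_coe_eq_finsum_mem (F.conjClass Q) (f := fun Q' => PLoc.extend p
      (Burnside.mark Q') (PLoc.of p (Burnside.cls (FinGSet.coset P)))), finsum_eq_sum_of_fintype,
      Nat.cast_sum]
    refine Finset.sum_congr rfl fun Q' _ => ?_
    rw [PLoc.extend_of, Burnside.mark_cls, Int.cast_natCast]
  rw [hsum]
  have h₁ := sum_numFixed_coset (F := F) Q P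
  have h₂ := card_conjClass_mul_card_isoGraphs (F := F) Q
  have h₁' := congrArg (Nat.cast : ℕ → ZLoc p) h₁
  have h₂' := congrArg (Nat.cast : ℕ → ZLoc p) h₂
  rw [Nat.cast_mul, Nat.cast_mul, Nat.cast_mul] at h₁'
  rw [Nat.cast_mul] at h₂'
  have hne : (Nat.card P * Nat.card (F.isoGraphs Q Q) : ZLoc p) ≠ 0 := by
    exact_mod_cast (Nat.mul_pos Nat.card_pos (card_isoGraphs_pos Q)).ne'
  rw [← h₁', ← h₂', ← mul_left_inj' hne]
  change _ * F.mark p Q b * _ = _ ↔ _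
  constructor <;> intro h <;> linear_combination h

theorem IsStabilization.eq [Finite S] [Fact p.Prime] {X : PLoc p (Burnside S)}
    {b b' : PLoc p F.burnside} (h : F.IsStabilization p X b) (h' : F.IsStabilization p X b') :
    b = b' := by
  refine ext_mark fun Q => ?_
  have : Nonempty (F.conjClass Q) := ⟨⟨Q, Conj.refl Q⟩⟩
  have hne : (Nat.card (F.conjClass Q) : ZLoc p) ≠ 0 := by
    exact_mod_cast (Nat.card_pos (α := F.conjClass Q)).ne'
  exact mul_left_cancel₀ hne ((h Q).trans (h' Q).symm)

theorem IsCharacteristic.existsUnique_isStabilization [Finite S] [Fact p.Prime]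
    (hS : IsPGroup p S) {Ω : FinGSet (S × S)} (hΩ : F.IsCharacteristic p Ω) (P : Subgroup S) :
    ∃! b, F.IsStabilization p (PLoc.of p (Burnside.cls (FinGSet.coset P))) b := by
  refine existsUnique_of_exists_of_unique ?_ fun b b' h h' => h.eq h'
  let ω : Subgroup S → PLoc p F.burnside := fun P =>
    PLoc.of p ⟨_, hΩ.rightQuot_mem_burnside P⟩
  have hω : ∀ P Q, F.mark p Q (ω P) = FinGSet.numFixed Q (Ω.rightQuot P) := fun P Q => by
    rw [mark_of, Burnside.mark_cls, Int.cast_natCast]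
  have hu : IsUnit (ω ⊤) := isUnit_of_mark fun Q => by
    rw [hω]
    exact ZLoc.isUnit_natCast p (hΩ.not_dvd_numFixed hS Q)
  obtain ⟨v, hv⟩ := isUnit_iff_exists_inv.1 hu
  -- The candidate is [Ω/P]/[Ω/S]: by `numFixed_rightQuot` the common factor |Ω^Δ(Q)| drops out of
  -- the quotient of the marks.
  refine ⟨ω P * v, isStabilization_iff.2 fun Q => ?_⟩
  have hvQ := congrArg (F.mark p Q) hv
  rw [map_mul, map_one, hω] at hvQ
  rw [map_mul, hω]
  have h₁ := congrArg (Nat.cast : ℕ → ZLoc p) (hΩ.numFixed_rightQuot P Q)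
  have h₂ := congrArg (Nat.cast : ℕ → ZLoc p) (hΩ.numFixed_rightQuot ⊤ Q)
  rw [Nat.cast_mul, Nat.cast_mul] at h₁ h₂
  rw [Nat.card_congr (Subgroup.topEquiv (G := S)).toEquiv] at h₂
  -- If the diagonal had no fixed points, the mark of Ω/S at Q would vanish, although it is
  -- invertible.
  have hne : (FinGSet.numFixed (Q.conjGraph 1) Ω : ZLoc p) ≠ 0 := by
    intro h0
    rw [h0, mul_zero] at h₂
    have hS0 : (Nat.card S : ZLoc p) ≠ 0 := by exact_mod_cast (Nat.card_pos (α := S)).ne'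
    rw [(mul_eq_zero.1 h₂).resolve_right hS0, zero_mul] at hvQ
    exact zero_ne_one hvQ
  refine mul_right_cancel₀ hne ?_
  linear_combination (F.mark p Q v * (Nat.card (F.graphs Q ⊤)) *
      (FinGSet.numFixed (Q.conjGraph 1) Ω : ZLoc p)) * h₁ -
    (Nat.card (F.graphs Q P) : ZLoc p) * (FinGSet.numFixed (Q.conjGraph 1) Ω) *
      F.mark p Q v * h₂ +
    (Nat.card S * Nat.card (F.graphs Q P) : ZLoc p) *
      (FinGSet.numFixed (Q.conjGraph 1) Ω) * hvQ

end FusionSystem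

/-! ### The elements `β_P` generate -/

namespace FusionSystem

open Subgroup

variable {S : Type u} [Group S] {F : FusionSystem S} {p : ℕ}

theorem isStabilization_beta [Finite S] [Fact p.Prime] {P : Subgroup S}
    (h : ∃! b, F.IsStabilization p (PLoc.of p (Burnside.cls (FinGSet.coset P))) b) :
    F.IsStabilization p (PLoc.of p (Burnside.cls (FinGSet.coset P))) (F.beta p P) :=
  Classical.epsilon_spec h.exists

theorem mark_beta [Finite S] [Fact p.Prime] {P : Subgroup S}
    (h : ∃! b, F.IsStabilization p (PLoc.of p (Burnside.cls (FinGSet.coset P))) b)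
    (Q : Subgroup S) : F.mark p Q (F.beta p P) * (Nat.card P * Nat.card (F.graphs Q ⊤)) =
      Nat.card S * Nat.card (F.graphs Q P) :=
  isStabilization_iff.1 (isStabilization_beta h) Q

theorem card_graphs_top_pos [Finite S] (Q : Subgroup S) : 0 < Nat.card (F.graphs Q ⊤) :=
  have : Nonempty (F.graphs Q ⊤) :=
    ⟨⟨_, isGraph_conjGraph Q 1, dom_conjGraph Q 1, le_top⟩⟩
  Nat.card_pos

theorem mark_beta_eq_zero [Finite S] [Fact p.Prime] {P : Subgroup S}
    (h : ∃! b, F.IsStabilization p (PLoc.of p (Burnside.cls (FinGSet.coset P))) b)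
    {Q : Subgroup S} (hQ : F.graphs Q P = ∅) : F.mark p Q (F.beta p P) = 0 := by
  have hm := mark_beta h Q
  have hc : Nat.card (F.graphs Q P) = 0 := by rw [hQ]; exact Nat.card_of_isEmpty
  rw [hc, Nat.cast_zero, mul_zero] at hm
  refine (mul_eq_zero.1 hm).resolve_right ?_
  exact_mod_cast (Nat.mul_pos Nat.card_pos (card_graphs_top_pos Q)).ne'

theorem graphs_self (Q : Subgroup S) [Finite S] : F.graphs Q Q = F.isoGraphs Q Q := by
  ext D
  refine ⟨fun ⟨hD, hd, hc⟩ => ⟨hD, hd, Subgroup.eq_of_le_of_card_ge hc ?_⟩,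
    fun ⟨hD, hd, hc⟩ => ⟨hD, hd, hc.le⟩⟩
  rw [hD.card_cod, ← hD.card_dom, hd]

/-- The diagonal entry of the table of marks of the β_P: |S| divided by |Q| and by the size of the
F-class of Q. -/
theorem mark_beta_self [Finite S] [Fact p.Prime] {Q : Subgroup S}
    (h : ∃! b, F.IsStabilization p (PLoc.of p (Burnside.cls (FinGSet.coset Q))) b) :
    F.mark p Q (F.beta p Q) * (Nat.card Q * Nat.card (F.conjClass Q)) = Nat.card S := by
  have hm := mark_beta h Q
  rw [← card_conjClass_mul_card_isoGraphs, graphs_self, Nat.cast_mul] at hm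
  have hne : (Nat.card (F.isoGraphs Q Q) : ZLoc p) ≠ 0 := by
    exact_mod_cast (card_isoGraphs_pos (F := F) Q).ne'
  refine mul_right_cancel₀ hne ?_
  linear_combination hm

theorem conj_map_conj (Q : Subgroup S) (s : S) :
    F.Conj Q (Q.map (MulAut.conj s).toMonoidHom) := by
  refine conj_iff_exists_graph.2 ⟨_, isGraph_conjGraph Q s, dom_conjGraph Q s, ?_⟩
  ext y
  simp only [mem_cod, mem_conjGraph, Subgroup.mem_map]
  exact exists_congr fun x => and_congr_right fun _ => eq_comm

theorem exists_fullyNormalized [Finite S] (P : Subgroup S) :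
    ∃ Q, F.Conj P Q ∧ F.FullyNormalized Q := by
  obtain ⟨Q, hQ, hmax⟩ := (F.conjClass P).toFinite.exists_maximalFor
    (fun Q : Subgroup S => Nat.card (Subgroup.normalizer (Q : Set S))) _ ⟨P, Conj.refl P⟩
  refine ⟨Q, hQ, fun R hR => ?_⟩
  by_contra hlt
  exact hlt (hmax (Conj.trans hQ hR) (not_le.1 hlt).le)

/-- If all point stabilizers of an action of a `p`-group have order at most `p ^ n`, then the order
of the group divides the product of `p ^ n` and the number of points. -/
theorem _root_.IsPGroup.card_dvd_card_mul {G X : Type*} [Group G] [Finite G] [Finite X]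
    [MulAction G X] [Fact p.Prime] (hG : IsPGroup p G) (N : Subgroup G)
    (h : ∀ x : X, Nat.card (MulAction.stabilizer G x) ≤ Nat.card N) :
    Nat.card G ∣ Nat.card X * Nat.card N := by
  have := Fintype.ofFinite (Quotient (MulAction.orbitRel G X))
  rw [Nat.card_congr (MulAction.selfEquivSigmaOrbitsQuotientStabilizer G X), Nat.card_sigma,
    Finset.sum_mul]
  refine Finset.dvd_sum fun ω _ => ?_
  obtain ⟨k, hk⟩ := IsPGroup.iff_card.1 (hG.to_subgroup N)
  obtain ⟨l, hl⟩ := IsPGroup.iff_card.1 (hG.to_subgroup (MulAction.stabilizer G ω.out))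
  have hle := h ω.out
  rw [hk, hl] at hle
  have hdvd : Nat.card (MulAction.stabilizer G ω.out) ∣ Nat.card N := by
    rw [hk, hl]
    exact pow_dvd_pow p ((Nat.pow_le_pow_iff_right (Fact.out : p.Prime).one_lt).1 hle)
  rw [Subgroup.card_eq_card_quotient_mul_card_subgroup (MulAction.stabilizer G ω.out)]
  exact mul_dvd_mul_left _ hdvd

/-- S acts by conjugation on the F-class of Q. The stabilizers are contained in normalizers, whose
orders are at most |N_S(Q)|. All these orders are powers of p, so every orbit length is a multiple
of |S : N_S(Q)|. -/
theorem FullyNormalized.card_dvd [Finite S] [Fact p.Prime] (hS : IsPGroup p S) {Q : Subgroup S}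
    (hQ : F.FullyNormalized Q) :
    Nat.card S ∣ Nat.card (F.conjClass Q) * Nat.card (Subgroup.normalizer (Q : Set S)) := by
  let _ : MulAction S (F.conjClass Q) :=
    { smul := fun s R => ⟨R.1.map (MulAut.conj s).toMonoidHom, Conj.trans R.2 (conj_map_conj _ s)⟩
      one_smul := fun R => Subtype.ext (by
        change R.1.map (MulAut.conj (1 : S)).toMonoidHom = R.1
        ext; simp)
      mul_smul := fun s t R => Subtype.ext (by
        change R.1.map (MulAut.conj (s * t)).toMonoidHom =
          (R.1.map (MulAut.conj t).toMonoidHom).map (MulAut.conj s).toMonoidHom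
        rw [Subgroup.map_map, map_mul]
        rfl) }
  refine hS.card_dvd_card_mul _ fun R => ?_
  refine le_trans ?_ (hQ R.1 R.2)
  refine Subgroup.card_le_of_le fun s hs => ?_
  have h : R.1.map (MulAut.conj s).toMonoidHom = R.1 := congrArg Subtype.val hs
  rw [Subgroup.mem_normalizer_iff]
  intro x
  constructor
  · intro hx
    rw [← h]
    exact ⟨x, hx, rfl⟩
  · intro hx
    obtain ⟨y, hy, hyx⟩ := h.ge hx
    have : y = x := by simpa using hyx
    exact this ▸ hy

/-- The elements whose marks vanish outside of a set `U` of subgroups which is closed under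
subconjugation are linear combinations of the `β_P` with `P ∈ U`. -/
theorem mem_span_beta [Finite S] [Fact p.Prime] (hS : IsPGroup p S)
    (hβ : ∀ P, ∃! b, F.IsStabilization p (PLoc.of p (Burnside.cls (FinGSet.coset P))) b)
    (U : Set (Subgroup S)) (hU : ∀ Q P, (F.graphs Q P).Nonempty → P ∈ U → Q ∈ U)
    (x : PLoc p F.burnside) (hx : ∀ Q ∉ U, F.mark p Q x = 0) :
    x ∈ Submodule.span (ZLoc p) (F.beta p '' U) := by
  induction hn : U.ncard using Nat.strong_induction_on generalizing U x with
  | _ n ih =>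
  rcases U.eq_empty_or_nonempty with rfl | hne
  · rw [eq_zero_of_mark fun Q => hx Q (Set.notMem_empty Q)]
    exact zero_mem _
  -- A member of largest order is replaced by a fully normalized conjugate Q, which still lies in U.
  -- No subgroup strictly above Q is in U, so the marks of x vanish there.
  obtain ⟨P, hP, hmax⟩ := U.toFinite.exists_maximalFor (fun Q : Subgroup S => Nat.card Q) U hne
  obtain ⟨Q, hPQ, hQ⟩ := exists_fullyNormalized (F := F) P
  have hconj : ∀ {R R'}, F.Conj R R' → R' ∈ U → R ∈ U := fun {R R'} h hR' => by
    obtain ⟨D, hD, hd, hc⟩ := conj_iff_exists_graph.1 h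
    exact hU _ _ ⟨D, hD, hd, hc.le⟩ hR'
  have hQU : Q ∈ U := hconj hPQ.symm hP
  have hQmax : ∀ R ∈ U, Nat.card R ≤ Nat.card Q := fun R hR => by
    rw [← hPQ.card_eq]
    by_contra hlt
    exact hlt (hmax hR (not_le.1 hlt).le)
  have habove : ∀ R, Q < R → R ∉ U := fun R hR hRU =>
    hR.ne (Subgroup.eq_of_le_of_card_ge hR.le (hQmax R hRU))
  -- By `card_normalizer_dvd`, |N_S(Q)/Q| divides Φ_Q(x) in ℤ_(p). By full normalization, Φ_Q(β_Q) =
  -- |S| / (|Q| |[Q]_F|) divides |N_S(Q)/Q|.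
  obtain ⟨c, hc⟩ : ∃ c, F.mark p Q x = c * F.mark p Q (F.beta p Q) := by
    obtain ⟨n, a, hn, ha⟩ := PLoc.exists_smul_eq_of x
    have hmark : ∀ R, (n : ZLoc p) * F.mark p R x = Burnside.mark R (a : Burnside S) := fun R => by
      rw [← mark_of (p := p), ← ha, map_smul, smul_eq_mul]
    have hdvd := Burnside.card_normalizer_dvd Q (a : Burnside S) fun R hR => by
      have := hmark R
      rw [hx R (habove R hR), mul_zero] at this
      exact_mod_cast this.symm
    have hdvd' := ZLoc.dvd_of_intCast_dvd (p := p) hdvd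
    rw [Int.cast_mul, ← hmark, Int.cast_natCast, Int.cast_natCast, mul_left_comm,
      (ZLoc.isUnit_intCast p hn).dvd_mul_left] at hdvd'
    obtain ⟨d, hd⟩ := hdvd'
    obtain ⟨m, hm⟩ := hQ.card_dvd hS
    have hm' := congrArg (Nat.cast : ℕ → ZLoc p) hm
    rw [Nat.cast_mul, Nat.cast_mul] at hm'
    have hself := mark_beta_self (hβ Q)
    have : Nonempty (F.conjClass Q) := ⟨⟨Q, Conj.refl Q⟩⟩
    have hne : (Nat.card Q * Nat.card (F.conjClass Q) : ZLoc p) ≠ 0 := by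
      exact_mod_cast (Nat.mul_pos (Nat.card_pos (α := Q)) (Nat.card_pos (α := F.conjClass Q))).ne'
    refine ⟨m * d, mul_right_cancel₀ hne ?_⟩
    linear_combination (Nat.card (F.conjClass Q) : ZLoc p) * hd + d * hm' - m * d * hself
  -- The difference vanishes on the whole class of Q. Removing this class keeps the set closed under
  -- subconjugation: a morphism from a conjugate of Q into a member of U is an isomorphism, by
  -- maximality of |Q|.
  have hmem : x - c • F.beta p Q ∈ Submodule.span (ZLoc p) (F.beta p '' (U \ F.conjClass Q)) := by
    refine ih _ ?_ (U \ F.conjClass Q) ?_ _ ?_ rfl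
    · rw [← hn]
      exact Set.ncard_lt_ncard ⟨Set.sdiff_subset, fun h => (h hQU).2 (Conj.refl Q)⟩ U.toFinite
    · rintro R P' ⟨D, hD, hd, hc⟩ ⟨hP', hP''⟩
      refine ⟨hU _ _ ⟨D, hD, hd, hc⟩ hP', fun hR => hP'' (Conj.trans hR ?_)⟩
      refine conj_iff_exists_graph.2 ⟨D, hD, hd, Subgroup.eq_of_le_of_card_ge hc ?_⟩
      rw [hD.card_cod, ← hD.card_dom, hd, ← Conj.card_eq hR]
      exact hQmax P' hP'
    · intro R hR
      rw [map_sub, map_smul, smul_eq_mul]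
      by_cases hRQ : F.Conj Q R
      · rw [← plocMark_eq_of_conj hRQ, ← plocMark_eq_of_conj hRQ, hc, sub_self]
      · have hRU : R ∉ U := fun h => hR ⟨h, hRQ⟩
        rw [hx R hRU, mark_beta_eq_zero (hβ Q), mul_zero, sub_zero]
        exact Set.not_nonempty_iff_eq_empty.1 fun h => hRU (hU _ _ h hQU)
  rw [← sub_add_cancel x (c • F.beta p Q)]
  exact add_mem (Submodule.span_mono (Set.image_mono Set.sdiff_subset) hmem)
    (Submodule.smul_mem _ _ (Submodule.subset_span ⟨Q, hQU, rfl⟩))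

theorem span_beta [Finite S] [Fact p.Prime] (hS : IsPGroup p S)
    (hβ : ∀ P, ∃! b, F.IsStabilization p (PLoc.of p (Burnside.cls (FinGSet.coset P))) b) :
    Submodule.span (ZLoc p) (Set.range (F.beta p)) = ⊤ := by
  rw [← Set.image_univ]
  exact eq_top_iff.2 fun x _ => mem_span_beta hS hβ Set.univ (fun _ _ _ _ => trivial) x
    fun Q hQ => (hQ trivial).elim

end FusionSystem

theorem FusionSystem.IsCharacteristic.mark_beta_mul {S : Type u} [Group S] [Finite S]
    {F : FusionSystem S} {p : ℕ} [Fact p.Prime] (hS : IsPGroup p S) {Ω : FinGSet (S × S)}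
    (hΩ : F.IsCharacteristic p Ω) (P Q : Subgroup S) :
    F.mark p Q (F.beta p P) * FinGSet.numFixed Q (Ω.rightQuot ⊤) =
      FinGSet.numFixed Q (Ω.rightQuot P) := by
  have h := mark_beta (hΩ.existsUnique_isStabilization hS P) Q
  have h₁ := congrArg (Nat.cast : ℕ → ZLoc p) (hΩ.numFixed_rightQuot P Q)
  have h₂ := congrArg (Nat.cast : ℕ → ZLoc p) (hΩ.numFixed_rightQuot ⊤ Q)
  rw [Nat.cast_mul, Nat.cast_mul] at h₁ h₂
  rw [Nat.card_congr (Subgroup.topEquiv (G := S)).toEquiv] at h₂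
  have hne : (Nat.card S * Nat.card P : ZLoc p) ≠ 0 := by
    exact_mod_cast (Nat.mul_pos (Nat.card_pos (α := S)) (Nat.card_pos (α := P))).ne'
  refine mul_right_cancel₀ hne ?_
  linear_combination F.mark p Q (F.beta p P) * Nat.card P * h₂ +
    (FinGSet.numFixed (Q.conjGraph 1) Ω : ZLoc p) * h - Nat.card S * h₁

/-! ### The fusion system of a finite group -/

section GroupFusion

open Subgroup

variable {G : Type u} [Group G]

/-- The group `G`, with `S` acting by multiplication from both sides. -/
def groupBiset [Finite G] (S : Subgroup G) : FinGSet (S × S) :=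
  letI : MulAction (S × S) G :=
    { smul := fun z g => z.1 * g * (z.2 : G)⁻¹
      one_smul := fun g => by
        change ((1 : S) : G) * g * ((1 : S) : G)⁻¹ = g
        simp
      mul_smul := fun z w g => by
        change ((z.1 * w.1 : S) : G) * g * ((z.2 * w.2 : S) : G)⁻¹ =
          z.1 * (w.1 * g * (w.2 : G)⁻¹) * (z.2 : G)⁻¹
        push_cast
        group }
  ⟨G⟩

/-- The equation s g t⁻¹ = g says t = g⁻¹sg, so the stabilizer is the graph of conjugation by g⁻¹ on
S ∩ gSg⁻¹. -/
theorem groupBiset_isGraph_stabilizer [Finite G] (S : Subgroup G) (g : groupBiset S) :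
    (fusionOfGroup S).IsGraph (MulAction.stabilizer (S × S) g) := by
  let g' : G := g
  let P : Subgroup S := S.comap ((MulAut.conj g'⁻¹).toMonoidHom.comp S.subtype)
  let φ : P →* (⊤ : Subgroup S) :=
    ((((MulAut.conj g'⁻¹).toMonoidHom.comp S.subtype).comp P.subtype).codRestrict S
      fun x => x.2).codRestrict ⊤ fun _ => trivial
  have hφ : ∀ x : P, ((φ x : S) : G) = g'⁻¹ * ((x : S) : G) * g' := fun x => by
    change g'⁻¹ * ((x : S) : G) * g'⁻¹⁻¹ = _
    rw [inv_inv]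
  refine ⟨P, φ, ⟨g'⁻¹, fun x => by rw [hφ, inv_inv]⟩, ?_⟩
  rintro ⟨s, t⟩
  have hst : (s, t) ∈ MulAction.stabilizer (S × S) g ↔ (t : G) = g'⁻¹ * s * g' := by
    change (s : G) * g' * (t : G)⁻¹ = g' ↔ _
    rw [mul_inv_eq_iff_eq_mul, mul_assoc, eq_inv_mul_iff_mul_eq, eq_comm]
  rw [hst]
  constructor
  · intro h
    have hs : s ∈ P := by
      change g'⁻¹ * (s : G) * g'⁻¹⁻¹ ∈ S
      rw [inv_inv, ← h]
      exact t.2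
    exact ⟨⟨s, hs⟩, Prod.ext rfl (Subtype.ext ((hφ ⟨s, hs⟩).trans h.symm))⟩
  · rintro ⟨x, hx⟩
    obtain ⟨rfl, rfl⟩ := Prod.ext_iff.1 hx
    exact hφ x

/-- If D is the graph of conjugation by g on Q, then k is fixed by D exactly when kg centralizes Q.
So the mark is |C_G(Q)|, which does not change under G-conjugation of Q. -/
theorem numFixed_groupBiset [Finite G] (S : Subgroup G) {D : Subgroup (S × S)}
    (hD : (fusionOfGroup S).IsGraph D) : FinGSet.numFixed D (groupBiset S) =
      Nat.card {c : G // ∀ x ∈ D.dom, (x : G) * c = c * x} := by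
  obtain ⟨φ, ⟨g, hg⟩, H⟩ := hD.exists_hom rfl (le_top (a := D.cod))
  refine Nat.card_congr ((Equiv.mulRight g).subtypeEquiv fun k => ?_)
  constructor
  · intro h x hx
    have := h _ ((H _).2 ⟨⟨x, hx⟩, rfl⟩)
    change (x : G) * k * (((φ ⟨x, hx⟩ : (⊤ : Subgroup S)) : S) : G)⁻¹ = k at this
    rw [hg, mul_inv_eq_iff_eq_mul] at this
    change (x : G) * (k * g) = k * g * x
    rw [← mul_assoc, this]
    simp [mul_assoc]
  · rintro h z hz
    obtain ⟨x, rfl⟩ := (H z).1 hz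
    have := h x x.2
    change ((x : S) : G) * k * (((φ x : (⊤ : Subgroup S)) : S) : G)⁻¹ = k
    change ((x : S) : G) * (k * g) = k * g * x at this
    rw [hg, mul_inv_eq_iff_eq_mul, ← mul_assoc, ← mul_assoc, ← this]
    simp [mul_assoc]

theorem cls_rightQuot_groupBiset [Finite G] (S : Subgroup G) (P : Subgroup S) :
    Burnside.cls ((groupBiset S).rightQuot P) =
      Burnside.res S.subtype (Burnside.cls (FinGSet.coset (P.map S.subtype))) := by
  rw [Burnside.res_cls]
  refine congrArg GrothendieckRing.of (FinGSet.Classes.mk_eq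
    (X := (groupBiset S).rightQuot P)
    (Y := FinGSet.res S.subtype (FinGSet.coset (P.map S.subtype)))
    (Quotient.congr (Equiv.refl G) fun (a b : G) => ?_) fun k x => ?_)
  · change (∃ y ∈ P, ((1 : S) : G) * a * (y : G)⁻¹ = b) ↔ QuotientGroup.leftRel _ a b
    rw [QuotientGroup.leftRel_apply]
    constructor
    · rintro ⟨y, hy, rfl⟩
      exact ⟨y⁻¹, P.inv_mem hy, by simp⟩
    · rintro ⟨y, hy, h⟩
      refine ⟨y⁻¹, P.inv_mem hy, ?_⟩
      change (y : G) = a⁻¹ * b at h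
      simp [h]
  · induction x using Quotient.inductionOn with | _ x
    refine congrArg (QuotientGroup.mk (s := P.map S.subtype)) ?_
    let x' : G := x
    change (k : G) * x' * ((1 : S) : G)⁻¹ = k * x'
    simp

theorem isCharacteristic_groupBiset [Finite G] {p : ℕ} [Fact p.Prime] (S : Sylow p G) :
    (fusionOfGroup (S : Subgroup G)).IsCharacteristic p (groupBiset (S : Subgroup G)) where
  isGraph_stabilizer := groupBiset_isGraph_stabilizer _
  numFixed_eq := by
    rintro D E hD hE h
    rw [numFixed_groupBiset _ hD, numFixed_groupBiset _ hE]
    obtain ⟨φ, ⟨g, hg⟩, hb⟩ := h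
    refine Nat.card_congr ((MulAut.conj g).toEquiv.subtypeEquiv fun c => ?_)
    change _ ↔ ∀ x ∈ E.dom, (x : G) * (g * c * g⁻¹) = g * c * g⁻¹ * x
    constructor
    · intro h y hy
      obtain ⟨x, hx⟩ := hb.2 ⟨y, hy⟩
      have hgx := hg x
      rw [hx] at hgx
      change (y : G) = _ at hgx
      rw [hgx]
      have := h x x.2
      simp only [mul_assoc, inv_mul_cancel_left, mul_right_inj]
      rw [← mul_assoc _ c, this, mul_assoc]
    · intro h x hx
      have := h (φ ⟨x, hx⟩) (φ ⟨x, hx⟩).2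
      rw [hg] at this
      simp only [mul_assoc, inv_mul_cancel_left, mul_right_inj] at this
      simpa only [← mul_assoc, mul_left_inj] using this
  not_dvd_card := by
    have h : Nat.card ((groupBiset (S : Subgroup G)).rightQuot ⊤) = (S : Subgroup G).index := by
      -- The mark at the trivial subgroup counts all points, so this compares the cardinalities of
      -- Ω/S and G/S.
      have := congrArg (Burnside.mark ⊥) (cls_rightQuot_groupBiset (S : Subgroup G) ⊤)
      rw [Burnside.mark_res, Burnside.mark_cls, Burnside.mark_cls, Nat.cast_inj] at this
      have hbot : ∀ {H : Type u} [Group H] (X : FinGSet H), FinGSet.numFixed ⊥ X = Nat.card X :=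
        fun X => Nat.card_congr (Equiv.subtypeUnivEquiv fun x g hg => by
          rw [Subgroup.mem_bot.1 hg, one_smul])
      rw [Subgroup.map_bot, hbot, hbot] at this
      rw [this, ← MonoidHom.range_eq_map, Subgroup.range_subtype]
      rfl
    rw [h]
    exact S.not_dvd_index

theorem IsPGroup.exists_conj_map_sylow [Finite G] {p : ℕ} [Fact p.Prime] (S : Sylow p G)
    {H : Subgroup G} (hH : IsPGroup p H) :
    ∃ (P : Subgroup S) (g : G), (P.map (S : Subgroup G).subtype).map
      (MulAut.conj g).toMonoidHom = H := by
  obtain ⟨T, hT⟩ := hH.exists_le_sylow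
  obtain ⟨g, rfl⟩ := MulAction.exists_smul_eq G S T
  refine ⟨(H.map (MulAut.conj g⁻¹).toMonoidHom).subgroupOf S, g, ?_⟩
  rw [Subgroup.map_subgroupOf_eq_of_le, Subgroup.map_map]
  · have : (MulAut.conj g).toMonoidHom.comp (MulAut.conj g⁻¹).toMonoidHom = MonoidHom.id G := by
      ext x
      simp [mul_assoc]
    rw [this, Subgroup.map_id]
  · rintro _ ⟨x, hx, rfl⟩
    obtain ⟨y, hy, hyx⟩ := hT hx
    have : y = g⁻¹ * x * g := by
      rw [← hyx]
      simp [mul_assoc]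
    have hgx : (MulAut.conj g⁻¹).toMonoidHom x = y := by
      rw [this]
      simp
    rw [hgx]
    exact hy

theorem pMark_mul {p : ℕ} (Q : Subgroup G) (a b : Burnside.pPart p G) :
    Burnside.pMark p Q (a * b) = Burnside.pMark p Q a * Burnside.pMark p Q b :=
  map_mul (Burnside.mark Q) (a : Burnside G) b

theorem sylow_stabilization_ringEquiv [Finite G] {p : ℕ} [Fact p.Prime] (S : Sylow p G) :
    IsInvertibleIn (PLoc.of p (Burnside.pCoset (S : Subgroup G) S.isPGroup')) ∧
      ∃! e : PLoc p (fusionOfGroup (S : Subgroup G)).burnside ≃+* PLoc p (Burnside.pPart p G),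
        ∀ P : Subgroup S, e ((fusionOfGroup (S : Subgroup G)).beta p P) *
            PLoc.of p (Burnside.pCoset (S : Subgroup G) S.isPGroup') =
          PLoc.of p (Burnside.pCoset (P.map (S : Subgroup G).subtype)
            ((S.isPGroup'.to_subgroup P).map (S : Subgroup G).subtype)) := by
  have hΩ := isCharacteristic_groupBiset S
  have htop : Burnside.pCoset (S : Subgroup G) S.isPGroup' =
      Burnside.pCoset ((⊤ : Subgroup S).map (S : Subgroup G).subtype)
        ((S.isPGroup'.to_subgroup ⊤).map (S : Subgroup G).subtype) :=
    Subtype.ext (congrArg (fun H : Subgroup G => Burnside.cls (FinGSet.coset H))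
      (by rw [← MonoidHom.range_eq_map, Subgroup.range_subtype]))
  rw [htop]
  let g : PLoc p (Burnside.pPart p G) →ₗ[ZLoc p] (Subgroup S → ZLoc p) := LinearMap.pi fun Q =>
    PLoc.linExtend p (Burnside.pMark p (Q.map (S : Subgroup G).subtype))
  have hg : ∀ P Q : Subgroup S, g (PLoc.of p (Burnside.pCoset (P.map (S : Subgroup G).subtype)
      ((S.isPGroup'.to_subgroup P).map (S : Subgroup G).subtype))) Q =
      FinGSet.numFixed Q ((groupBiset (S : Subgroup G)).rightQuot P) := fun P Q => by
    refine (PLoc.linExtend_of (Burnside.pMark p (Q.map (S : Subgroup G).subtype)) _).trans ?_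
    rw [Burnside.pMark_apply, ← Burnside.mark_res]
    change ((Burnside.mark Q (Burnside.res _ (Burnside.cls _)) : ℤ) : ZLoc p) = _
    rw [← cls_rightQuot_groupBiset, Burnside.mark_cls, Int.cast_natCast]
  refine existsUnique_ringEquiv_of_pi (J := Subgroup S)
    ((fusionOfGroup (S : Subgroup G)).marks p) FusionSystem.marks_injective g ?_ ?_
    ((fusionOfGroup (S : Subgroup G)).beta p)
    (FusionSystem.span_beta S.isPGroup' (hΩ.existsUnique_isStabilization S.isPGroup'))
    (fun P => PLoc.of p (Burnside.pCoset (P.map (S : Subgroup G).subtype)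
      ((S.isPGroup'.to_subgroup P).map (S : Subgroup G).subtype))) ?_ ⊤ ?_ ?_
  -- Marks at p-subgroups of G detect A(G;p), and by Sylow's theorem each of them equals a mark at a
  -- subgroup of S.
  · rw [injective_iff_map_eq_zero]
    intro x hx
    refine PLoc.eq_zero_of_linExtend (ι := {H : Subgroup G // IsPGroup p H})
      (fun H => Burnside.pMark p H.1) (fun a ha => Burnside.eq_zero_of_pMark a
        fun Q hQ => ha ⟨Q, hQ⟩) fun H => ?_
    obtain ⟨P, k, hk⟩ := H.2.exists_conj_map_sylow S
    have : Burnside.pMark p H.1 = Burnside.pMark p (P.map (S : Subgroup G).subtype) := by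
      ext a
      rw [Burnside.pMark_apply, Burnside.pMark_apply, ← hk, Burnside.mark_conj]
    rw [this]
    exact congrFun hx P
  · intro x y
    ext Q
    exact PLoc.linExtend_mul (Burnside.pMark p (Q.map (S : Subgroup G).subtype))
      (pMark_mul _) x y
  · have : Set.range (fun P : Subgroup S => Burnside.pCoset (P.map (S : Subgroup G).subtype)
        ((S.isPGroup'.to_subgroup P).map (S : Subgroup G).subtype)) =
        Set.range fun H : {H : Subgroup G // IsPGroup p H} =>
          (Burnside.pCoset H.1 H.2 : Burnside.pPart p G) := by
      refine subset_antisymm ?_ ?_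
      · rintro _ ⟨P, rfl⟩
        exact ⟨⟨_, (S.isPGroup'.to_subgroup P).map (S : Subgroup G).subtype⟩, rfl⟩
      · rintro _ ⟨⟨H, hH⟩, rfl⟩
        obtain ⟨P, k, hk⟩ := hH.exists_conj_map_sylow S
        refine ⟨P, Subtype.ext (Burnside.cls_coset_conj k⁻¹ fun x => ?_)⟩
        change _ ↔ k⁻¹⁻¹ * x * k⁻¹ ∈ H
        rw [← hk, inv_inv]
        constructor
        · exact fun hx => ⟨x, hx, rfl⟩
        · rintro ⟨y, hy, hyx⟩
          have : y = x := by simpa using hyx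
          exact this ▸ hy
    have h := PLoc.span_of_eq_top (p := p)
      (this ▸ Burnside.closure_pCoset (p := p) (G := G))
    rwa [← Set.range_comp] at h
  · rw [Pi.isUnit_iff]
    intro Q
    rw [hg]
    exact ZLoc.isUnit_natCast p (hΩ.not_dvd_numFixed S.isPGroup' Q)
  · intro P
    ext Q
    rw [Pi.mul_apply, hg, hg]
    exact (hΩ.mark_beta_mul S.isPGroup' P Q).symm

end GroupFusion

/-! ### Graphs in saturated fusion systems -/

namespace FusionSystem

open Subgroup

variable {S : Type u} [Group S] {F : FusionSystem S} {p : ℕ}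

theorem mem_normalizer_of_forall [Finite S] {D : Subgroup (S × S)} {x y : S}
    (h : ∀ a b, (a, b) ∈ D → (x * a * x⁻¹, y * b * y⁻¹) ∈ D) :
    (x, y) ∈ normalizer (D : Set (S × S)) :=
  Subgroup.mem_normalizer_fintype fun z hz => h z.1 z.2 hz

theorem conj_mem_of_mem_normalizer {D : Subgroup (S × S)} {x y a b : S}
    (h : (x, y) ∈ normalizer (D : Set (S × S))) (hab : (a, b) ∈ D) :
    (x * a * x⁻¹, y * b * y⁻¹) ∈ D :=
  (Subgroup.mem_normalizer_iff.1 h (a, b)).1 hab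

theorem dom_normalizer_le (D : Subgroup (S × S)) :
    (normalizer (D : Set (S × S))).dom ≤ normalizer (D.dom : Set S) := by
  intro x hx
  obtain ⟨y, hy⟩ := mem_dom.1 hx
  rw [Subgroup.mem_normalizer_iff]
  intro a
  constructor
  · intro ha
    obtain ⟨b, hb⟩ := mem_dom.1 ha
    exact mem_dom.2 ⟨_, conj_mem_of_mem_normalizer hy hb⟩
  · intro ha
    obtain ⟨b, hb⟩ := mem_dom.1 ha
    have h := conj_mem_of_mem_normalizer (x := x⁻¹) (y := y⁻¹) (inv_mem hy) hb
    exact mem_dom.2 ⟨_, by simpa [mul_assoc] using h⟩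

/-- A pair (x, y) normalizes the graph of φ exactly when x normalizes the domain and φ ∘ c_x = c_y ∘
φ. Hence N_φ is the domain of the normalizer of the graph, and the extension axiom takes this form.
-/
theorem IsSaturated.exists_extension [Finite S] (hF : F.IsSaturated p) {D : Subgroup (S × S)}
    (hD : F.IsGraph D) (hc : F.FullyCentralized D.cod) :
    ∃ E, F.IsGraph E ∧ D ≤ E ∧ E.dom = (normalizer (D : Set (S × S))).dom := by
  obtain ⟨φ, hφ, H⟩ := hD.exists_hom rfl (le_top (a := D.cod))
  have hr : φ.range.map (⊤ : Subgroup S).subtype = D.cod := by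
    ext y
    rw [mem_cod]
    constructor
    · rintro ⟨_, ⟨x, rfl⟩, rfl⟩
      exact ⟨x, (H _).2 ⟨x, rfl⟩⟩
    · rintro ⟨x, hx⟩
      obtain ⟨z, hz⟩ := (H _).1 hx
      exact ⟨φ z, ⟨z, rfl⟩, (Prod.ext_iff.1 hz).2⟩
  obtain ⟨ψ, hψ, hcomp⟩ := hF.extension D.dom φ hφ (hr ▸ hc)
  refine ⟨homGraph ψ, isGraph_homGraph hψ, fun z hz => ?_, ?_⟩
  · obtain ⟨x, rfl⟩ := (H _).1 hz
    refine ⟨Subgroup.inclusion (le_extensionDomain φ) x, Prod.ext rfl ?_⟩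
    exact congrArg (fun f : D.dom →* (⊤ : Subgroup S) => ((f x : (⊤ : Subgroup S)) : S)) hcomp
  rw [dom_homGraph]
  ext x
  rw [mem_dom]
  constructor
  · rintro ⟨hx, y, hy⟩
    refine ⟨y, mem_normalizer_of_forall fun a b hab => ?_⟩
    obtain ⟨u, hu⟩ := (H _).1 hab
    obtain ⟨rfl, rfl⟩ := Prod.ext_iff.1 hu
    have hv : x * u * x⁻¹ ∈ D.dom := (Subgroup.mem_normalizer_iff.1 hx u).1 u.2
    exact (H _).2 ⟨⟨_, hv⟩, Prod.ext rfl (hy u ⟨_, hv⟩ rfl)⟩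
  · rintro ⟨y, hy⟩
    refine ⟨dom_normalizer_le D (mem_dom.2 ⟨y, hy⟩), y, fun u v huv => ?_⟩
    have h := conj_mem_of_mem_normalizer hy ((H _).2 ⟨u, rfl⟩)
    rw [← huv] at h
    exact hD.right_unique ((H _).2 ⟨v, rfl⟩) h

/-- A fully normalized subgroup is the target of an isomorphism which is compatible with the
conjugation by all elements normalizing the source. -/
theorem IsSaturated.exists_isoGraph [Finite S] [Fact p.Prime] (hS : IsPGroup p S)
    (hF : F.IsSaturated p) {P Q : Subgroup S} (hQ : F.FullyNormalized Q) (h : F.Conj P Q) :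
    ∃ D, F.IsGraph D ∧ D.dom = P ∧ D.cod = Q ∧
      normalizer (P : Set S) ≤ (normalizer (D : Set (S × S))).dom := by
  obtain ⟨φ, hφ, hb⟩ := h
  let e : P ≃* Q := MulEquiv.ofBijective φ hb
  obtain ⟨he, he'⟩ := F.equiv_mem e hφ fun _ => rfl
  -- N_S(P) acts on P by conjugation. Transported to Q along e, its image is a p-subgroup of
  -- Aut_F(Q).
  let μ : normalizer (P : Set S) →* MulAut Q :=
    (MulAut.congr e).toMonoidHom.comp P.normalizerMonoidHom
  have hc : ∀ s : normalizer (P : Set S), (P.normalizerMonoidHom s).toMonoidHom ∈ F.hom P P :=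
    fun s => F.conj_mem s _ fun _ => rfl
  have hμ : ∀ s, μ s ∈ F.aut Q := fun s => F.comp_mem (F.comp_mem he' (hc s)) he
  let μ' : normalizer (P : Set S) →* F.aut Q := μ.codRestrict (F.aut Q) hμ
  have hp : IsPGroup p μ'.range :=
    (hS.to_subgroup _).of_surjective μ'.rangeRestrict μ'.rangeRestrict_surjective
  obtain ⟨T, hT⟩ := hp.exists_le_sylow
  obtain ⟨T₀, hT₀⟩ := (hF.fullyNormalized Q hQ).2
  -- Since Aut_S(Q) is a Sylow subgroup of Aut_F(Q), some g ∈ Aut_F(Q) moves that image into it. The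
  -- corrected isomorphism g ∘ e then carries conjugation by N_S(P) to conjugation by elements of S.
  obtain ⟨g, hg⟩ := MulAction.exists_smul_eq (F.aut Q) T T₀
  have hge : (g.1.toMonoidHom.comp e.toMonoidHom) ∈ F.hom P Q := F.comp_mem he g.2
  refine ⟨homGraph (g.1.toMonoidHom.comp e.toMonoidHom), isGraph_homGraph hge, dom_homGraph _,
    le_antisymm (cod_homGraph_le _) fun y hy => ?_, fun s hs => ?_⟩
  · refine mem_cod.2 ⟨e.symm (g.1.symm ⟨y, hy⟩), e.symm (g.1.symm ⟨y, hy⟩), Prod.ext rfl ?_⟩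
    change ((g.1 (e (e.symm (g.1.symm ⟨y, hy⟩))) : Q) : S) = y
    rw [MulEquiv.apply_symm_apply, MulEquiv.apply_symm_apply]
  · have hmem : g * μ' ⟨s, hs⟩ * g⁻¹ ∈ (T₀ : Subgroup (F.aut Q)) := by
      rw [← hg]
      exact ⟨μ' ⟨s, hs⟩, hT ⟨_, rfl⟩, rfl⟩
    rw [hT₀] at hmem
    obtain ⟨t, ht⟩ := hmem
    refine mem_dom.2 ⟨t, mem_normalizer_of_forall fun a b hab => ?_⟩
    obtain ⟨x, hx⟩ := hab
    obtain ⟨rfl, rfl⟩ := Prod.ext_iff.1 hx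
    refine ⟨P.normalizerMonoidHom ⟨s, hs⟩ x, Prod.ext rfl ?_⟩
    refine Eq.trans ?_ (ht (g.1 (e x)))
    change ((g.1 (e (P.normalizerMonoidHom ⟨s, hs⟩ x)) : Q) : S) =
      ((g.1 (e (P.normalizerMonoidHom ⟨s, hs⟩ (e.symm (g.1⁻¹ (g.1 (e x)))))) : Q) : S)
    rw [MulAut.inv_apply_self, MulEquiv.symm_apply_apply]

theorem mem_normalizer_relComp [Finite S] {D E : Subgroup (S × S)} {x y z : S}
    (h : (x, y) ∈ normalizer (D : Set (S × S))) (h' : (y, z) ∈ normalizer (E : Set (S × S))) :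
    (x, z) ∈ normalizer (relComp D E : Set (S × S)) :=
  mem_normalizer_of_forall fun _ _ ⟨_, ht, ht'⟩ =>
    ⟨_, conj_mem_of_mem_normalizer h ht, conj_mem_of_mem_normalizer h' ht'⟩

theorem mem_normalizer_relInv [Finite S] {D : Subgroup (S × S)} {x y : S}
    (h : (x, y) ∈ normalizer (D : Set (S × S))) :
    (y, x) ∈ normalizer (D.relInv : Set (S × S)) :=
  mem_normalizer_of_forall fun _ _ hab => conj_mem_of_mem_normalizer (D := D) h hab

/-- The normalizer of a graph can be moved into the normalizer of a fixed diagonal subgroup by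
morphisms of `F` in both coordinates. -/
theorem IsSaturated.exists_transport [Finite S] [Fact p.Prime] (hS : IsPGroup p S)
    (hF : F.IsSaturated p) {D : Subgroup (S × S)} (hD : F.IsGraph D) {Q : Subgroup S}
    (hQ : F.FullyNormalized Q) (h : F.Conj D.dom Q) :
    ∃ K L, F.IsGraph K ∧ F.IsGraph L ∧ (normalizer (D : Set (S × S))).dom ≤ K.dom ∧
      (normalizer (D : Set (S × S))).cod ≤ L.dom ∧
      relComp K.relInv (relComp D L) = Q.conjGraph 1 := by
  have hc := (hF.fullyNormalized Q hQ).1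
  -- A maps the domain of D onto Q compatibly with the normalizer. K extends A, and L extends A ∘
  -- D⁻¹ on the range of D; through K and L the graph D becomes the diagonal of Q.
  obtain ⟨A, hA, hAd, hAc, hN⟩ := hF.exists_isoGraph hS hQ h
  obtain ⟨K, hK, hAK, hKd⟩ := hF.exists_extension hA (hAc ▸ hc)
  have hB := hD.relInv.relComp hA
  have hBc : (relComp D.relInv A).cod = Q := by
    rw [cod_relComp (by rw [cod_relInv, hAd]), hAc]
  obtain ⟨L, hL, hBL, hLd⟩ := hF.exists_extension hB (hBc ▸ hc)
  have hNK : (normalizer (D : Set (S × S))).dom ≤ K.dom := by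
    rw [hKd]
    exact (dom_normalizer_le D).trans hN
  refine ⟨K, L, hK, hL, hNK, fun y hy => ?_, ?_⟩
  · obtain ⟨x, hxy⟩ := mem_cod.1 hy
    obtain ⟨t, ht⟩ := mem_dom.1 (hN (dom_normalizer_le D (mem_dom.2 ⟨y, hxy⟩)))
    rw [hLd]
    exact mem_dom.2 ⟨t, mem_normalizer_relComp (mem_normalizer_relInv hxy) ht⟩
  · ext ⟨s, t⟩
    simp only [mem_relComp, mem_relInv, mem_conjGraph]
    constructor
    · rintro ⟨x, hxs, y, hxy, hyt⟩
      obtain ⟨a, ha⟩ := mem_dom.1 (hAd.ge (mem_dom.2 ⟨y, hxy⟩))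
      rw [hK.right_unique hxs (hAK ha), hL.right_unique hyt (hBL ⟨x, hxy, ha⟩)]
      exact ⟨hAc.le (mem_cod.2 ⟨x, ha⟩), by simp⟩
    · rintro ⟨hs, rfl⟩
      obtain ⟨x, hx⟩ := mem_cod.1 (hAc.ge hs)
      obtain ⟨y, hy⟩ := mem_dom.1 (hAd.le (mem_dom.2 ⟨s, hx⟩))
      exact ⟨x, hAK hx, y, hy, hBL ⟨x, hy, by simpa using hx⟩⟩

/-- The homomorphism given by a graph on a subgroup of its domain. -/
theorem IsGraph.exists_monoidHom {K : Subgroup (S × S)} (hK : F.IsGraph K) {H : Type u} [Group H]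
    (f : H →* S) (hf : ∀ h, f h ∈ K.dom) : ∃ χ : H →* S, ∀ h, (f h, χ h) ∈ K := by
  obtain ⟨φ, -, H⟩ := hK.exists_hom rfl (le_top (a := K.cod))
  exact ⟨(⊤ : Subgroup S).subtype.comp (φ.comp (f.codRestrict K.dom hf)),
    fun h => (H _).2 ⟨⟨f h, hf h⟩, rfl⟩⟩

/-- If the marks of an `S × S`-set with isotropy groups in `F` are `F`-stable on the graphs of
order greater than the order of `D`, then the mark of `D` is determined up to a multiple of
`|N(D) / D|`. -/
theorem IsSaturated.card_normalizer_dvd [Finite S] [Fact p.Prime] (hS : IsPGroup p S)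
    (hF : F.IsSaturated p) (Ω : FinGSet (S × S))
    (hΩ : ∀ E, FinGSet.numFixed E Ω ≠ 0 → F.IsGraph E) {D : Subgroup (S × S)} (hD : F.IsGraph D)
    (hst : ∀ E E', F.IsGraph E → F.IsGraph E' → F.Conj E.dom E'.dom → Nat.card D < Nat.card E →
      FinGSet.numFixed E Ω = FinGSet.numFixed E' Ω)
    {Q : Subgroup S} (hQ : F.FullyNormalized Q) (h : F.Conj D.dom Q) :
    (Nat.card (normalizer (D : Set (S × S))) : ℤ) ∣
      Nat.card D * (FinGSet.numFixed D Ω - FinGSet.numFixed (Q.conjGraph 1) Ω) := by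
  obtain ⟨K, L, hK, hL, hKd, hLd, hKL⟩ := hF.exists_transport hS hD hQ h
  let N := normalizer (D : Set (S × S))
  obtain ⟨κ, hκ⟩ := hK.exists_monoidHom ((MonoidHom.fst S S).comp N.subtype)
    fun z => hKd (mem_dom.2 ⟨_, z.2⟩)
  obtain ⟨l, hl⟩ := hL.exists_monoidHom ((MonoidHom.snd S S).comp N.subtype)
    fun z => hLd (mem_cod.2 ⟨_, z.2⟩)
  have hmap : ∀ H : Subgroup N, H.map (κ.prod l) =
      relComp K.relInv (relComp (H.map N.subtype) L) := by
    intro H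
    ext ⟨s, t⟩
    simp only [mem_relComp, mem_relInv]
    constructor
    · rintro ⟨z, hz, hst⟩
      obtain ⟨rfl, rfl⟩ := Prod.ext_iff.1 hst
      exact ⟨z.1.1, hκ z, z.1.2, ⟨z, hz, rfl⟩, hl z⟩
    · rintro ⟨x, hxs, y, ⟨z, hz, hxy⟩, hyt⟩
      obtain ⟨rfl, rfl⟩ := Prod.ext_iff.1 hxy
      exact ⟨z, hz, Prod.ext (hK.right_unique (hκ z) hxs) (hL.right_unique (hl z) hyt)⟩
  have hDN : D ≤ N := Subgroup.le_normalizer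
  have hDmap : (D.subgroupOf N).map N.subtype = D := Subgroup.map_subgroupOf_eq_of_le hDN
  -- Ω is restricted to N along the inclusion and along (κ, l). The two restrictions have the same
  -- marks at all subgroups of N strictly above D, so the congruence for a normal subgroup applies
  -- to their difference at D.
  have key := Burnside.card_dvd_card_mul_mark_of_normal (D.subgroupOf N)
    (Burnside.res N.subtype (Burnside.cls Ω) - Burnside.res (κ.prod l) (Burnside.cls Ω)) ?_
  · rw [map_sub, Burnside.mark_res, Burnside.mark_res, hmap, hDmap, hKL, Burnside.mark_cls,
      Burnside.mark_cls, Nat.card_congr (Subgroup.subgroupOfEquivOfLe hDN).toEquiv] at key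
    exact key
  · intro H hH
    rw [map_sub, Burnside.mark_res, Burnside.mark_res, Burnside.mark_cls, Burnside.mark_cls,
      sub_eq_zero, Nat.cast_inj]
    have hlt : D < H.map N.subtype := by
      have := (Subgroup.map_lt_map_iff_of_injective N.subtype_injective).2 hH
      rwa [hDmap] at this
    have hHK : (H.map N.subtype).dom ≤ K.dom := by
      refine le_trans (dom_mono ?_) hKd
      exact Subgroup.map_subtype_le H
    have hHL : (H.map N.subtype).cod ≤ L.dom := by
      refine le_trans (cod_mono ?_) hLd
      exact Subgroup.map_subtype_le H
    by_cases hg : F.IsGraph (H.map N.subtype)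
    · have hg' : F.IsGraph (H.map (κ.prod l)) := by
        rw [hmap]
        exact hK.relInv.relComp (hg.relComp hL)
      refine hst _ _ hg hg' ?_ (Set.Finite.card_lt_card (Set.toFinite _) hlt)
      have hK' : F.IsGraph (K ⊓ (H.map N.subtype).dom.comap (MonoidHom.fst S S)) :=
        hK.mono inf_le_left
      refine conj_iff_exists_graph.2 ⟨_, hK', ?_, ?_⟩
      · refine le_antisymm ?_ fun x hx => ?_
        · rintro _ ⟨z, hz, rfl⟩
          exact hz.2
        · obtain ⟨y, hy⟩ := mem_dom.1 (hHK hx)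
          exact mem_dom.2 ⟨y, hy, hx⟩
      · rw [hmap]
        ext t
        rw [mem_cod, mem_dom]
        constructor
        · rintro ⟨x, hxt, hx⟩
          obtain ⟨y, hy⟩ := mem_dom.1 hx
          obtain ⟨w, hw⟩ := mem_dom.1 (hHL (mem_cod.2 ⟨_, hy⟩))
          exact ⟨w, x, hxt, y, hy, hw⟩
        · rintro ⟨w, x, hxt, y, hy, hw⟩
          exact ⟨x, hxt, mem_dom.2 ⟨y, hy⟩⟩
    -- If the transported subgroup were a graph, transporting it back would make H one as well. So
    -- both are non-graphs, and both marks are zero.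
    · have hg' : ¬ F.IsGraph (H.map (κ.prod l)) := by
        rw [hmap]
        intro hg'
        refine hg ((hK.relComp (hg'.relComp hL.relInv)).mono ?_)
        rintro ⟨x, y⟩ hxy
        obtain ⟨s, hs⟩ := mem_dom.1 (hHK (mem_dom.2 ⟨_, hxy⟩))
        obtain ⟨t, ht⟩ := mem_dom.1 (hHL (mem_cod.2 ⟨_, hxy⟩))
        exact ⟨s, hs, t, ⟨x, hs, y, hxy, ht⟩, ht⟩
      rw [not_not.1 (mt (hΩ _) hg), not_not.1 (mt (hΩ _) hg')]

end FusionSystem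

/-! ### Existence of characteristic bisets -/

namespace FinGSet

variable {G : Type u} [Group G]

theorem numFixed_coset_self [Finite G] (D : Subgroup G) :
    numFixed D (coset D) * Nat.card D = Nat.card (Subgroup.normalizer (D : Set G)) := by
  rw [numFixed_coset_mul_card]
  refine Nat.card_congr (Equiv.subtypeEquiv (Equiv.inv G) fun g => ?_)
  constructor
  · exact fun h => Subgroup.mem_normalizer_fintype fun n hn => by simpa using h n hn
  · intro h q hq
    simpa using (Subgroup.mem_normalizer_iff.1 h q).1 hq

theorem numFixed_map_conj (g : G) (Q : Subgroup G) (X : FinGSet G) :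
    numFixed (Q.map (MulAut.conj g).toMonoidHom) X = numFixed Q X := by
  have := Burnside.mark_conj g Q (Burnside.cls X)
  rw [Burnside.mark_cls, Burnside.mark_cls] at this
  exact_mod_cast this

theorem exists_map_conj_le [Finite G] {E D : Subgroup G} (h : numFixed E (coset D) ≠ 0) :
    ∃ g : G, E.map (MulAut.conj g).toMonoidHom ≤ D := by
  obtain ⟨g, hg⟩ := Burnside.mark_coset_ne_zero (Q := E) (P := D)
    (by rw [Burnside.mark_cls]; exact_mod_cast h)
  refine ⟨g⁻¹, ?_⟩
  rintro _ ⟨q, hq, rfl⟩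
  simpa using hg q hq

theorem card_map_conj (g : G) (Q : Subgroup G) :
    Nat.card (Q.map (MulAut.conj g).toMonoidHom) = Nat.card Q :=
  Subgroup.card_map_of_injective (MulAut.conj g).injective

end FinGSet

namespace FusionSystem

open Subgroup

variable {S : Type u} [Group S] {F : FusionSystem S} {p : ℕ}

/-- Conjugacy of subgroups. -/
def subgroupConjSetoid (G : Type u) [Group G] : Setoid (Subgroup G) where
  r D E := ∃ g : G, D.map (MulAut.conj g).toMonoidHom = E
  iseqv :=
    { refl := fun D => ⟨1, by ext; simp⟩
      symm := by
        rintro D _ ⟨g, rfl⟩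
        refine ⟨g⁻¹, ?_⟩
        rw [Subgroup.map_map]
        convert Subgroup.map_id D
        ext x
        simp [mul_assoc]
      trans := by
        rintro D _ _ ⟨g, rfl⟩ ⟨k, rfl⟩
        refine ⟨k * g, ?_⟩
        rw [Subgroup.map_map, map_mul]
        rfl }

/-- One can prescribe the marks of a sum of orbits on the graphs of order `n`, without changing the
marks on graphs of greater order. -/
theorem exists_adjust_marks [Finite S] (n : ℕ) (Ω : FinGSet (S × S))
    (hΩ : ∀ E, FinGSet.numFixed E Ω ≠ 0 → F.IsGraph E) (M : Subgroup (S × S) → ℕ)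
    (hM : ∀ D (g : S × S), F.IsGraph D → M (D.map (MulAut.conj g).toMonoidHom) = M D)
    (hle : ∀ D, F.IsGraph D → Nat.card D = n → FinGSet.numFixed D Ω ≤ M D)
    (hdvd : ∀ D, F.IsGraph D → Nat.card D = n →
      Nat.card (normalizer (D : Set (S × S))) ∣ Nat.card D * (M D - FinGSet.numFixed D Ω)) :
    ∃ Ω' : FinGSet (S × S), (∀ E, FinGSet.numFixed E Ω' ≠ 0 → F.IsGraph E) ∧
      (∀ D, F.IsGraph D → Nat.card D = n → FinGSet.numFixed D Ω' = M D) ∧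
      ∀ D : Subgroup (S × S), n < Nat.card D →
        FinGSet.numFixed D Ω' = FinGSet.numFixed D Ω := by
  classical
  let J := Quotient (subgroupConjSetoid (S × S))
  have : Finite J := Quotient.finite _
  have := Fintype.ofFinite J
  let good : J → Prop := fun j => F.IsGraph j.out ∧ Nat.card j.out = n
  -- The orbit of a graph D of order n has mark |N(D)/D| at D, so raising the mark to M(D) takes
  -- (M(D) − |Ω^D|) / |N(D)/D| copies of it.
  let c : J → ℕ := fun j => if good j then
    Nat.card j.out * (M j.out - FinGSet.numFixed j.out Ω) /
      Nat.card (normalizer (j.out : Set (S × S))) else 0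
  obtain ⟨Ω', hΩ'⟩ := Quotient.exists_rep (FinGSet.Classes.mk Ω +
    ∑ j : J, c j • FinGSet.Classes.mk (FinGSet.coset j.out))
  have hval : ∀ E, FinGSet.numFixed E Ω' = FinGSet.numFixed E Ω +
      ∑ j : J, c j * FinGSet.numFixed E (FinGSet.coset j.out) := fun E => by
    have := congrArg (FinGSet.Classes.numFixed E) hΩ'
    simp only [map_add, map_sum, map_nsmul, smul_eq_mul] at this
    exact this
  have hterm : ∀ E (j : J), c j * FinGSet.numFixed E (FinGSet.coset j.out) ≠ 0 →
      good j ∧ ∃ g : S × S, E.map (MulAut.conj g).toMonoidHom ≤ j.out := by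
    intro E j hj
    obtain ⟨h₁, h₂⟩ := mul_ne_zero_iff.1 hj
    refine ⟨?_, FinGSet.exists_map_conj_le h₂⟩
    by_contra h
    exact h₁ (if_neg h)
  refine ⟨Ω', fun E hE => ?_, fun D hD hn => ?_, fun D hn => ?_⟩
  · by_cases h0 : FinGSet.numFixed E Ω = 0
    · rw [hval, h0, zero_add] at hE
      obtain ⟨j, -, hj⟩ := Finset.exists_ne_zero_of_sum_ne_zero hE
      obtain ⟨hgood, g, hg⟩ := hterm E j hj
      have := (hgood.1.mono hg).conj g⁻¹
      rw [Subgroup.map_map] at this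
      convert this
      symm
      convert Subgroup.map_id E
      ext x <;> simp [mul_assoc]
    · exact hΩ E h0
  · obtain ⟨g, hg⟩ : ∃ g : S × S, D.map (MulAut.conj g).toMonoidHom =
        (Quotient.mk (subgroupConjSetoid (S × S)) D).out :=
      Quotient.exact (s := subgroupConjSetoid (S × S))
        (Quotient.out_eq (Quotient.mk (subgroupConjSetoid (S × S)) D)).symm
    set j₀ : J := Quotient.mk (subgroupConjSetoid (S × S)) D with hj₀
    have hgood : good j₀ := by
      refine ⟨hg ▸ hD.conj g, ?_⟩
      rw [← hg, FinGSet.card_map_conj, hn]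
    -- A subgroup of order n that is conjugate into another one of order n is conjugate to it, so
    -- orbits of different classes do not interfere.
    have hsum : ∑ j : J, c j * FinGSet.numFixed D (FinGSet.coset j.out) =
        c j₀ * FinGSet.numFixed D (FinGSet.coset j₀.out) := by
      refine Finset.sum_eq_single j₀ (fun j _ hj => ?_) fun h => (h (Finset.mem_univ _)).elim
      by_contra hne
      obtain ⟨hgood', k, hk⟩ := hterm D j hne
      have hk' := Subgroup.eq_of_le_of_card_ge hk (by rw [FinGSet.card_map_conj, hn, hgood'.2])
      refine hj ?_
      rw [hj₀, ← Quotient.out_eq j]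
      exact (Quotient.sound (s := subgroupConjSetoid (S × S)) ⟨k, hk'⟩).symm
    have hinv : ∀ X : FinGSet (S × S), FinGSet.numFixed j₀.out X = FinGSet.numFixed D X :=
      fun X => by rw [← hg, FinGSet.numFixed_map_conj]
    have hMj : M j₀.out = M D := by rw [← hg, hM D g hD]
    have hc : c j₀ * Nat.card (normalizer (j₀.out : Set (S × S))) =
        Nat.card j₀.out * (M D - FinGSet.numFixed D Ω) := by
      have h := Nat.div_mul_cancel (hdvd _ hgood.1 hgood.2)
      rw [hMj, hinv] at h
      rw [← h, ← hinv Ω, ← hMj]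
      congr 1
      exact if_pos hgood
    rw [hval, hsum, ← hinv (FinGSet.coset j₀.out)]
    rw [← FinGSet.numFixed_coset_self, ← mul_assoc, mul_comm (Nat.card j₀.out)] at hc
    have hc' := Nat.eq_of_mul_eq_mul_right Nat.card_pos hc
    rw [hc', Nat.add_sub_cancel' (hle D hD hn)]
  · rw [hval, Finset.sum_eq_zero, add_zero]
    intro j _
    by_contra hne
    obtain ⟨hgood, g, hg⟩ := hterm D j hne
    have := Subgroup.card_le_of_le hg
    rw [FinGSet.card_map_conj, hgood.2] at this
    exact absurd this (not_le.2 hn)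

/-- The representative is constant on F-classes, so that a target mark defined from it is F-stable
by construction. -/
theorem exists_fullyNormalized_rep [Finite S] (F : FusionSystem S) :
    ∃ r : Subgroup S → Subgroup S, (∀ P, F.FullyNormalized (r P)) ∧ (∀ P, F.Conj P (r P)) ∧
      ∀ P Q, F.Conj P Q → r P = r Q := by
  let s : Setoid (Subgroup S) := ⟨F.Conj, Conj.refl, Conj.symm, Conj.trans⟩
  choose f hf hf' using exists_fullyNormalized (F := F)
  refine ⟨fun P => f (Quotient.mk s P).out, fun P => hf' _, fun P => ?_, fun P Q h => ?_⟩
  · exact Conj.trans (Conj.symm (Quotient.exact (Quotient.out_eq (Quotient.mk s P)))) (hf _)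
  · have : Quotient.mk s P = Quotient.mk s Q := Quotient.sound h
    exact congrArg (fun q => f q.out) this

theorem conj_dom_map_conj {D : Subgroup (S × S)} (g : S × S) :
    F.Conj (D.map (MulAut.conj g).toMonoidHom).dom D.dom := by
  refine Conj.symm ?_
  have h := conj_map_conj (F := F) D.dom g.1
  convert h using 1
  rw [dom, dom, Subgroup.map_map, Subgroup.map_map]
  rfl

/-- Any (x, y) in the normalizer differs from the element of D over x by some (1, z), and (1, z)
normalizes the graph of an automorphism of S exactly when z is central. -/
theorem card_normalizer_of_dom_eq_top [Finite S] {D : Subgroup (S × S)} (hD : F.IsGraph D)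
    (hd : D.dom = ⊤) (hc : D.cod = ⊤) : Nat.card (normalizer (D : Set (S × S))) =
      Nat.card D * Nat.card (Subgroup.center S) := by
  rw [← Nat.card_prod]
  symm
  have hz : ∀ z ∈ Subgroup.center S, ((1, z) : S × S) ∈ normalizer (D : Set (S × S)) :=
    fun z hz => mem_normalizer_of_forall fun a b hab => by
      rw [← Subgroup.mem_center_iff.1 hz b]
      simpa using hab
  refine Nat.card_congr (Equiv.ofBijective (fun w : D × Subgroup.center S =>
    (⟨w.1.1 * (1, w.2.1), mul_mem (Subgroup.le_normalizer w.1.2) (hz _ w.2.2)⟩ :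
      normalizer (D : Set (S × S)))) ⟨?_, ?_⟩)
  · rintro ⟨⟨⟨a, b⟩, hab⟩, ⟨z, hz⟩⟩ ⟨⟨⟨a', b'⟩, hab'⟩, ⟨z', hz'⟩⟩ h
    have h' := congrArg Subtype.val h
    simp only [Prod.mk_mul_mk, mul_one, Prod.mk.injEq] at h'
    obtain ⟨rfl, h'⟩ := h'
    obtain rfl := hD.right_unique hab hab'
    obtain rfl := mul_left_cancel h'
    rfl
  · rintro ⟨⟨x, y⟩, hxy⟩
    obtain ⟨t, ht⟩ := mem_dom.1 (hd.ge (Subgroup.mem_top x))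
    have hN : ((1, t⁻¹ * y) : S × S) ∈ normalizer (D : Set (S × S)) := by
      have := mul_mem (inv_mem (Subgroup.le_normalizer ht)) hxy
      simpa using this
    refine ⟨⟨⟨_, ht⟩, ⟨t⁻¹ * y, Subgroup.mem_center_iff.2 fun b => ?_⟩⟩, Subtype.ext ?_⟩
    · obtain ⟨a, ha⟩ := mem_cod.1 (hc.ge (Subgroup.mem_top b))
      have := conj_mem_of_mem_normalizer hN ha
      rw [one_mul, inv_one, mul_one] at this
      have := hD.right_unique ha this
      rw [eq_mul_inv_iff_mul_eq] at this
      exact this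
    · simp

theorem IsGraph.dom_eq_top [Finite S] {D : Subgroup (S × S)} (hD : F.IsGraph D)
    (h : Nat.card D = Nat.card S) : D.dom = ⊤ ∧ D.cod = ⊤ :=
  ⟨Subgroup.eq_top_of_card_eq _ (hD.card_dom.trans h),
    Subgroup.eq_top_of_card_eq _ (hD.card_cod.trans h)⟩

/-- Stability is reached downwards in the order of the graphs: stage k settles all graphs of order
at least |S| − k. The last clause fixes the marks at the top, from which |Ω/S| modulo p is computed.
-/
theorem IsSaturated.exists_stable [Finite S] [Fact p.Prime] (hS : IsPGroup p S)
    (hF : F.IsSaturated p) (k : ℕ) : ∃ Ω : FinGSet (S × S),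
      (∀ E, FinGSet.numFixed E Ω ≠ 0 → F.IsGraph E) ∧
      (∀ D E, F.IsGraph D → F.IsGraph E → F.Conj D.dom E.dom → Nat.card S ≤ k + Nat.card D →
        FinGSet.numFixed D Ω = FinGSet.numFixed E Ω) ∧
      ∀ D, F.IsGraph D → Nat.card D = Nat.card S →
        FinGSet.numFixed D Ω = Nat.card (Subgroup.center S) := by
  have hcardle : ∀ D, F.IsGraph D → Nat.card D ≤ Nat.card S := fun D hD => by
    rw [← hD.card_dom]
    exact Subgroup.card_le_card_group _
  have hcard : ∀ {D E}, F.IsGraph D → F.IsGraph E → F.Conj D.dom E.dom →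
      Nat.card D = Nat.card E := fun hD hE h => by
    rw [← hD.card_dom, ← hE.card_dom, h.card_eq]
  induction k with
  | zero =>
    have h0 : ∀ E, FinGSet.numFixed E (FinGSet.empty (S × S)) = 0 :=
      fun E => (FinGSet.Classes.numFixed E).map_zero
    -- Starting from the empty set, the value |Z(S)| = |N(D)/D| means one orbit for each conjugacy
    -- class of graphs of automorphisms of S.
    obtain ⟨Ω, h₁, h₂, h₃⟩ := exists_adjust_marks (F := F) (Nat.card S) (FinGSet.empty (S × S))
      (fun E hE => (hE (h0 E)).elim) (fun _ => Nat.card (Subgroup.center S)) (fun _ _ _ => rfl)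
      (fun D _ _ => by rw [h0]; exact Nat.zero_le _) fun D hD hn => by
        obtain ⟨hd, hc⟩ := hD.dom_eq_top hn
        rw [card_normalizer_of_dom_eq_top hD hd hc, h0, Nat.sub_zero]
    refine ⟨Ω, h₁, fun D E hD hE h hn => ?_, h₂⟩
    rw [zero_add] at hn
    have hDn := le_antisymm (hcardle D hD) hn
    rw [h₂ D hD hDn, h₂ E hE ((hcard hD hE h).symm.trans hDn)]
  | succ k ih =>
    obtain ⟨Ω, h₁, h₂, h₃⟩ := ih
    obtain ⟨r, hr, hrc, hre⟩ := F.exists_fullyNormalized_rep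
    -- Otherwise k ≥ |S|, all orders are already settled, and the truncated subtraction defining `n`
    -- is avoided.
    by_cases hk : k + 1 ≤ Nat.card S
    swap
    · exact ⟨Ω, h₁, fun D E hD hE h _ => h₂ D E hD hE h (by omega), h₃⟩
    set n := Nat.card S - (k + 1) with hn
    -- The mark at a fully normalized diagonal, raised by a constant. The constant exceeds every
    -- existing mark, so that only additions are needed, and it is a multiple of |S × S|, hence of
    -- |N(D)|, so that the congruence is kept.
    let M : Subgroup (S × S) → ℕ := fun D => FinGSet.numFixed ((r D.dom).conjGraph 1) Ω +
      Nat.card Ω * Nat.card (S × S)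
    have hMconj : ∀ D E : Subgroup (S × S), F.Conj D.dom E.dom → M D = M E := fun D E h => by
      simp only [M, hre _ _ h]
    have hle : ∀ D, FinGSet.numFixed D Ω ≤ M D := fun D => by
      refine le_trans (Finite.card_subtype_le _) (le_trans ?_ (Nat.le_add_left _ _))
      exact Nat.le_mul_of_pos_right _ Nat.card_pos
    obtain ⟨Ω', h₁', h₂', h₃'⟩ := exists_adjust_marks (F := F) n Ω h₁ M
      (fun D g _ => hMconj _ _ (conj_dom_map_conj g)) (fun D _ _ => hle D) fun D hD hDn => by
        have h := hF.card_normalizer_dvd hS Ω h₁ hD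
          (fun E E' hE hE' hEE' hlt => h₂ E E' hE hE' hEE' (by omega)) (hr _) (hrc D.dom)
        have h' : (Nat.card (normalizer (D : Set (S × S))) : ℤ) ∣
            Nat.card D * (Nat.card Ω * Nat.card (S × S) : ℕ) := by
          refine dvd_mul_of_dvd_right ?_ _
          exact_mod_cast dvd_mul_of_dvd_right (Subgroup.card_subgroup_dvd_card _) _
        have h'' := dvd_sub h' h
        rw [← Int.natCast_dvd_natCast, Nat.cast_mul, Nat.cast_sub (hle D)]
        have e : (Nat.card D : ℤ) * ((M D : ℤ) - FinGSet.numFixed D Ω) =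
            Nat.card D * (Nat.card Ω * Nat.card (S × S) : ℕ) - Nat.card D *
              (FinGSet.numFixed D Ω - FinGSet.numFixed ((r D.dom).conjGraph 1) Ω) := by
          simp only [M]
          push_cast
          ring
        rw [e]
        exact h''
    refine ⟨Ω', h₁', fun D E hD hE h hle => ?_, fun D hD hDS => ?_⟩
    · have hDE := hcard hD hE h
      rcases Nat.lt_or_ge n (Nat.card D) with hlt | hge
      · rw [h₃' D hlt, h₃' E (hDE ▸ hlt)]
        exact h₂ D E hD hE h (by omega)
      · have hDn : Nat.card D = n := by omega
        rw [h₂' D hD hDn, h₂' E hE (hDE ▸ hDn), hMconj D E h]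
    · rw [h₃' D (by omega), h₃ D hD hDS]

theorem fullyNormalized_top [Finite S] : F.FullyNormalized ⊤ := fun Q _ => by
  rw [Subgroup.normalizer_eq_top (⊤ : Subgroup S),
    Nat.card_congr (Subgroup.topEquiv (G := S)).toEquiv]
  exact Subgroup.card_le_card_group _

theorem card_autS_top [Finite S] :
    Nat.card (autS (⊤ : Subgroup S)) * Nat.card (Subgroup.center S) = Nat.card S := by
  let c : S →* MulAut (⊤ : Subgroup S) :=
    (MulAut.congr (Subgroup.topEquiv (G := S)).symm).toMonoidHom.comp MulAut.conj
  have hc : ∀ (s : S) (x : (⊤ : Subgroup S)), (c s x : S) = s * x * s⁻¹ := fun _ _ => rfl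
  have hrange : c.range = autS ⊤ := by
    ext α
    constructor
    · rintro ⟨s, rfl⟩
      exact ⟨s, hc s⟩
    · rintro ⟨s, hs⟩
      exact ⟨s, MulEquiv.ext fun x => Subtype.ext (hs x).symm⟩
  have hker : c.ker = Subgroup.center S := by
    ext s
    rw [MonoidHom.mem_ker, Subgroup.mem_center_iff]
    constructor
    · intro h x
      have := hc s ⟨x, trivial⟩
      rw [h] at this
      change x = s * x * s⁻¹ at this
      rwa [eq_mul_inv_iff_mul_eq] at this
    · intro h
      refine MulEquiv.ext fun x => Subtype.ext ?_
      rw [hc, ← h x]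
      simp
  rw [← hrange, ← hker, ← Nat.card_congr (QuotientGroup.quotientKerEquivRange c).toEquiv,
    ← Subgroup.card_eq_card_quotient_mul_card_subgroup]

theorem card_graphs_top [Finite S] :
    Nat.card (F.graphs ⊤ ⊤) = Nat.card (F.aut ⊤) := by
  symm
  refine Nat.card_congr (Equiv.ofBijective (fun α : F.aut ⊤ => (⟨homGraph α.1.toMonoidHom,
    isGraph_homGraph α.2, dom_homGraph _, cod_homGraph_le _⟩ : F.graphs ⊤ ⊤)) ⟨?_, ?_⟩)
  · intro α β h
    have h' : homGraph α.1.toMonoidHom = homGraph β.1.toMonoidHom := congrArg Subtype.val h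
    refine Subtype.ext (MulEquiv.ext fun x => Subtype.ext ?_)
    refine (isGraph_homGraph (F := F) β.2).right_unique (x := x) ?_ ⟨x, rfl⟩
    rw [← h']
    exact ⟨x, rfl⟩
  · rintro ⟨D, hD, hd, hc⟩
    obtain ⟨φ, hφ, H⟩ := hD.exists_hom hd hc
    have hb : Function.Bijective φ := Finite.injective_iff_bijective.1 (F.injective hφ)
    refine ⟨⟨MulEquiv.ofBijective φ hb, hφ⟩, Subtype.ext ?_⟩
    ext z
    rw [H, mem_homGraph]
    rfl

/-- Every saturated fusion system has a characteristic biset. -/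
theorem IsSaturated.exists_isCharacteristic [Finite S] [Fact p.Prime] (hS : IsPGroup p S)
    (hF : F.IsSaturated p) : ∃ Ω, F.IsCharacteristic p Ω := by
  obtain ⟨Ω, h₁, h₂, h₃⟩ := hF.exists_stable hS (Nat.card S)
  have hstab : ∀ ω : Ω, F.IsGraph (MulAction.stabilizer (S × S) ω) := fun ω =>
    h₁ _ (FinGSet.numFixed_pos_iff.2 ⟨ω, le_rfl⟩).ne'
  refine ⟨Ω, hstab, fun hD hE h => h₂ _ _ hD hE h (Nat.le_add_right _ _), fun hdvd => ?_⟩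
  have := Fintype.ofFinite (F.graphs ⊤ ⊤)
  -- This gives |(Ω/S)^S| |S| = |Aut_F(S)| |Z(S)|. As |S| = |Aut_S(S)| |Z(S)|, the number |(Ω/S)^S|
  -- is the index of Aut_S(S) in Aut_F(S), prime to p by saturation, and it is congruent to |Ω/S|
  -- modulo p.
  have hsum := numFixed_rightQuot_eq_sum hstab ⊤ ⊤
  rw [Finset.sum_congr rfl fun D _ => h₃ D.1 D.2.1 (by
    rw [← D.2.1.card_dom, D.2.2.1, Nat.card_congr (Subgroup.topEquiv (G := S)).toEquiv]),
    Finset.sum_const, smul_eq_mul, Finset.card_univ, ← Nat.card_eq_fintype_card, card_graphs_top,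
    Nat.card_congr (Subgroup.topEquiv (G := S)).toEquiv] at hsum
  obtain ⟨T, hT⟩ := (hF.fullyNormalized ⊤ fullyNormalized_top).2
  have hle : autS (⊤ : Subgroup S) ≤ F.aut ⊤ := fun α ⟨s, hs⟩ => F.conj_mem s _ hs
  have hcard := Subgroup.index_mul_card (T : Subgroup (F.aut ⊤))
  rw [hT, Nat.card_congr (Subgroup.subgroupOfEquivOfLe hle).toEquiv, ← hT] at hcard
  rw [← hcard, mul_assoc, card_autS_top] at hsum
  have hfix := Nat.eq_of_mul_eq_mul_right Nat.card_pos hsum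
  refine T.not_dvd_index ?_
  rw [← hfix]
  have hmod := (hS.to_subgroup ⊤).card_modEq_card_fixedPoints (Ω.rightQuot ⊤)
  have e : Nat.card (MulAction.fixedPoints (⊤ : Subgroup S) (Ω.rightQuot ⊤)) =
      FinGSet.numFixed ⊤ (Ω.rightQuot ⊤) :=
    Nat.card_congr (Equiv.subtypeEquivRight fun x => ⟨fun h g hg => h ⟨g, hg⟩, fun h g => h g g.2⟩)
  rw [e] at hmod
  exact (Nat.ModEq.dvd_iff hmod dvd_rfl).1 hdvd

end FusionSystem

/-! ### Extensions of graphs with centric domain -/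

namespace Subgroup

theorem map_conj_map_conj {G : Type*} [Group G] (D : Subgroup G) (g h : G) :
    (D.map (MulAut.conj g).toMonoidHom).map (MulAut.conj h).toMonoidHom =
      D.map (MulAut.conj (h * g)).toMonoidHom := by
  rw [Subgroup.map_map, map_mul]
  rfl

theorem map_conj_one {G : Type*} [Group G] (D : Subgroup G) :
    D.map (MulAut.conj (1 : G)).toMonoidHom = D := by
  ext
  simp

theorem map_conj_eq_self {G : Type*} [Group G] {D : Subgroup G} {g : G}
    (h : g ∈ centralizer (D : Set G)) : D.map (MulAut.conj g).toMonoidHom = D := by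
  have key : ∀ x ∈ D, (MulAut.conj g).toMonoidHom x = x := fun x hx => by
    change g * x * g⁻¹ = x
    rw [← Subgroup.mem_centralizer_iff.1 h x hx, mul_inv_cancel_right]
  ext x
  constructor
  · rintro ⟨y, hy, rfl⟩
    rwa [key y hy]
  · exact fun hx => ⟨x, hx, key x hx⟩

/-- Normalizers grow in the p-group E. -/
theorem lt_inf_normalizer {G : Type*} [Group G] [Finite G] {p : ℕ} [Fact p.Prime]
    (hG : IsPGroup p G) {D E : Subgroup G} (h : D < E) : D < E ⊓ normalizer (D : Set G) := by
  have : Group.IsNilpotent E := (hG.to_subgroup E).isNilpotent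
  have hlt : D.subgroupOf E < ⊤ := by
    rw [lt_top_iff_ne_top, ne_eq, Subgroup.subgroupOf_eq_top]
    exact not_le_of_gt h
  obtain ⟨x, hx, hx'⟩ := SetLike.exists_of_lt
    (Group.normalizerCondition_of_isNilpotent (D.subgroupOf E) hlt)
  refine SetLike.lt_iff_le_and_exists.2 ⟨le_inf h.le le_normalizer, (x : G),
    Subgroup.mem_inf.2 ⟨x.2, ?_⟩, hx'⟩
  refine Subgroup.mem_normalizer_fintype fun d hd => ?_
  exact (Subgroup.mem_normalizer_iff.1 hx ⟨d, h.le hd⟩).1 hd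

end Subgroup

namespace FusionSystem

open Subgroup

variable {S : Type u} [Group S] {F : FusionSystem S} {p : ℕ}

theorem IsCentric.of_conj {P Q : Subgroup S} (hP : F.IsCentric P) (h : F.Conj P Q) :
    F.IsCentric Q := fun R hR => hP R (h.trans hR)

theorem IsCentric.centralizer_le {P : Subgroup S} (hP : F.IsCentric P) :
    centralizer (P : Set S) ≤ P := hP P (Conj.refl P)

/-- If an isomorphism takes Q to R and P to P', then C_S(R) ≤ C_S(P') ≤ P' ≤ R. -/
theorem IsCentric.mono {P Q : Subgroup S} (hP : F.IsCentric P) (h : P ≤ Q) : F.IsCentric Q := by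
  intro R hR
  obtain ⟨D, hD, rfl, rfl⟩ := conj_iff_exists_graph.1 hR
  have hle : (P.conjGraph 1).cod ≤ D.dom := by rwa [cod_conjGraph_one]
  have hc := ((isGraph_conjGraph P 1).relComp hD).conj_dom_cod
  rw [dom_relComp hle, dom_conjGraph] at hc
  refine le_trans (Subgroup.centralizer_le ?_) ((hP _ hc).trans cod_relComp_le)
  exact cod_relComp_le

/-- The centralizer of a conjugate of P lies in that conjugate, so the inverse isomorphism is
defined on it and maps it into C_S(P). Hence the extension axiom applies to every morphism with
centric domain. -/
theorem IsCentric.fullyCentralized [Finite S] {P : Subgroup S} (hP : F.IsCentric P) :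
    F.FullyCentralized P := by
  intro Q hQ
  obtain ⟨D, hD, rfl, rfl⟩ := conj_iff_exists_graph.1 hQ
  have hc := hP _ hD.conj_dom_cod
  choose f hf using fun y : centralizer (D.cod : Set S) => mem_cod.1 (hc y.2)
  refine Nat.card_le_card_of_injective (fun y => (⟨f y, Subgroup.mem_centralizer_iff.2
    fun a ha => ?_⟩ : centralizer (D.dom : Set S))) fun y y' h => ?_
  · obtain ⟨b, hb⟩ := mem_dom.1 ha
    refine hD.left_unique (mul_mem hb (hf y)) ?_
    change (f y * a, b * y) ∈ D
    rw [Subgroup.mem_centralizer_iff.1 y.2 b (mem_cod.2 ⟨a, hb⟩)]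
    exact mul_mem (hf y) hb
  · have h' : f y = f y' := congrArg Subtype.val h
    exact Subtype.ext (hD.right_unique (hf y) (h' ▸ hf y'))

/-- An automorphism of `p`-power order in a saturated fusion system is conjugate to one that is
induced by an element of `S`. -/
theorem IsSaturated.exists_conj_autS [Finite S] [Fact p.Prime] (hF : F.IsSaturated p)
    {C : Subgroup S} {θ : MulAut C} (hθ : θ ∈ F.aut C) {n : ℕ} (hn : θ ^ p ^ n = 1) :
    ∃ (K : Subgroup (S × S)) (s : S), F.IsGraph K ∧ K.dom = C ∧
      ∀ (x : C) (t : S), ((x : S), t) ∈ K → ((θ x : S), s * t * s⁻¹) ∈ K := by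
  obtain ⟨Q, hCQ, hQ⟩ := exists_fullyNormalized (F := F) C
  obtain ⟨φ, hφ, hb⟩ := hCQ
  let e : C ≃* Q := MulEquiv.ofBijective φ hb
  obtain ⟨he, he'⟩ := F.equiv_mem e hφ fun _ => rfl
  let σ : F.aut Q := ⟨MulAut.congr e θ, F.comp_mem (F.comp_mem he' hθ) he⟩
  have hσ : σ ^ p ^ n = 1 := Subtype.ext (by
    change (MulAut.congr e θ) ^ p ^ n = 1
    rw [← map_pow, hn, map_one])
  have hp : IsPGroup p (Subgroup.zpowers σ) := by
    rintro ⟨_, k, rfl⟩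
    refine ⟨n, Subtype.ext ?_⟩
    change (σ ^ k) ^ p ^ n = 1
    rw [← zpow_natCast, zpow_comm, zpow_natCast, hσ, one_zpow]
  obtain ⟨T, hT⟩ := hp.exists_le_sylow
  obtain ⟨T₀, hT₀⟩ := (hF.fullyNormalized Q hQ).2
  obtain ⟨g, hg⟩ := MulAction.exists_smul_eq (F.aut Q) T T₀
  have hge : (g.1.toMonoidHom.comp e.toMonoidHom) ∈ F.hom C Q := F.comp_mem he g.2
  have hmem : g * σ * g⁻¹ ∈ (T₀ : Subgroup (F.aut Q)) := by
    rw [← hg]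
    exact ⟨σ, hT (Subgroup.mem_zpowers σ), rfl⟩
  rw [hT₀] at hmem
  obtain ⟨s, hs⟩ := hmem
  refine ⟨homGraph (g.1.toMonoidHom.comp e.toMonoidHom), s, isGraph_homGraph hge,
    dom_homGraph _, ?_⟩
  rintro x t ⟨y, hy⟩
  obtain ⟨h₁, rfl⟩ := Prod.ext_iff.1 hy
  obtain rfl : y = x := Subtype.ext h₁
  refine ⟨θ y, Prod.ext rfl ?_⟩
  refine Eq.trans ?_ (hs (g.1 (e y)))
  change ((g.1 (e (θ y)) : Q) : S) = ((g.1 (e (θ (e.symm (g.1⁻¹ (g.1 (e y)))))) : Q) : S)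
  rw [MulAut.inv_apply_self, MulEquiv.symm_apply_apply]

/-- Two elements which act in the same way on the graph `D` differ by an element of the
centralizer of the range of `D`. -/
theorem IsGraph.inv_mul_mem_centralizer {D E : Subgroup (S × S)} (hE : F.IsGraph E) (hDE : D ≤ E)
    {x y y' : S} (h : (x, y) ∈ normalizer (D : Set (S × S))) (h' : (x, y') ∈ E) :
    y⁻¹ * y' ∈ centralizer (D.cod : Set S) := by
  refine Subgroup.mem_centralizer_iff.2 fun b hb => ?_
  obtain ⟨a, ha⟩ := mem_cod.1 hb
  have h₁ := hDE (conj_mem_of_mem_normalizer h ha)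
  have h₂ := mul_mem (mul_mem h' (hDE ha)) (inv_mem h')
  have h₃ : y * b * y⁻¹ = y' * b * y'⁻¹ := hE.right_unique h₁ h₂
  have h₄ : y⁻¹ * (y * b * y⁻¹) * y' = y⁻¹ * (y' * b * y'⁻¹) * y' := by rw [h₃]
  simpa [mul_assoc] using h₄

/-- Extensions of a graph with centric domain are unique up to conjugation. -/
theorem IsSaturated.exists_map_conj_le [Finite S] [Fact p.Prime] (hS : IsPGroup p S)
    (hF : F.IsSaturated p) {D N E : Subgroup (S × S)} (hD : F.IsCentric D.dom) (hN : F.IsGraph N)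
    (hE : F.IsGraph E) (hDN : D ≤ N) (hDE : D ≤ E) (hND : N ≤ normalizer (D : Set (S × S)))
    (hdom : N.dom ≤ E.dom) : ∃ z ∈ centralizer (D.cod : Set S),
      N.map (MulAut.conj ((1, z) : S × S)).toMonoidHom ≤ E := by
  have hA : F.IsCentric D.cod := hD.of_conj (hN.mono hDN).conj_dom_cod
  -- The composite E ∘ N⁻¹ moves each y by an element of C_S(cod D) ≤ cod D, so it is an
  -- automorphism θ of the range of N that fixes the range of D.
  have hΘ := hN.relInv.relComp hE
  have hΘd : (relComp N.relInv E).dom = N.cod := by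
    rw [dom_relComp (by rwa [cod_relInv]), dom_relInv]
  have hdiff : ∀ y y', (y, y') ∈ relComp N.relInv E →
      y⁻¹ * y' ∈ centralizer (D.cod : Set S) := by
    rintro y y' ⟨x, hx, hx'⟩
    exact hE.inv_mul_mem_centralizer hDE (hND hx) hx'
  have hΘc : (relComp N.relInv E).cod ≤ N.cod := by
    intro y' hy'
    obtain ⟨y, h⟩ := mem_cod.1 hy'
    have h₁ := cod_mono hDN (hA.centralizer_le (hdiff _ _ h))
    have h₂ := hΘd.le (mem_dom.2 ⟨_, h⟩)
    simpa using mul_mem h₂ h₁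
  obtain ⟨φ, hφ, H⟩ := hΘ.exists_hom hΘd hΘc
  have hb : Function.Bijective φ := Finite.injective_iff_bijective.1 (F.injective hφ)
  let θ : MulAut N.cod := MulEquiv.ofBijective φ hb
  have hθ : ∀ x : N.cod, ((x : S), (θ x : S)) ∈ relComp N.relInv E := fun x => (H _).2 ⟨x, rfl⟩
  have hfix : ∀ x : N.cod, (x : S) ∈ D.cod → θ x = x := by
    intro x hx
    obtain ⟨a, ha⟩ := mem_cod.1 hx
    exact Subtype.ext (hΘ.right_unique (hθ x) ⟨a, hDN ha, hDE ha⟩)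
  -- The factor x⁻¹θ(x) lies in cod D and is fixed by θ, so powers of θ only raise it to powers.
  -- Therefore θ has p-power order.
  have hpow : ∀ (k : ℕ) (x : N.cod), (θ ^ k) x = x * (x⁻¹ * θ x) ^ k := by
    intro k x
    induction k with
    | zero => simp
    | succ k ih =>
      have hz : θ (x⁻¹ * θ x) = x⁻¹ * θ x := hfix _ (hA.centralizer_le (hdiff _ _ (hθ x)))
      rw [pow_succ', MulAut.mul_apply, ih, map_mul, map_pow, hz, pow_succ', ← mul_assoc x,
        mul_inv_cancel_left]
  obtain ⟨n, hn⟩ := IsPGroup.iff_card.1 (hS.to_subgroup N.cod)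
  have hone : θ ^ p ^ n = 1 := by
    refine MulEquiv.ext fun x => ?_
    rw [hpow, ← hn, pow_card_eq_one', mul_one]
    rfl
  obtain ⟨K, s, hK, hKd, hKs⟩ := hF.exists_conj_autS (C := N.cod) (θ := θ) hφ hone
  have hDK : (relComp (D.cod.conjGraph 1) K).dom = D.cod := by
    rw [dom_relComp (by rw [cod_conjGraph_one, hKd]; exact cod_mono hDN), dom_conjGraph]
  have hc := ((isGraph_conjGraph D.cod 1).relComp hK).conj_dom_cod
  rw [hDK] at hc
  -- Under K the automorphism θ becomes conjugation by s. As θ fixes cod D, s centralizes its image,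
  -- which is centric and so contains s. The preimage a of s lies in cod D, and θ is conjugation by
  -- a.
  have hs : s ∈ centralizer ((relComp (D.cod.conjGraph 1) K).cod : Set S) := by
    refine Subgroup.mem_centralizer_iff.2 fun t ht => ?_
    obtain ⟨b, b', hbb, hbt⟩ := mem_cod.1 ht
    obtain ⟨hb, rfl⟩ := mem_conjGraph.1 hbb
    simp only [one_mul, inv_one, mul_one] at hbt
    have h := hKs ⟨b, cod_mono hDN hb⟩ t hbt
    rw [hfix _ hb] at h
    have := hK.right_unique hbt h
    rwa [eq_mul_inv_iff_mul_eq] at this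
  obtain ⟨a, a', ha, has⟩ := mem_cod.1 (hA _ hc hs)
  obtain ⟨ha, rfl⟩ := mem_conjGraph.1 ha
  simp only [one_mul, inv_one, mul_one] at has
  have hconj : ∀ y : N.cod, (θ y : S) = a * y * a⁻¹ := by
    intro y
    obtain ⟨t, ht⟩ := mem_dom.1 (hKd.ge y.2)
    exact hK.left_unique (hKs y t ht) (mul_mem (mul_mem has ht) (inv_mem has))
  refine ⟨a, Subgroup.mem_centralizer_iff.2 fun b hb => ?_, ?_⟩
  · have h := hconj ⟨b, cod_mono hDN hb⟩
    rw [hfix _ hb] at h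
    change b = a * b * a⁻¹ at h
    rwa [eq_mul_inv_iff_mul_eq] at h
  · rintro _ ⟨⟨x, y⟩, hxy, rfl⟩
    have hy : y ∈ N.cod := mem_cod.2 ⟨x, hxy⟩
    obtain ⟨x', hx', hE'⟩ := hθ ⟨y, hy⟩
    obtain rfl := hN.left_unique hxy hx'
    rw [hconj ⟨y, hy⟩] at hE'
    change (1 * x * 1⁻¹, a * y * a⁻¹) ∈ E
    simpa using hE'

variable (F) in
/-- The graphs of morphisms between subgroups of `P` and `Q` with centric domain. -/
def orbitGraphs (P Q : Subgroup S) : Set (Subgroup (S × S)) :=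
  {D | F.IsGraph D ∧ F.IsCentric D.dom ∧ D ≤ P.prod Q}

theorem map_conj_mem_orbitGraphs {P Q : Subgroup S} {D : Subgroup (S × S)}
    (hD : D ∈ F.orbitGraphs P Q) {g : S × S} (hg : g ∈ P.prod Q) :
    D.map (MulAut.conj g).toMonoidHom ∈ F.orbitGraphs P Q := by
  refine ⟨hD.1.conj g, hD.2.1.of_conj (conj_dom_map_conj g).symm, ?_⟩
  rintro _ ⟨z, hz, rfl⟩
  exact mul_mem (mul_mem hg (hD.2.2 hz)) (inv_mem hg)

theorem maximal_map_conj {P Q : Subgroup S} {E : Subgroup (S × S)}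
    (hE : Maximal (· ∈ F.orbitGraphs P Q) E) {g : S × S} (hg : g ∈ P.prod Q) :
    Maximal (· ∈ F.orbitGraphs P Q) (E.map (MulAut.conj g).toMonoidHom) := by
  refine ⟨map_conj_mem_orbitGraphs hE.prop hg, fun E' hE' hle => ?_⟩
  have h := Subgroup.map_mono (f := (MulAut.conj g⁻¹).toMonoidHom) hle
  rw [map_conj_map_conj, inv_mul_cancel, map_conj_one] at h
  have h' := Subgroup.map_mono (f := (MulAut.conj g).toMonoidHom)
    (hE.le_of_ge (map_conj_mem_orbitGraphs hE' (inv_mem hg)) h)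
  rwa [map_conj_map_conj, mul_inv_cancel, map_conj_one] at h'

/-- Inside `P × Q`, a graph with centric domain extends to everything that normalizes it. -/
theorem IsSaturated.exists_mem_orbitGraphs [Finite S] (hF : F.IsSaturated p) {P Q : Subgroup S}
    {D : Subgroup (S × S)} (hD : D ∈ F.orbitGraphs P Q) : ∃ E ∈ F.orbitGraphs P Q, D ≤ E ∧
      (P.prod Q ⊓ normalizer (D : Set (S × S))).dom ≤ E.dom := by
  obtain ⟨hg, hc, hle⟩ := hD
  have hA : F.IsCentric D.cod := hc.of_conj hg.conj_dom_cod
  obtain ⟨E, hE, hDE, hEd⟩ := hF.exists_extension hg hA.fullyCentralized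
  -- The extension is cut down to elements x for which some (x, y) in P × Q normalizes D. Its value
  -- at x differs from y ∈ Q by an element of C_S(cod D) ≤ cod D ≤ Q, so the result stays in P × Q.
  have hsub : D ≤ E ⊓ (P.prod Q ⊓ normalizer (D : Set (S × S))).dom.comap (MonoidHom.fst S S) :=
    fun z hz => ⟨hDE hz, mem_dom.2 ⟨z.2, hle hz, Subgroup.le_normalizer hz⟩⟩
  refine ⟨_, ⟨hE.mono inf_le_left, hc.mono (dom_mono hsub), ?_⟩, hsub, fun x hx => ?_⟩
  · rintro ⟨x, y'⟩ ⟨hxy', hx⟩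
    obtain ⟨y, hP, hN⟩ := mem_dom.1 hx
    have h₁ := hA.centralizer_le (hE.inv_mul_mem_centralizer hDE hN hxy')
    have h₂ : D.cod ≤ Q := by
      intro b hb
      obtain ⟨a, ha⟩ := mem_cod.1 hb
      exact (hle ha).2
    exact ⟨hP.1, by simpa using mul_mem hP.2 (h₂ h₁)⟩
  · obtain ⟨y, hy⟩ := mem_dom.1 (hEd.ge (dom_mono inf_le_right hx))
    exact mem_dom.2 ⟨y, hy, hx⟩

theorem IsSaturated.dom_normalizer_le_of_maximal [Finite S] (hF : F.IsSaturated p)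
    {P Q : Subgroup S} {E : Subgroup (S × S)} (hE : Maximal (· ∈ F.orbitGraphs P Q) E) :
    (P.prod Q ⊓ normalizer (E : Set (S × S))).dom ≤ E.dom := by
  obtain ⟨E', hE', hle, hdom⟩ := hF.exists_mem_orbitGraphs hE.prop
  exact hdom.trans (dom_mono (hE.le_of_ge hE' hle))

theorem exists_maximal_orbitGraphs [Finite S] {P Q : Subgroup S} {D : Subgroup (S × S)}
    (hD : D ∈ F.orbitGraphs P Q) : ∃ E, D ≤ E ∧ Maximal (· ∈ F.orbitGraphs P Q) E :=
  (Set.toFinite (F.orbitGraphs P Q)).exists_le_maximal hD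

/-- Maximal extensions of a graph with centric domain are conjugate. -/
theorem IsSaturated.exists_conj_of_maximal [Finite S] [Fact p.Prime] (hS : IsPGroup p S)
    (hF : F.IsSaturated p) {P Q : Subgroup S} (D : Subgroup (S × S))
    (hD : D ∈ F.orbitGraphs P Q) (E₁ E₂ : Subgroup (S × S))
    (hE₁ : Maximal (· ∈ F.orbitGraphs P Q) E₁) (hE₂ : Maximal (· ∈ F.orbitGraphs P Q) E₂)
    (h₁ : D ≤ E₁) (h₂ : D ≤ E₂) :
    ∃ g ∈ P.prod Q ⊓ centralizer (D : Set (S × S)), E₁.map (MulAut.conj g).toMonoidHom = E₂ := by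
  induction D using WellFoundedGT.induction generalizing E₁ E₂ with
  | _ D ih =>
  -- Both maximal graphs are compared with one maximal M above E'. If E is maximal and strictly
  -- above D, then E ∩ N(D) is larger than D and some element centralizing D conjugates it into E'.
  -- The induction hypothesis for this conjugate then relates the conjugate of E to M.
  obtain ⟨E', hE', hDE', hdom⟩ := hF.exists_mem_orbitGraphs hD
  obtain ⟨M, hE'M, hM⟩ := exists_maximal_orbitGraphs hE'
  have key : ∀ E, Maximal (· ∈ F.orbitGraphs P Q) E → D ≤ E →
      ∃ g ∈ P.prod Q ⊓ centralizer (D : Set (S × S)), E.map (MulAut.conj g).toMonoidHom = M := by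
    intro E hE hDE
    rcases hDE.eq_or_lt with rfl | hlt
    · refine ⟨1, one_mem _, ?_⟩
      rw [map_conj_one]
      exact hE.eq_of_le hM.prop (hDE'.trans hE'M)
    have hSS : IsPGroup p (S × S) := by
      obtain ⟨n, hn⟩ := IsPGroup.iff_card.1 hS
      exact IsPGroup.of_card (n := n + n) (by rw [Nat.card_prod, hn, pow_add])
    have hN := Subgroup.lt_inf_normalizer hSS hlt
    obtain ⟨z, hz, hzE⟩ := hF.exists_map_conj_le hS hD.2.1 (hE.prop.1.mono inf_le_left) hE'.1
      hN.le hDE' inf_le_right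
      (le_trans (dom_mono (inf_le_inf_right _ hE.prop.2.2)) hdom)
    have hzQ : ((1, z) : S × S) ∈ P.prod Q := by
      refine ⟨one_mem _, ?_⟩
      obtain ⟨a, ha⟩ := mem_cod.1 ((hD.2.1.of_conj hD.1.conj_dom_cod).centralizer_le hz)
      exact (hD.2.2 ha).2
    have hzD : ((1, z) : S × S) ∈ centralizer (D : Set (S × S)) := by
      refine Subgroup.mem_centralizer_iff.2 fun ⟨a, b⟩ hab => ?_
      refine Prod.ext (by simp) ?_
      exact Subgroup.mem_centralizer_iff.1 hz b (mem_cod.2 ⟨a, hab⟩)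
    set N := (E ⊓ normalizer (D : Set (S × S))).map (MulAut.conj ((1, z) : S × S)).toMonoidHom
    have hDN : D < N := by
      have h := (Subgroup.map_lt_map_iff_of_injective
        (f := (MulAut.conj ((1, z) : S × S)).toMonoidHom) (MulAut.conj _).injective).2 hN
      rwa [map_conj_eq_self hzD] at h
    have hNm : N ∈ F.orbitGraphs P Q :=
      ⟨hE'.1.mono hzE, hD.2.1.mono (dom_mono hDN.le), hzE.trans hE'.2.2⟩
    obtain ⟨g, hg, hgE⟩ := ih N hDN hNm _ M (maximal_map_conj hE hzQ) hM
      (Subgroup.map_mono inf_le_left) (hzE.trans hE'M)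
    refine ⟨g * (1, z), ⟨mul_mem hg.1 hzQ, mul_mem ?_ hzD⟩, ?_⟩
    · exact Subgroup.centralizer_le hDN.le hg.2
    · rw [← map_conj_map_conj, hgE]
  obtain ⟨g₁, hg₁, e₁⟩ := key E₁ hE₁ h₁
  obtain ⟨g₂, hg₂, e₂⟩ := key E₂ hE₂ h₂
  refine ⟨g₂⁻¹ * g₁, mul_mem (inv_mem hg₂) hg₁, ?_⟩
  rw [← map_conj_map_conj, e₁, ← e₂, map_conj_map_conj, inv_mul_cancel, map_conj_one]

end FusionSystem

/-! ### Products in the category of finite formal coproducts -/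

namespace FinCoprod

variable {C : Type u} [Category.{u} C]

/-- If, for all objects `A` and `B` of `C`, the pairs of morphisms into `A` and `B` factor uniquely
through one member of a finite family of such pairs, then `C_⊔` has binary products. -/
theorem hasBinaryProducts_of_exists
    (h : ∀ A B : C, ∃ (n : ℕ) (L : Fin n → C) (f : ∀ k, L k ⟶ A) (g : ∀ k, L k ⟶ B),
      ∀ (T : C) (u : T ⟶ A) (v : T ⟶ B),
        ∃! w : Σ k, (T ⟶ L k), w.2 ≫ f w.1 = u ∧ w.2 ≫ g w.1 = v) :
    HasBinaryProducts (FinCoprod C) := by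
  choose n L f g H using h
  choose w hw hw' using H
  have : ∀ X Y : FinCoprod C, HasLimit (pair X Y) := by
    intro X Y
    have := X.property
    have := Y.property
    -- The components of the product are the families belonging to all pairs of a component of X and
    -- one of Y.
    let Z : FinCoprod C :=
      ⟨⟨Σ (i : X.obj.I) (j : Y.obj.I), Fin (n (X.obj.obj i) (Y.obj.obj j)),
        fun z => L _ _ z.2.2⟩, inferInstanceAs (Finite (Σ (i : X.obj.I) (j : Y.obj.I),
          Fin (n (X.obj.obj i) (Y.obj.obj j))))⟩
    let π₁ : Z ⟶ X := (homEquiv _ _).symm fun z => ⟨z.1, f _ _ z.2.2⟩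
    let π₂ : Z ⟶ Y := (homEquiv _ _).symm fun z => ⟨z.2.1, g _ _ z.2.2⟩
    let lift : ∀ {T : FinCoprod C}, (T ⟶ X) → (T ⟶ Y) → (T ⟶ Z) := fun {T} a b =>
      (homEquiv _ _).symm fun t =>
        let u := homEquiv _ _ a t
        let v := homEquiv _ _ b t
        let c := w _ _ _ u.2 v.2
        ⟨⟨u.1, v.1, c.1⟩, c.2⟩
    have huniq : ∀ {T : FinCoprod C} {a : T ⟶ X} {b : T ⟶ Y} (m : T ⟶ Z), m ≫ π₁ = a →
        m ≫ π₂ = b → m = lift a b := by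
      rintro T _ _ m rfl rfl
      refine ext_family fun t => ?_
      have := hw' _ _ _ ((homEquiv _ _ m t).2 ≫ f _ _ (homEquiv _ _ m t).1.2.2)
        ((homEquiv _ _ m t).2 ≫ g _ _ (homEquiv _ _ m t).1.2.2)
        ⟨(homEquiv _ _ m t).1.2.2, (homEquiv _ _ m t).2⟩ ⟨rfl, rfl⟩
      refine Eq.trans ?_ (congrArg (fun q : Σ k, (T.obj.obj t ⟶ L _ _ k) =>
        (⟨⟨(homEquiv _ _ m t).1.1, (homEquiv _ _ m t).1.2.1, q.1⟩, q.2⟩ :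
          Σ z : Z.obj.I, (T.obj.obj t ⟶ Z.obj.obj z))) this)
      rfl
    refine ⟨⟨⟨BinaryFan.mk π₁ π₂, BinaryFan.isLimitMk (fun s => lift s.fst s.snd) ?_ ?_ ?_⟩⟩⟩
    · intro s
      refine ext_family fun t => Sigma.ext rfl (heq_of_eq ?_)
      exact (hw _ _ _ _ _).1
    · intro s
      refine ext_family fun t => Sigma.ext rfl (heq_of_eq ?_)
      exact (hw _ _ _ _ _).2
    · exact fun s m hm₁ hm₂ => huniq m hm₁ hm₂
  exact hasBinaryProducts_of_hasLimit_pair _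

end FinCoprod

/-! ### Binary products from maximal graphs with centric domain. -/

namespace FusionSystem

open Subgroup

variable {S : Type u} [Group S] {F : FusionSystem S} {p : ℕ}

namespace OrbitCat

/-- The class of a morphism of `F`. -/
def homMk {P Q : F.OrbitCat} (φ : P.subgroup →* Q.subgroup) (hφ : φ ∈ F.hom P.subgroup Q.subgroup) :
    P ⟶ Q :=
  Quotient.mk (innSetoid P.subgroup Q.subgroup) ⟨φ, hφ⟩

theorem homMk_eq_iff {P Q : F.OrbitCat} {φ ψ : P.subgroup →* Q.subgroup}
    {hφ : φ ∈ F.hom P.subgroup Q.subgroup} {hψ : ψ ∈ F.hom P.subgroup Q.subgroup} :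
    homMk φ hφ = homMk ψ hψ ↔
      ∃ q ∈ Q.subgroup, ∀ x : P.subgroup, (ψ x : S) = q * φ x * q⁻¹ := by
  constructor
  · intro h
    obtain ⟨q, hq⟩ := Quotient.exact h
    exact ⟨q, q.2, fun x => congrArg Subtype.val (hq x)⟩
  · rintro ⟨q, hq, h⟩
    exact Quotient.sound ⟨⟨q, hq⟩, fun x => Subtype.ext (h x)⟩

theorem exists_homMk {P Q : F.OrbitCat} (u : P ⟶ Q) : ∃ φ hφ, homMk φ hφ = u := by
  obtain ⟨φ, rfl⟩ := Quotient.exists_rep u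
  exact ⟨φ.1, φ.2, rfl⟩

theorem homMk_comp {P Q R : F.OrbitCat} {φ : P.subgroup →* Q.subgroup}
    {ψ : Q.subgroup →* R.subgroup} (hφ : φ ∈ F.hom P.subgroup Q.subgroup)
    (hψ : ψ ∈ F.hom Q.subgroup R.subgroup) :
    homMk φ hφ ≫ homMk ψ hψ = homMk (ψ.comp φ) (F.comp_mem hφ hψ) := rfl

end OrbitCat

/-- Pairs of morphisms into `P` and `Q` factor uniquely through the maximal graphs in `P × Q`, up
to conjugation. -/
theorem IsSaturated.exists_factorization [Finite S] [Fact p.Prime] (hS : IsPGroup p S)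
    (hF : F.IsSaturated p) (A B : F.OrbitCat) :
    ∃ (n : ℕ) (L : Fin n → F.OrbitCat) (f : ∀ k, L k ⟶ A) (g : ∀ k, L k ⟶ B),
      ∀ (T : F.OrbitCat) (u : T ⟶ A) (v : T ⟶ B),
        ∃! w : Σ k, (T ⟶ L k), w.2 ≫ f w.1 = u ∧ w.2 ≫ g w.1 = v := by
  classical
  let P := A.subgroup
  let Q := B.subgroup
  let X := {E : Subgroup (S × S) // Maximal (· ∈ F.orbitGraphs P Q) E}
  let s : Setoid X :=
    { r := fun E E' => ∃ g ∈ P.prod Q, E.1.map (MulAut.conj g).toMonoidHom = E'.1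
      iseqv :=
        { refl := fun E => ⟨1, one_mem _, map_conj_one _⟩
          symm := by
            rintro E E' ⟨g, hg, h⟩
            refine ⟨g⁻¹, inv_mem hg, ?_⟩
            rw [← h, map_conj_map_conj, inv_mul_cancel, map_conj_one]
          trans := by
            rintro E E' E'' ⟨g, hg, h⟩ ⟨g', hg', h'⟩
            refine ⟨g' * g, mul_mem hg' hg, ?_⟩
            rw [← map_conj_map_conj, h, h'] } }
  have : Finite (Quotient s) := Quotient.finite s
  let ε := (Finite.equivFin (Quotient s)).symm
  let E : Fin (Nat.card (Quotient s)) → Subgroup (S × S) := fun k => (ε k).out.1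
  have hE : ∀ k, Maximal (· ∈ F.orbitGraphs P Q) (E k) := fun k => (ε k).out.2
  have hrep : ∀ E', Maximal (· ∈ F.orbitGraphs P Q) E' →
      ∃ k, ∃ g ∈ P.prod Q, E'.map (MulAut.conj g).toMonoidHom = E k := by
    intro E' hE'
    refine ⟨ε.symm (Quotient.mk s ⟨E', hE'⟩), ?_⟩
    have := Quotient.exact (Quotient.out_eq (Quotient.mk s ⟨E', hE'⟩)).symm
    simp only [E, Equiv.apply_symm_apply]
    exact this
  have hinj : ∀ k k', (∃ g ∈ P.prod Q, (E k).map (MulAut.conj g).toMonoidHom = E k') →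
      k = k' := by
    intro k k' h
    refine ε.injective ?_
    rw [← Quotient.out_eq (ε k), ← Quotient.out_eq (ε k')]
    exact Quotient.sound h
  have hdom : ∀ k, (E k).dom ≤ P := fun k x hx => by
    obtain ⟨y, hy⟩ := mem_dom.1 hx
    exact ((hE k).prop.2.2 hy).1
  have hcod : ∀ k, (E k).cod ≤ Q := fun k x hx => by
    obtain ⟨y, hy⟩ := mem_cod.1 hx
    exact ((hE k).prop.2.2 hy).2
  choose γ hγ Hγ using fun k => (hE k).prop.1.exists_hom rfl (hcod k)
  let L : Fin (Nat.card (Quotient s)) → F.OrbitCat := fun k => ⟨(E k).dom, (hE k).prop.2.1⟩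
  refine ⟨_, L, fun k => OrbitCat.homMk (P := L k) (Subgroup.inclusion (hdom k)) (inclusion_mem _),
    fun k => OrbitCat.homMk (P := L k) (γ k) (hγ k), fun T u v => ?_⟩
  refine existsUnique_of_exists_of_unique ?_ ?_
  · obtain ⟨φ, hφ, rfl⟩ := OrbitCat.exists_homMk u
    obtain ⟨ψ, hψ, rfl⟩ := OrbitCat.exists_homMk v
    -- The pair (u, v) is encoded by the graph of all (φ t, ψ t). A factorization arises from a
    -- maximal graph above it, after conjugation to the chosen representative.
    have hD : relComp (homGraph φ).relInv (homGraph ψ) ∈ F.orbitGraphs P Q := by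
      have hg := (isGraph_homGraph hφ).relInv.relComp (isGraph_homGraph hψ)
      have hd : (relComp (homGraph φ).relInv (homGraph ψ)).dom = (homGraph φ).cod := by
        rw [dom_relComp (by rw [cod_relInv, dom_homGraph, dom_homGraph]), dom_relInv]
      refine ⟨hg, ?_, ?_⟩
      · rw [hd]
        refine T.centric.of_conj ?_
        have := (isGraph_homGraph hφ).conj_dom_cod
        rwa [dom_homGraph] at this
      · rintro ⟨x, y⟩ ⟨t, hx, hy⟩
        exact ⟨cod_homGraph_le _ (mem_cod.2 ⟨t, hx⟩), cod_homGraph_le _ (mem_cod.2 ⟨t, hy⟩)⟩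
    obtain ⟨E', hDE', hE'⟩ := exists_maximal_orbitGraphs hD
    obtain ⟨k, g, hg, hgE⟩ := hrep E' hE'
    have hmem : ∀ t : T.subgroup, (g.1 * φ t * g.1⁻¹, g.2 * ψ t * g.2⁻¹) ∈ E k := by
      intro t
      rw [← hgE]
      exact ⟨((φ t : S), (ψ t : S)), hDE' ⟨t, ⟨t, rfl⟩, ⟨t, rfl⟩⟩, rfl⟩
    let χ : T.subgroup →* (E k).dom :=
      ((MulAut.conj g.1).toMonoidHom.comp (A.subgroup.subtype.comp φ)).codRestrict _
        fun t => mem_dom.2 ⟨_, hmem t⟩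
    have hχ : χ ∈ F.hom T.subgroup (E k).dom := by
      have hh := ((isGraph_homGraph hφ).relComp (isGraph_conjGraph (F := F) P g.1))
      obtain ⟨χ', hχ', H⟩ := hh.exists_hom (P := T.subgroup) (Q := (E k).dom)
        (by
          rw [dom_relComp (by rw [dom_conjGraph]; exact cod_homGraph_le φ), dom_homGraph])
        (by
          rintro y hy
          obtain ⟨x, t, ⟨x', hx'⟩, h⟩ := mem_cod.1 hy
          obtain ⟨-, rfl⟩ := Prod.ext_iff.1 hx'
          obtain ⟨-, rfl⟩ := mem_conjGraph.1 h
          exact mem_dom.2 ⟨_, hmem x'⟩)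
      convert hχ'
      refine MonoidHom.ext fun t => Subtype.ext ?_
      refine hh.right_unique (x := t) ?_ ((H _).2 ⟨t, rfl⟩)
      exact ⟨φ t, ⟨t, rfl⟩, mem_conjGraph.2 ⟨(φ t).2, rfl⟩⟩
    refine ⟨⟨k, OrbitCat.homMk (Q := L k) χ hχ⟩, ?_, ?_⟩
    · rw [OrbitCat.homMk_comp, eq_comm, OrbitCat.homMk_eq_iff]
      exact ⟨g.1, hg.1, fun x => rfl⟩
    · rw [OrbitCat.homMk_comp, eq_comm, OrbitCat.homMk_eq_iff]
      refine ⟨g.2, hg.2, fun x => ?_⟩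
      exact (hE k).prop.1.right_unique ((Hγ k _).2 ⟨χ x, rfl⟩) (hmem x)
  · rintro ⟨k, w⟩ ⟨k', w'⟩ ⟨h₁, h₂⟩ ⟨h₁', h₂'⟩
    obtain ⟨χ, hχ, rfl⟩ := OrbitCat.exists_homMk w
    obtain ⟨χ', hχ', rfl⟩ := OrbitCat.exists_homMk w'
    have e₁ := h₁.trans h₁'.symm
    have e₂ := h₂.trans h₂'.symm
    rw [OrbitCat.homMk_comp, OrbitCat.homMk_comp, OrbitCat.homMk_eq_iff] at e₁ e₂
    obtain ⟨a, ha, hχa⟩ := e₁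
    obtain ⟨b, hb, hχb⟩ := e₂
    have hEχ : ∀ t, ((χ t : S), (γ k (χ t) : S)) ∈ E k := fun t => (Hγ k _).2 ⟨χ t, rfl⟩
    have hEχ' : ∀ t, ((χ' t : S), (γ k' (χ' t) : S)) ∈ E k' := fun t => (Hγ k' _).2 ⟨χ' t, rfl⟩
    have hab : ((a, b) : S × S) ∈ P.prod Q := ⟨ha, hb⟩
    -- D lies in `E k'` and in the (a, b)-conjugate of `E k`. Both are maximal, so they are
    -- conjugate by some c centralizing D, and hence k = k'.
    let D := relComp (homGraph χ').relInv (homGraph ((γ k').comp χ'))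
    have hDE : D ≤ E k' := by
      rintro ⟨x, y⟩ ⟨t, ⟨t₁, h₁⟩, ⟨t₂, h₂⟩⟩
      obtain ⟨h₁, h₁'⟩ := Prod.ext_iff.1 h₁
      obtain ⟨h₂, h₂'⟩ := Prod.ext_iff.1 h₂
      obtain rfl : t₁ = t₂ := Subtype.ext (h₁.trans h₂.symm)
      rw [← show (χ' t₁ : S) = x from h₁', ← show (γ k' (χ' t₁) : S) = y from h₂']
      exact hEχ' t₁
    have hDmem : ∀ t, ((χ' t : S), (γ k' (χ' t) : S)) ∈ D := fun t => ⟨t, ⟨t, rfl⟩, ⟨t, rfl⟩⟩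
    have hD : D ∈ F.orbitGraphs P Q := by
      refine ⟨(hE k').prop.1.mono hDE, ?_, hDE.trans (hE k').prop.2.2⟩
      have hd : D.dom = (homGraph χ').cod := by
        rw [dom_relComp (by rw [cod_relInv, dom_homGraph, dom_homGraph]), dom_relInv]
      rw [hd]
      refine T.centric.of_conj ?_
      have := (isGraph_homGraph hχ').conj_dom_cod
      rwa [dom_homGraph] at this
    have hDE₁ : D ≤ (E k).map (MulAut.conj ((a, b) : S × S)).toMonoidHom := by
      rintro ⟨x, y⟩ ⟨t, ⟨t₁, h₁⟩, ⟨t₂, h₂⟩⟩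
      obtain ⟨h₁, h₁'⟩ := Prod.ext_iff.1 h₁
      obtain ⟨h₂, h₂'⟩ := Prod.ext_iff.1 h₂
      obtain rfl : t₁ = t₂ := Subtype.ext (h₁.trans h₂.symm)
      refine ⟨_, hEχ t₁, Prod.ext ?_ ?_⟩
      · exact (hχa t₁).symm.trans h₁'
      · exact (hχb t₁).symm.trans h₂'
    obtain ⟨c, hc, hcE⟩ := hF.exists_conj_of_maximal hS D hD _ _ (maximal_map_conj (hE k) hab)
      (hE k') hDE₁ hDE
    rw [map_conj_map_conj] at hcE
    obtain rfl := hinj k k' ⟨_, mul_mem hc.1 hab, hcE⟩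
    -- By maximality the first coordinate of c(a, b) lies in the domain of `E k`. As c centralizes
    -- D, conjugation by this coordinate turns χ into χ', so both give the same morphism into `L k`.
    have hn : c * (a, b) ∈ P.prod Q ⊓ normalizer (E k : Set (S × S)) := by
      refine ⟨mul_mem hc.1 hab, Subgroup.mem_normalizer_fintype fun z hz => ?_⟩
      rw [← hcE]
      exact ⟨z, hz, rfl⟩
    have hL := hF.dom_normalizer_le_of_maximal (hE k) (mem_dom.2 ⟨_, hn⟩)
    refine Sigma.ext rfl (heq_of_eq (OrbitCat.homMk_eq_iff.2 ⟨_, hL, fun t => ?_⟩))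
    have h₁ : (χ' t : S) * c.1 = c.1 * χ' t :=
      congrArg Prod.fst (Subgroup.mem_centralizer_iff.1 hc.2 _ (hDmem t))
    have h₂ : (χ' t : S) = a * χ t * a⁻¹ := hχa t
    calc (χ' t : S) = c.1 * χ' t * c.1⁻¹ := by rw [← h₁, mul_inv_cancel_right]
      _ = _ := by rw [h₂]; simp [mul_assoc]

theorem IsSaturated.hasBinaryProducts [Finite S] [Fact p.Prime] (hS : IsPGroup p S)
    (hF : F.IsSaturated p) : HasBinaryProducts (FinCoprod F.OrbitCat) :=
  FinCoprod.hasBinaryProducts_of_exists (hF.exists_factorization hS)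

end FusionSystem

theorem Ideal.span_range_mk_eq_top {k R J K : Type*} [CommRing k] [CommRing R] [Algebra k R]
    (I : Ideal R) {b : J → R} (hb : Submodule.span k (Set.range b) = ⊤) (s : K → J)
    (h : ∀ j, j ∈ Set.range s ∨ b j ∈ I) :
    Submodule.span k (Set.range fun i => Ideal.Quotient.mk I (b (s i))) = ⊤ := by
  have hmap := congrArg (Submodule.map (Ideal.Quotient.mkₐ k I).toLinearMap) hb
  rw [Submodule.map_top, LinearMap.range_eq_top.2 (Ideal.Quotient.mkₐ_surjective k I),
    Submodule.map_span] at hmap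
  rw [eq_top_iff, ← hmap, Submodule.span_le]
  rintro _ ⟨_, ⟨j, rfl⟩, rfl⟩
  rcases h j with ⟨i, rfl⟩ | hj
  · exact Submodule.subset_span ⟨i, rfl⟩
  · have : Ideal.Quotient.mkₐ k I (b j) = 0 := Ideal.Quotient.eq_zero_iff_mem.2 hj
    rw [AlgHom.toLinearMap_apply, this]
    exact zero_mem _

/-! ### Marks of finite formal coproducts -/

namespace FinCoprod

variable {C : Type u} [Category.{u} C]

namespace Classes

theorem mem_closure_single (x : Classes C) :
    x ∈ AddSubmonoid.closure (Set.range fun A : C => mk (single A)) := by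
  obtain ⟨⟨⟨I, obj⟩, hI⟩, rfl⟩ := Quotient.exists_rep x
  change Finite I at hI
  revert hI obj
  refine fun obj hI => Finite.induction_empty_option
    (P := fun I : Type => ∀ (obj : I → C) (hI : Finite I), (mk ⟨⟨I, obj⟩, hI⟩ : Classes C) ∈
      AddSubmonoid.closure (Set.range fun A : C => mk (single A))) ?_ ?_ ?_ I obj hI
  · intro I J e h obj hJ
    have hI := Finite.of_equiv J e.symm
    have := h (fun i => obj (e i)) hI
    rwa [mk_eq_of_equiv (Y := ⟨⟨J, obj⟩, hJ⟩) e fun _ => rfl] at this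
  · intro obj hI
    have : (mk ⟨⟨PEmpty, obj⟩, hI⟩ : Classes C) = 0 :=
      mk_eq_of_equiv (Y := empty C) (Equiv.equivOfIsEmpty PEmpty Empty) fun i => i.elim
    rw [this]
    exact zero_mem _
  · intro I _ h obj hI
    have e : (mk ⟨⟨Option I, obj⟩, hI⟩ : Classes C) =
        mk ⟨⟨I, fun i => obj (some i)⟩, inferInstanceAs (Finite I)⟩ + mk (single (obj none)) :=
      mk_eq_of_equiv (Y := sum ⟨⟨I, fun i => obj (some i)⟩, inferInstanceAs (Finite I)⟩
        (single (obj none))) (Equiv.optionEquivSumPUnit.{0} I) (by rintro (_ | i) <;> rfl)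
    rw [e]
    exact add_mem (h _ _) (AddSubmonoid.subset_closure ⟨_, rfl⟩)

variable [∀ A B : C, Finite (A ⟶ B)]

instance (A : C) (X : FinCoprod C) : Finite (single A ⟶ X) := by
  have := X.property
  have : Finite (single A).obj.I := (single A).property
  exact Finite.of_equiv _ (homEquiv (single A) X).symm

/-- The number of morphisms from an object of `C`. -/
noncomputable def numHom (A : C) : Classes C →+ ℕ where
  toFun := Quotient.lift (fun X => Nat.card (single A ⟶ X)) fun X Y ⟨e⟩ =>
    Nat.card_congr ((Iso.refl (single A)).homCongr e)
  map_zero' := by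
    have : IsEmpty (single A ⟶ empty C) := ⟨fun f => (homEquiv _ _ f PUnit.unit).1.elim⟩
    exact Nat.card_of_isEmpty
  map_add' := by
    rintro ⟨X⟩ ⟨Y⟩
    refine Eq.trans (Nat.card_congr (Equiv.ofBijective (Sum.elim (fun f : single A ⟶ X => f ≫ inl X Y)
      (fun f : single A ⟶ Y => f ≫ inr X Y)) ⟨?_, fun f => ?_⟩)).symm Nat.card_sum
    · rintro (f | f) (g | g) h
      · exact congrArg Sum.inl (inl_cancel h)
      · exact (inl_ne_inr h).elim
      · exact (inl_ne_inr h.symm).elim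
      · exact congrArg Sum.inr (inr_cancel h)
    · rcases single_hom_sum f with ⟨g, hg⟩ | ⟨g, hg⟩
      · exact ⟨Sum.inl g, hg⟩
      · exact ⟨Sum.inr g, hg⟩

theorem numHom_mk_single (A B : C) : numHom A (mk (single B)) = Nat.card (A ⟶ B) := by
  refine Nat.card_congr ((homEquiv (single A) (single B)).trans ?_)
  exact
    { toFun := fun g => (g PUnit.unit).2
      invFun := fun g _ => ⟨PUnit.unit, g⟩
      left_inv := fun _ => rfl
      right_inv := fun _ => rfl }

/-- By the universal property of the product. The numbers of morphisms thus play the role of marks.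
-/
theorem numHom_mul [HasBinaryProducts (FinCoprod C)] (A : C) (x y : Classes C) :
    numHom A (x * y) = numHom A x * numHom A y := by
  induction x using Quotient.inductionOn with | _ X
  induction y using Quotient.inductionOn with | _ Y
  refine Eq.trans (Nat.card_congr ?_) (Nat.card_prod (single A ⟶ X) (single A ⟶ Y))
  exact
    { toFun := fun f => (f ≫ prod.fst, f ≫ prod.snd)
      invFun := fun f => prod.lift f.1 f.2
      left_inv := fun f => by apply Limits.prod.hom_ext <;> simp [prod.lift_fst, prod.lift_snd]
      right_inv := fun f => by simp [prod.lift_fst, prod.lift_snd] }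

/-- The number of morphisms from an object of `C`, on the Grothendieck group. -/
noncomputable def homMark (A : C) : GrothendieckRing (Classes C) →+ ℤ :=
  GrothendieckRing.liftAdd ((Nat.castAddMonoidHom ℤ).comp (numHom A))

theorem homMark_single (A B : C) :
    homMark A (GrothendieckRing.of (mk (single B))) = Nat.card (A ⟶ B) := by
  rw [homMark, GrothendieckRing.liftAdd_of, ← numHom_mk_single]
  rfl

theorem homMark_mul [HasBinaryProducts (FinCoprod C)] (A : C)
    (x y : GrothendieckRing (Classes C)) : homMark A (x * y) = homMark A x * homMark A y := by
  induction x using GrothendieckRing.induction with | _ a a'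
  induction y using GrothendieckRing.induction with | _ b b'
  have h : ∀ a b : Classes C, homMark A (GrothendieckRing.of a * GrothendieckRing.of b) =
      homMark A (GrothendieckRing.of a) * homMark A (GrothendieckRing.of b) := fun a b => by
    rw [← GrothendieckRing.of_mul, homMark, GrothendieckRing.liftAdd_of,
      GrothendieckRing.liftAdd_of, GrothendieckRing.liftAdd_of]
    simp [numHom_mul]
  simp only [mul_sub, sub_mul, map_sub, h]

end Classes

end FinCoprod

/-! ### Marks of the centric Burnside ring and the comparison with A(F)_(p)/N. -/

namespace FusionSystem

open Subgroup

variable {S : Type u} [Group S] {F : FusionSystem S} {p : ℕ}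

namespace OrbitCat

instance [Finite S] : Finite F.OrbitCat :=
  Finite.of_injective OrbitCat.subgroup fun ⟨_, _⟩ ⟨_, _⟩ h => by cases h; rfl

instance [Finite S] (P Q : F.OrbitCat) : Finite (P ⟶ Q) := by
  have : Finite (P.subgroup →* Q.subgroup) := Finite.of_injective _ DFunLike.coe_injective
  exact Quotient.finite (innSetoid (F := F) P.subgroup Q.subgroup)

end OrbitCat

theorem card_graphs_eq_card_hom (Q P : Subgroup S) :
    Nat.card (F.graphs Q P) = Nat.card (F.hom Q P) := by
  symm
  refine Nat.card_congr (Equiv.ofBijective (fun φ : F.hom Q P => (⟨homGraph φ.1,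
    isGraph_homGraph φ.2, dom_homGraph _, cod_homGraph_le _⟩ : F.graphs Q P)) ⟨?_, ?_⟩)
  · intro α β h
    have h' : homGraph α.1 = homGraph β.1 := congrArg Subtype.val h
    refine Subtype.ext (MonoidHom.ext fun x => Subtype.ext ?_)
    refine (isGraph_homGraph (F := F) β.2).right_unique (x := x) ?_ ⟨x, rfl⟩
    rw [← h']
    exact ⟨x, rfl⟩
  · rintro ⟨D, hD, hd, hc⟩
    obtain ⟨φ, hφ, H⟩ := hD.exists_hom hd hc
    refine ⟨⟨φ, hφ⟩, Subtype.ext ?_⟩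
    ext z
    rw [H, mem_homGraph]

/-- The action of `P` on `F(Q, P)` by conjugation. -/
@[reducible]
def homConjAction (F : FusionSystem S) (Q P : Subgroup S) : MulAction P (F.hom Q P) where
  smul a φ := ⟨(MulAut.conj a).toMonoidHom.comp φ.1, F.comp_mem φ.2 (F.conj_mem a _ fun _ => rfl)⟩
  one_smul φ := Subtype.ext (MonoidHom.ext fun x => by
    change 1 * φ.1 x * 1⁻¹ = φ.1 x
    simp)
  mul_smul a b φ := Subtype.ext (MonoidHom.ext fun x => by
    change a * b * φ.1 x * (a * b)⁻¹ = a * (b * φ.1 x * b⁻¹) * a⁻¹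
    group)

/-- Morphisms of the orbit category are the orbits of B on F(A, B). The stabilizer of φ is the
centralizer of φ(A) in B, which is the center of φ(A) because A is centric, so all stabilizers have
order |Z(A)|. -/
theorem card_hom_mul_card [Finite S] (A B : F.OrbitCat) :
    Nat.card (A ⟶ B) * Nat.card B.subgroup =
      Nat.card (F.graphs A.subgroup B.subgroup) * Nat.card (center A.subgroup) := by
  let := homConjAction F A.subgroup B.subgroup
  have : Finite (A.subgroup →* B.subgroup) := Finite.of_injective _ DFunLike.coe_injective
  have hsmul : ∀ (b : B.subgroup) (φ : F.hom A.subgroup B.subgroup) (x : A.subgroup),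
      (b • φ).1 x = b * φ.1 x * b⁻¹ := fun _ _ _ => rfl
  have hstab : ∀ φ : F.hom A.subgroup B.subgroup,
      Nat.card (MulAction.stabilizer B.subgroup φ) = Nat.card (center A.subgroup) := by
    intro φ
    symm
    refine Nat.card_congr (Equiv.ofBijective (fun z : center A.subgroup =>
      (⟨φ.1 z.1, Subtype.ext (MonoidHom.ext fun x => ?_)⟩ :
        MulAction.stabilizer B.subgroup φ)) ⟨?_, ?_⟩)
    · rw [hsmul, ← map_mul, ← Subgroup.mem_center_iff.1 z.2 x, map_mul, mul_inv_cancel_right]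
    · intro z w h
      exact Subtype.ext (F.injective φ.2 (congrArg (fun t => t.1) h))
    · rintro ⟨b, hb⟩
      have hb' : ∀ x, φ.1 x * b = b * φ.1 x := fun x => by
        have h := hsmul b φ x
        rw [MulAction.mem_stabilizer_iff.1 hb] at h
        rwa [eq_mul_inv_iff_mul_eq] at h
      have hconj := (isGraph_homGraph φ.2).conj_dom_cod
      rw [dom_homGraph] at hconj
      have hmem : (b : S) ∈ (homGraph φ.1).cod := by
        refine A.centric _ hconj (Subgroup.mem_centralizer_iff.2 fun y hy => ?_)
        obtain ⟨x, z, hz⟩ := mem_cod.1 hy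
        obtain ⟨-, rfl⟩ := Prod.ext_iff.1 hz
        exact congrArg Subtype.val (hb' z)
      obtain ⟨x, z, hz⟩ := mem_cod.1 hmem
      have hzb : φ.1 z = b := Subtype.ext (Prod.ext_iff.1 hz).2
      refine ⟨⟨z, Subgroup.mem_center_iff.2 fun x => F.injective φ.2 ?_⟩, Subtype.ext hzb⟩
      rw [map_mul, map_mul, hzb, hb']
  have horb : innSetoid (F := F) A.subgroup B.subgroup =
      MulAction.orbitRel B.subgroup (F.hom A.subgroup B.subgroup) := by
    refine Setoid.ext fun φ ψ => ?_
    rw [Setoid.comm']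
    constructor
    · rintro ⟨b, hb⟩
      exact ⟨b, Subtype.ext (MonoidHom.ext fun x => (hb x).symm)⟩
    · rintro ⟨b, hb⟩
      exact ⟨b, fun x => by rw [← hsmul, ← hb]⟩
  have := Fintype.ofFinite (MulAction.orbitRel.Quotient B.subgroup
    (F.hom A.subgroup B.subgroup))
  have e : Nat.card (A ⟶ B) = Nat.card (MulAction.orbitRel.Quotient B.subgroup
      (F.hom A.subgroup B.subgroup)) := by
    change Nat.card (Quotient (innSetoid (F := F) A.subgroup B.subgroup)) = _
    rw [horb]
  rw [e, card_graphs_eq_card_hom, Nat.card_congr (MulAction.selfEquivSigmaOrbitsQuotientStabilizer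
    B.subgroup (F.hom A.subgroup B.subgroup)), Nat.card_sigma, Finset.sum_mul]
  have hterm : ∀ ω : Quotient (MulAction.orbitRel B.subgroup (F.hom A.subgroup B.subgroup)),
      Nat.card (B.subgroup ⧸ MulAction.stabilizer B.subgroup ω.out) *
        Nat.card (center A.subgroup) = Nat.card B.subgroup := fun ω => by
    rw [← hstab ω.out, ← Subgroup.card_eq_card_quotient_mul_card_subgroup]
  rw [Finset.sum_congr rfl fun ω _ => hterm ω, Finset.sum_const, smul_eq_mul, Finset.card_univ,
    Nat.card_eq_fintype_card]

/-- Z(Q) commutes with the diagonal of Q and therefore acts on its fixed points through the second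
factor. The action is free, since stabilizers are graphs. -/
theorem IsCharacteristic.card_center_dvd [Finite S] [Fact p.Prime] (hS : IsPGroup p S)
    {Ω : FinGSet (S × S)} (hΩ : F.IsCharacteristic p Ω) (Q : Subgroup S) :
    Nat.card (center Q) ∣ FinGSet.numFixed (Q.conjGraph 1) Ω := by
  have hcomm : ∀ (z : center Q) (d : S × S), d ∈ Q.conjGraph 1 →
      d * (1, ((z : Q) : S)) = (1, ((z : Q) : S)) * d := by
    rintro z ⟨x, y⟩ hd
    obtain ⟨hx, rfl⟩ := mem_conjGraph.1 hd
    have h : x * ((z : Q) : S) = ((z : Q) : S) * x :=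
      congrArg Subtype.val (Subgroup.mem_center_iff.1 z.2 ⟨x, hx⟩)
    refine Prod.ext (by simp) ?_
    simpa using h
  let : MulAction (center Q) {ω : Ω // ∀ d ∈ Q.conjGraph 1, d • ω = ω} :=
    { smul := fun z ω => ⟨((1, ((z : Q) : S)) : S × S) • ω.1, fun d hd => by
        rw [smul_smul, hcomm z d hd, ← smul_smul, ω.2 d hd]⟩
      one_smul := fun ω => Subtype.ext (one_smul (S × S) ω.1)
      mul_smul := fun z w ω => Subtype.ext (by
        change ((1, (((z * w : center Q) : Q) : S)) : S × S) • ω.1 =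
          ((1, ((z : Q) : S)) : S × S) • ((1, ((w : Q) : S)) : S × S) • ω.1
        rw [smul_smul, Prod.mk_mul_mk, one_mul]
        rfl) }
  have h := ((hS.to_subgroup Q).to_subgroup (center Q)).card_dvd_card_mul
    (X := {ω : Ω // ∀ d ∈ Q.conjGraph 1, d • ω = ω}) ⊥ fun ω => ?_
  · rwa [Subgroup.card_bot, mul_one] at h
  · refine Subgroup.card_le_of_le fun z hz => ?_
    have hz' : ((1, ((z : Q) : S)) : S × S) • ω.1 = ω.1 := congrArg Subtype.val hz
    have := (hΩ.isGraph_stabilizer ω.1).right_unique (MulAction.mem_stabilizer_iff.2 hz')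
      (one_mem _)
    exact Subgroup.mem_bot.2 (Subtype.ext (Subtype.ext this))

variable (F) in
/-- The group `S` as an object of the orbit category. -/
def OrbitCat.top [Finite S] : F.OrbitCat := ⟨⊤, F.isCentric_top⟩

/-- For centric Q one has |(Ω/S)^Q| = |Hom(Q, S)| · |Ω^Δ(Q)| / |Z(Q)| with an integral last factor,
and the left side is prime to p. This makes ξ_S a unit of the product of the marks. -/
theorem IsCharacteristic.not_dvd_card_hom [Finite S] [Fact p.Prime] (hS : IsPGroup p S)
    {Ω : FinGSet (S × S)} (hΩ : F.IsCharacteristic p Ω) (A : F.OrbitCat) :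
    ¬ p ∣ Nat.card (A ⟶ OrbitCat.top F) := by
  obtain ⟨m, hm⟩ := hΩ.card_center_dvd hS A.subgroup
  have h₁ := hΩ.numFixed_rightQuot ⊤ A.subgroup
  have h₂ := card_hom_mul_card A (OrbitCat.top F)
  have h : FinGSet.numFixed A.subgroup (Ω.rightQuot ⊤) = Nat.card (A ⟶ OrbitCat.top F) * m := by
    refine Nat.eq_of_mul_eq_mul_right (Nat.card_pos (α := (⊤ : Subgroup S))) ?_
    rw [h₁, hm, ← mul_assoc, mul_right_comm _ m]
    exact congrArg (· * m) h₂.symm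
  exact fun hd => hΩ.not_dvd_numFixed hS A.subgroup (h ▸ hd.mul_right m)

theorem xi_eq_of_conj {P Q : F.OrbitCat} (h : F.Conj P.subgroup Q.subgroup) :
    F.xi P.subgroup P.centric = F.xi Q.subgroup Q.centric := by
  obtain ⟨φ, hφ, hb⟩ := h
  obtain ⟨he, he'⟩ := F.equiv_mem (MulEquiv.ofBijective φ hb) hφ fun _ => rfl
  let i : P ≅ Q :=
    { hom := OrbitCat.homMk _ he
      inv := OrbitCat.homMk _ he'
      hom_inv_id := by
        rw [OrbitCat.homMk_comp]
        exact OrbitCat.homMk_eq_iff.2 ⟨1, one_mem _, fun x => by simp⟩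
      inv_hom_id := by
        rw [OrbitCat.homMk_comp]
        exact OrbitCat.homMk_eq_iff.2 ⟨1, one_mem _, fun x => by simp⟩ }
  exact congrArg GrothendieckRing.of (FinCoprod.Classes.mk_eq
    (ObjectProperty.isoMk _ ((FormalCoproduct.incl F.OrbitCat).mapIso i)))

/-- The mark `[X] ↦ |Hom(Q, X)|` of the centric Burnside ring. -/
noncomputable def centricMark [Finite S] (Q : F.OrbitCat) : F.centricBurnside →+ ℤ :=
  FinCoprod.Classes.homMark Q

theorem centricMark_xi [Finite S] (Q P : F.OrbitCat) :
    centricMark Q (F.xi P.subgroup P.centric) = Nat.card (Q ⟶ P) :=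
  FinCoprod.Classes.homMark_single Q P

theorem centricMark_mul [Finite S] [HasBinaryProducts (FinCoprod F.OrbitCat)] (Q : F.OrbitCat)
    (x y : F.centricBurnside) : centricMark Q (x * y) = centricMark Q x * centricMark Q y :=
  FinCoprod.Classes.homMark_mul Q x y

theorem closure_xi : AddSubgroup.closure
    (Set.range fun P : F.OrbitCat => F.xi P.subgroup P.centric) = ⊤ := by
  have key : ∀ a : FinCoprod.Classes F.OrbitCat, (GrothendieckRing.of a : F.centricBurnside) ∈
      AddSubgroup.closure (Set.range fun P : F.OrbitCat => F.xi P.subgroup P.centric) := by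
    intro a
    induction FinCoprod.Classes.mem_closure_single a using AddSubmonoid.closure_induction with
    | mem a ha =>
      obtain ⟨A, rfl⟩ := ha
      exact AddSubgroup.subset_closure ⟨A, rfl⟩
    | zero => rw [map_zero]; exact zero_mem _
    | add a b _ _ ha hb => rw [map_add]; exact add_mem ha hb
  set H := AddSubgroup.closure (Set.range fun P : F.OrbitCat => F.xi P.subgroup P.centric)
  -- Additive maps on a Grothendieck group are determined on the classes `of a`, so the quotient map
  -- by `H` vanishes.
  have h : QuotientAddGroup.mk' H = 0 :=
    GrothendieckRing.addHom_ext fun a => (QuotientAddGroup.eq_zero_iff _).2 (key a)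
  rw [← QuotientAddGroup.ker_mk' H, h, AddMonoidHom.ker_zero]

/-- Triangularity: a morphism Q → P is injective, hence |Q| ≤ |P|, and equality makes it an
isomorphism, in which case ξ_Q = ξ_P. -/
theorem eq_zero_of_centricMark [Finite S] (a : F.centricBurnside)
    (h : ∀ Q : F.OrbitCat, centricMark Q a = 0) : a = 0 := by
  refine eq_zero_of_triangular (fun P : F.OrbitCat => F.xi P.subgroup P.centric)
    (fun Q => (centricMark Q).toIntLinearMap) (fun Q => Nat.card Q.subgroup)
    (fun Q P hQP => ?_) (fun P => ?_) (mem_span_int_of_closure closure_xi a) h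
  · have hQP' : centricMark Q (F.xi P.subgroup P.centric) ≠ 0 := hQP
    rw [centricMark_xi] at hQP'
    obtain ⟨u⟩ := (Nat.card_ne_zero.1 (by exact_mod_cast hQP' : Nat.card (Q ⟶ P) ≠ 0)).1
    obtain ⟨φ, hφ, -⟩ := OrbitCat.exists_homMk u
    rcases (Nat.card_le_card_of_injective φ (F.injective hφ)).lt_or_eq with hlt | heq
    · exact Or.inl hlt
    · exact Or.inr (xi_eq_of_conj ⟨φ, hφ,
        (Nat.bijective_iff_injective_and_card φ).2 ⟨F.injective hφ, heq⟩⟩)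
  · change centricMark P (F.xi P.subgroup P.centric) ≠ 0
    rw [centricMark_xi]
    have : Nonempty (P ⟶ P) := ⟨𝟙 P⟩
    exact_mod_cast Nat.card_pos.ne'

variable (F p) in
/-- The marks at the centric subgroups. -/
noncomputable def centricMarks [Fact p.Prime] :
    PLoc p F.burnside →ₐ[ZLoc p] (F.OrbitCat → ZLoc p) :=
  AlgHom.pi fun Q => F.mark p Q.subgroup

/-- Conjugates and overgroups of centric subgroups are centric. So the non-centric subgroups form a
set to which `mem_span_beta` applies. -/
theorem isCentric_of_graphs_nonempty {Q P : Subgroup S} (h : (F.graphs Q P).Nonempty)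
    (hQ : F.IsCentric Q) : F.IsCentric P := by
  obtain ⟨D, hD, rfl, hc⟩ := h
  exact (hQ.of_conj hD.conj_dom_cod).mono hc

theorem centricMarks_beta_eq_zero [Finite S] [Fact p.Prime] {P : Subgroup S}
    (hβ : ∃! b, F.IsStabilization p (PLoc.of p (Burnside.cls (FinGSet.coset P))) b)
    (hP : ¬ F.IsCentric P) : F.centricMarks p (F.beta p P) = 0 := by
  ext Q
  refine mark_beta_eq_zero hβ (Set.not_nonempty_iff_eq_empty.1 fun h => hP ?_)
  exact isCentric_of_graphs_nonempty h Q.centric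

/-- A non-centric P receives no morphism from a centric subgroup, so β_P has zero centric marks.
Conversely, an element with zero centric marks is spanned by such β_P, by `mem_span_beta`. In
particular N is an ideal. -/
theorem ker_centricMarks [Finite S] [Fact p.Prime] (hS : IsPGroup p S)
    (hβ : ∀ P, ∃! b, F.IsStabilization p (PLoc.of p (Burnside.cls (FinGSet.coset P))) b) :
    (RingHom.ker (F.centricMarks p) : Set (PLoc p F.burnside)) = F.nonCentricSpan p := by
  refine subset_antisymm (fun x hx => ?_) ?_
  · refine Submodule.span_mono ?_ (mem_span_beta hS hβ {P | ¬ F.IsCentric P} (fun Q P h hP hQ =>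
      hP (isCentric_of_graphs_nonempty h hQ)) x fun Q hQ => ?_)
    · rintro _ ⟨P, hP, rfl⟩
      exact ⟨P, hP, rfl⟩
    · exact congrFun (show F.centricMarks p x = 0 from hx) ⟨Q, not_not.1 hQ⟩
  · have : F.nonCentricSpan p ≤ LinearMap.ker (F.centricMarks p).toLinearMap := by
      refine Submodule.span_le.2 ?_
      rintro _ ⟨P, hP, rfl⟩
      exact centricMarks_beta_eq_zero (hβ P) hP
    exact this

theorem span_mk_beta [Finite S] [Fact p.Prime] (hS : IsPGroup p S)
    (hβ : ∀ P, ∃! b, F.IsStabilization p (PLoc.of p (Burnside.cls (FinGSet.coset P))) b) :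
    Submodule.span (ZLoc p) (Set.range fun P : F.OrbitCat =>
      Ideal.Quotient.mk (RingHom.ker (F.centricMarks p)) (F.beta p P.subgroup)) = ⊤ := by
  refine Ideal.span_range_mk_eq_top _ (span_beta hS hβ) (OrbitCat.subgroup (F := F)) fun P => ?_
  by_cases hP : F.IsCentric P
  · exact Or.inl ⟨⟨P, hP⟩, rfl⟩
  · exact Or.inr (centricMarks_beta_eq_zero (hβ P) hP)

/-- In the ratio |Hom(Q, P)| / |Hom(Q, S)| the factor |Z(Q)| cancels, and what remains is the
formula for Φ_Q(β_P). -/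
theorem mark_beta_mul_card_hom [Finite S] [Fact p.Prime] {P : F.OrbitCat}
    (hβ : ∃! b, F.IsStabilization p (PLoc.of p (Burnside.cls (FinGSet.coset P.subgroup))) b)
    (Q : F.OrbitCat) : F.mark p Q.subgroup (F.beta p P.subgroup) *
      Nat.card (Q ⟶ OrbitCat.top F) = Nat.card (Q ⟶ P) := by
  have h := mark_beta hβ Q.subgroup
  generalize F.mark p Q.subgroup (F.beta p P.subgroup) = m at h ⊢
  have h₁ := congrArg (Nat.cast : ℕ → ZLoc p) (card_hom_mul_card Q P)
  have h₂ := congrArg (Nat.cast : ℕ → ZLoc p) (card_hom_mul_card Q (OrbitCat.top F))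
  rw [Nat.cast_mul, Nat.cast_mul] at h₁ h₂
  rw [show Nat.card (OrbitCat.top F).subgroup = Nat.card S from
    Nat.card_congr (Subgroup.topEquiv (G := S)).toEquiv] at h₂
  change _ = (Nat.card (F.graphs Q.subgroup ⊤) : ZLoc p) * _ at h₂
  have hne : (Nat.card S * Nat.card P.subgroup : ZLoc p) ≠ 0 := by
    rw [← Nat.cast_mul, Nat.cast_ne_zero]
    exact (Nat.mul_pos Nat.card_pos Nat.card_pos).ne'
  refine mul_right_cancel₀ hne ?_
  linear_combination m * Nat.card P.subgroup * h₂ +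
    (Nat.card (center Q.subgroup) : ZLoc p) * h - Nat.card S * h₁

theorem IsCharacteristic.centric_ringEquiv [Finite S] [Fact p.Prime] (hS : IsPGroup p S)
    {Ω : FinGSet (S × S)} (hΩ : F.IsCharacteristic p Ω)
    [HasBinaryProducts (FinCoprod F.OrbitCat)] :
    IsInvertibleIn (PLoc.of p (F.xi ⊤ F.isCentric_top)) ∧
      ∃! e : (PLoc p F.burnside ⧸ RingHom.ker (F.centricMarks p)) ≃+* PLoc p F.centricBurnside,
        ∀ P : F.OrbitCat, e (Ideal.Quotient.mk _ (F.beta p P.subgroup)) *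
            PLoc.of p (F.xi ⊤ F.isCentric_top) = PLoc.of p (F.xi P.subgroup P.centric) := by
  have hβ := hΩ.existsUnique_isStabilization hS
  let g : PLoc p F.centricBurnside →ₗ[ZLoc p] (F.OrbitCat → ZLoc p) :=
    LinearMap.pi fun Q => PLoc.linExtend p (centricMark Q)
  have hg : ∀ P Q : F.OrbitCat, g (PLoc.of p (F.xi P.subgroup P.centric)) Q =
      Nat.card (Q ⟶ P) := fun P Q => by
    refine (PLoc.linExtend_of (centricMark Q) _).trans ?_
    rw [centricMark_xi, Int.cast_natCast]
  refine existsUnique_ringEquiv_of_pi (J := F.OrbitCat) (Ideal.kerLiftAlg (F.centricMarks p))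
    (Ideal.kerLiftAlg_injective _) g ?_ ?_
    (fun P => Ideal.Quotient.mk _ (F.beta p P.subgroup)) ?_
    (fun P => PLoc.of p (F.xi P.subgroup P.centric)) ?_ (OrbitCat.top F) ?_ ?_
  · rw [injective_iff_map_eq_zero]
    exact fun x hx => PLoc.eq_zero_of_linExtend centricMark eq_zero_of_centricMark
      fun Q => congrFun hx Q
  · intro x y
    ext Q
    exact PLoc.linExtend_mul (centricMark Q) (centricMark_mul Q) x y
  · exact span_mk_beta hS hβ
  · have h := PLoc.span_of_eq_top (p := p) (closure_xi (F := F))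
    rwa [← Set.range_comp] at h
  · rw [Pi.isUnit_iff]
    intro Q
    rw [hg]
    exact ZLoc.isUnit_natCast p (hΩ.not_dvd_card_hom hS Q)
  · intro P
    ext Q
    rw [Pi.mul_apply, hg, hg]
    exact (mark_beta_mul_card_hom (hβ P.subgroup) Q).symm

end FusionSystem
-- The fractions are written multiplied out. `IsInvertibleIn` asserts both the existence of the unit
-- and the invertibility of the denominator, so the equations determine the images of the β_P.
theorem mainTheorem12 (p : ℕ) [Fact p.Prime] :
    (∀ (G : Type u) [Group G] [Finite G] (S : Sylow p G),
      (∀ P : Subgroup S, ∃! b, (fusionOfGroup (S : Subgroup G)).IsStabilization p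
        (PLoc.of p (Burnside.cls (FinGSet.coset P))) b) ∧
      IsInvertibleIn (PLoc.of p (Burnside.pCoset (S : Subgroup G) S.isPGroup')) ∧
      ∃! e : PLoc p (fusionOfGroup (S : Subgroup G)).burnside ≃+* PLoc p (Burnside.pPart p G),
        ∀ P : Subgroup S, e ((fusionOfGroup (S : Subgroup G)).beta p P) *
            PLoc.of p (Burnside.pCoset (S : Subgroup G) S.isPGroup') =
          PLoc.of p (Burnside.pCoset (P.map (S : Subgroup G).subtype)
            ((S.isPGroup'.to_subgroup P).map (S : Subgroup G).subtype))) ∧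
    (∀ (S : Type u) [Group S] [Finite S] (_ : IsPGroup p S) (F : FusionSystem S)
        (_ : F.IsSaturated p),
      (∀ P : Subgroup S, ∃! b, F.IsStabilization p
        (PLoc.of p (Burnside.cls (FinGSet.coset P))) b) ∧
      ∃ N : Ideal (PLoc p F.burnside), (N : Set (PLoc p F.burnside)) = F.nonCentricSpan p ∧
      ∃ _ : HasBinaryProducts (FinCoprod F.OrbitCat),
        IsInvertibleIn (PLoc.of p (F.xi ⊤ F.isCentric_top)) ∧
        ∃! e : (PLoc p F.burnside ⧸ N) ≃+* PLoc p F.centricBurnside,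
          ∀ (P : Subgroup S) (hP : F.IsCentric P),
            e (Ideal.Quotient.mk N (F.beta p P)) * PLoc.of p (F.xi ⊤ F.isCentric_top) =
              PLoc.of p (F.xi P hP)) := by
  refine ⟨fun G _ _ S => ⟨fun P =>
    (isCharacteristic_groupBiset S).existsUnique_isStabilization S.isPGroup' P,
    sylow_stabilization_ringEquiv S⟩, fun S _ _ hS F hF => ?_⟩
  obtain ⟨Ω, hΩ⟩ := hF.exists_isCharacteristic hS
  have := hF.hasBinaryProducts hS
  have hβ := hΩ.existsUnique_isStabilization hS
  obtain ⟨hinv, e, he, hu⟩ := hΩ.centric_ringEquiv hS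
  exact ⟨hβ, RingHom.ker (F.centricMarks p), FusionSystem.ker_centricMarks hS hβ, this, hinv, e,
    fun P hP => he ⟨P, hP⟩, fun e' he' => hu e' fun P => he' P.subgroup P.centric⟩
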